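/- **Setting.** All functions and distributions on $\mathbb T^3=(\mathbb R/2\pi\mathbb Z)^3$ are real-valued, $dx$ is the normalized Lebesgue measure, $e_n=e^{in\cdot x}$, $\langle n\rangle=(1+|n|^2)^{1/2}$, $[\![n]\!]=(\frac34+|n|^2)^{1/2}$. Let $\|f\|_{W^{s,p}}=\|\langle\nabla\rangle^s f\|_{L^p}$, $H^s=W^{s,2}$, $\mathcal H^s=H^s\times H^{s-1}$, and let $V*f=\langle\nabla\rangle^{-\beta}f$ (Bessel potential of order $\beta$). Fix a smooth $\phi:\mathbb R\to[0,1]$ supported in $[-\frac85,\frac85]$ with $\phi\equiv1$ on $[-\frac54,\frac54]$, let $\phi_0(\xi)=\phi(|\xi|)$ and $\phi_j(\xi)=\phi(2^{-j}|\xi|)-\phi(2^{-j+1}|\xi|)$ for $j\ge1$, and let $\mathbf P_j$ be the Littlewood–Paley projector with symbol $\varphi_j=\phi_j/\sum_k\phi_k$. Set $$f\prec g=\sum_{j<k-2}\mathbf P_jf\,\mathbf P_kg,\qquad f\circ g=\sum_{|j-k|\le2}\mathbf P_jf\,\mathbf P_kg,\qquad f\succ g=g\prec f .$$ Fix also $c_0\in\mathbb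 R$. For $\theta>0$ let $f\prec^{(1)}_\theta g$ be the part $\theta k+c_0\le j<k-2$ of $\sum_{j,k}\mathbf P_jf\,\mathbf P_kg$. Let $\mathcal D(t)$ be the Fourier multiplier with symbol $e^{-t/2}\sin(t[\![n]\!])/[\![n]\!]$, $\mathcal I F(t)=\int_0^t\mathcal D(t-t')F(t')\,dt'$, $S(t)(f,g)=\partial_t\mathcal D(t)f+\mathcal D(t)(f+g)$, and $$M_\gamma(w)=2A\gamma\Big|\int_{\mathbb T^3}w\,dx\Big|^{\gamma-2}\int_{\mathbb T^3}w\,dx .$$ Let $\Delta_2(T)=\{(t,t'):0\le t'\le t\le T\}$ and let $\mathcal L_2(\frac32,T)$ be the space of bounded linear operators from $L^{3/2}([0,T];L^2(\mathbb T^3))$ to $L^\infty([0,T];H^{s_3}(\mathbb T^3))$ that are causal, i.e. whose output on $[0,t]$ depends only on the input on $[0,t]$, for every $t$. An *enhanced data set* is $\Xi=(X_0,X_1,Y_0,Y_1,\Psi,:\!\Psi^2\!:,\mathbb A,\mathfrak I)$. Its entries are deterministic and need not be related to each other. It belongs to $\mathcal Y_T=\mathcal Y^{s_1,s_2,\varepsilon}_T$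 if * $(X_0,X_1)\in\mathcal H^{s_1}$ and $(Y_0,Y_1)\in\mathcal H^{s_2}$; * $\Psi\in C([0,T];W^{-\frac12-\varepsilon,\infty})\cap C^1([0,T];W^{-\frac32-\varepsilon,\infty})$ and $:\!\Psi^2\!:\,\in C([0,T];W^{-1-\varepsilon,\infty})$; * $\mathbb A=\mathbb A(t,t')\in L^\infty_{t'}L^3_t(\Delta_2(T);H^{-\varepsilon})$ and $\mathfrak I\in\mathcal L_2(\frac32,T)$. The distance on $\mathcal Y_T$ is the one given by the sum of the corresponding norms. For $T\le1$, data in $\mathcal Y_1$ restrict to data in $\mathcal Y_T$ (a function on $[0,T]$ is extended by zero before $\mathfrak I$ is applied). With $Q_{X,Y}=(X+Y)^2+2X\prec\Psi+2X\succ\Psi+2Y\Psi$ and $N=Q_{X,Y}+2\mathfrak R+:\!\Psi^2\!:$, the focusing system on $[0,T]$ is $$\begin{aligned} (\partial_t^2+\partial_t+1-\Delta)X&=(V*N)\prec\Psi-M_\gamma(N)\Psi,\\ (\partial_t^2+\partial_t+1-\Delta)Y&=(V*N)(X+Y)+(V*N)\succ\Psi+(V*N)\circ\Psi-M_\gamma(N)(X+Y),\\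 \mathfrak R(t)&=\mathcal I\big((V*N)\prec^{(1)}_\theta\Psi\big)(t)\circ\Psi(t)+\mathfrak I(V*N)(t)-\int_0^tM_\gamma(N)(t')\,\mathbb A(t,t')\,dt', \end{aligned}$$ with $(X,\partial_tX,Y,\partial_tY)|_{t=0}=(X_0,X_1,Y_0,Y_1)$. The first two equations are understood in the Duhamel form: $X=S(t)(X_0,X_1)+\mathcal I(\cdots)$, $Y=S(t)(Y_0,Y_1)+\mathcal I(\cdots)$. Solutions are sought in $$Z(T)=X^{s_1}(T)\times X^{s_2}(T)\times L^3([0,T];H^{s_3}),\qquad X^s(T)=C([0,T];H^s)\cap C^1([0,T];H^{s-1}).$$ **Theorem.** Let $-\frac12<s_3<0$. There is $\theta_0=\theta_0(s_3)>0$ such that for every $0<\theta\le\theta_0$ the following holds. Let $\beta\ge2$, $\frac14<s_1<\frac12<s_2<1$ and $\beta>-3s_1+s_2+2$. Then there is $\varepsilon>0$, depending only on $s_1,s_2,s_3,\beta$ and $\theta$ (and on the fixed $\phi,c_0$), such that for all $A\in\mathbb R$ and $2<\gamma\le3$ the focusing system is locally well-posed: for every $\Xi\in\mathcal Y_1$ there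 are $0<T\le1$ and $r>0$ such that 1. for every $\Xi'\in\mathcal Y_T$ at $\mathcal Y_T$-distance less than $r$ from $\Xi$ (in particular for $\Xi'=\Xi$), the system with data $\Xi'$ has a solution in $Z(T)$ on $[0,T]$, and it is the only solution in $Z(T)$; 2. the map that takes $\Xi'$ to this solution is continuous from the $r$-ball around $\Xi$ in $\mathcal Y_T$ to $Z(T)$. -/

import Mathlib

open MeasureTheory Set Filter Topology
open scoped ENNReal

namespace HartreeWave

/-! ### Distributions on the torus and Sobolev spaces

A distribution on `𝕋³` is given by its Fourier coefficients. The torus carries the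
normalized Lebesgue measure, and the characters `e_n` are indexed by `n ∈ ℤ³`. -/

/-- Frequencies: the lattice `ℤ³`. -/
abbrev Freq : Type := Fin 3 → ℤ

/-- A distribution on `𝕋³`, as the family of its Fourier coefficients. -/
abbrev TDist : Type := Freq → ℂ

/-- The normalized Lebesgue measure on `𝕋³`. -/
noncomputable abbrev torusMeasure : Measure (UnitAddTorus (Fin 3)) :=
  Measure.pi fun _ => AddCircle.haarAddCircle

/-- The real space `L^p(𝕋³; ℝ)`. -/
abbrev LpT (p : ℝ≥0∞) : Type := Lp ℝ p torusMeasure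

/-- The Euclidean length `|n|`. -/
noncomputable def freqNorm (n : Freq) : ℝ := Real.sqrt (∑ i, (n i : ℝ) ^ 2)

/-- The bracket `⟨n⟩ = (1 + |n|²)^{1/2}`. -/
noncomputable def bracket (n : Freq) : ℝ := Real.sqrt (1 + freqNorm n ^ 2)

/-- The bracket `⟦n⟧ = (3/4 + |n|²)^{1/2}`. -/
noncomputable def waveBracket (n : Freq) : ℝ := Real.sqrt (3 / 4 + freqNorm n ^ 2)

/-- The real distribution `⟨∇⟩^{-s} g` for `g ∈ L^p(𝕋³; ℝ)`. The map `g ↦ ⟨∇⟩^{-s} g` is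
an isometry of `L^p(𝕋³; ℝ)` onto the space `W^{s,p}(𝕋³; ℝ)`, which is `H^s` for `p = 2`. -/
noncomputable def bessel (s : ℝ) {p : ℝ≥0∞} (g : LpT p) : TDist := fun n =>
  ((bracket n ^ (-s) : ℝ) : ℂ) * UnitAddTorus.mFourierCoeff (fun x => ((g x : ℝ) : ℂ)) n

/-- `u ∈ W^{s,p}(𝕋³; ℝ)`. -/
def MemSob (s : ℝ) (p : ℝ≥0∞) (u : TDist) : Prop := ∃ g : LpT p, u = bessel s g

/-- The norm `‖u‖_{W^{s,p}} = ‖⟨∇⟩^s u‖_{L^p}`, infinite if `u ∉ W^{s,p}(𝕋³; ℝ)`. -/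
noncomputable def sobNorm (s : ℝ) (p : ℝ≥0∞) (u : TDist) : ℝ≥0∞ :=
  ⨅ (g : LpT p) (_ : u = bessel s g), eLpNorm g p torusMeasure

/-! ### Distribution-valued functions of time -/

/-- Lebesgue measure on `[0, T]`. -/
noncomputable def timeMeasure (T : ℝ) : Measure ℝ := volume.restrict (Icc 0 T)

/-- `u ∈ C([0, T]; W^{s,p})`. -/
def MemC (T s : ℝ) (p : ℝ≥0∞) [Fact (1 ≤ p)] (u : ℝ → TDist) : Prop :=
  ∃ U : ℝ → LpT p, ContinuousOn U (Icc 0 T) ∧ ∀ t ∈ Icc 0 T, u t = bessel s (U t)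

/-- `u ∈ C¹([0, T]; W^{s,p})`. -/
def MemC1 (T s : ℝ) (p : ℝ≥0∞) [Fact (1 ≤ p)] (u : ℝ → TDist) : Prop :=
  ∃ U : ℝ → LpT p, ContDiffOn ℝ 1 U (Icc 0 T) ∧ ∀ t ∈ Icc 0 T, u t = bessel s (U t)

/-- `u ∈ L^q([0, T]; H^s)`. -/
def MemLq (T : ℝ) (q : ℝ≥0∞) (s : ℝ) (u : ℝ → TDist) : Prop :=
  ∃ U : ℝ → LpT 2, MemLp U q (timeMeasure T) ∧ ∀ᵐ t ∂timeMeasure T, u t = bessel s (U t)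

/-- The time derivative on `[0, T]`, one-sided at the end points. -/
noncomputable def timeDeriv (T : ℝ) (u : ℝ → TDist) (t : ℝ) : TDist := fun n =>
  derivWithin (fun τ => u τ n) (Icc 0 T) t

/-- The norm of `C([0, T]; W^{s,p})`. -/
noncomputable def normC (T s : ℝ) (p : ℝ≥0∞) (u : ℝ → TDist) : ℝ≥0∞ :=
  ⨆ t ∈ Icc 0 T, sobNorm s p (u t)

/-- The norm of `C([0, T]; W^{s,p}) ∩ C¹([0, T]; W^{s-1,p})`. -/
noncomputable def normC1 (T s : ℝ) (p : ℝ≥0∞) (u : ℝ → TDist) : ℝ≥0∞ :=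
  normC T s p u + normC T (s - 1) p (timeDeriv T u)

/-- The norm of `L^q([0, T]; H^s)`. -/
noncomputable def normLq (T : ℝ) (q : ℝ≥0∞) (s : ℝ) (u : ℝ → TDist) : ℝ≥0∞ :=
  eLpNorm (fun t => sobNorm s 2 (u t)) q (timeMeasure T)

/-- The triangle `Δ₂(T)` of pairs `(t, t')` with `0 ≤ t' ≤ t ≤ T`. -/
def triangle (T : ℝ) : Set (ℝ × ℝ) := {p | 0 ≤ p.2 ∧ p.2 ≤ p.1 ∧ p.1 ≤ T}

/-- The norm of `L^∞_{t'} L³_t(Δ₂(T); H^s)`. -/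
noncomputable def normKernel (T s : ℝ) (K : ℝ → ℝ → TDist) : ℝ≥0∞ :=
  eLpNorm (fun t' => eLpNorm (fun t => sobNorm s 2 (K t t')) 3 (volume.restrict (Icc t' T)))
    ∞ (timeMeasure T)

/-- `K ∈ L^∞_{t'} L³_t(Δ₂(T); H^s)`, where `K t t'` is the value at `(t, t')`. -/
def MemKernel (T s : ℝ) (K : ℝ → ℝ → TDist) : Prop :=
  (∃ k : ℝ × ℝ → LpT 2, AEStronglyMeasurable k (volume.restrict (triangle T)) ∧
    ∀ᵐ z ∂volume.restrict (triangle T), K z.1 z.2 = bessel s (k z)) ∧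
  normKernel T s K < ∞

instance factOneLeThreeHalves : Fact ((1 : ℝ≥0∞) ≤ 3 / 2) :=
  ⟨by rw [ENNReal.le_div_iff_mul_le (by simp) (by simp)]; norm_num⟩

/-- The space `𝓛(L^{3/2}([0, 1]; L²(𝕋³)); L^∞([0, 1]; H^s(𝕋³)))` of bounded linear operators.
The space `H^s(𝕋³)` is identified with `L²(𝕋³)` by the isometry `⟨∇⟩^s`, that is, the value
of the operator at `W` is the distribution-valued function `t ↦ bessel s (J W t)`. -/
abbrev ParaOp : Type :=
  Lp (LpT 2) (3 / 2) (timeMeasure 1) →L[ℝ] Lp (LpT 2) ∞ (timeMeasure 1)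

/-- The operator is causal: `J W` on `[0, t]` depends only on `W` on `[0, t]`. -/
def Causal (J : ParaOp) : Prop :=
  ∀ t ∈ Icc (0 : ℝ) 1, ∀ W : Lp (LpT 2) (3 / 2) (timeMeasure 1),
    (∀ᵐ τ ∂timeMeasure t, W τ = 0) → ∀ᵐ τ ∂timeMeasure t, J W τ = 0

/-- The norm in `𝓛(L^{3/2}([0, T]; L²); L^∞([0, T]; H^s))` of the restriction of `J` to
`[0, T]`, for `T ≤ 1`. A function on `[0, T]` is extended by zero. -/
noncomputable def normOp (T : ℝ) (J : ParaOp) : ℝ≥0∞ :=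
  ⨆ (W : Lp (LpT 2) (3 / 2) (timeMeasure 1))
    (_ : ∀ᵐ τ ∂timeMeasure 1, T < τ → W τ = 0),
    eLpNorm (J W) ∞ (timeMeasure T) / eLpNorm W (3 / 2) (timeMeasure T)

/-! ### Products and paraproducts -/

/-- A smooth bump function `φ : ℝ → [0, 1]`, supported on `[-8/5, 8/5]` and equal to `1`
on `[-5/4, 5/4]`. -/
structure IsBump (φ : ℝ → ℝ) : Prop where
  smooth : ContDiff ℝ (⊤ : ℕ∞) φ
  range : ∀ r, φ r ∈ Icc (0 : ℝ) 1
  supp : tsupport φ ⊆ Icc (-(8 / 5)) (8 / 5)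
  one : ∀ r ∈ Icc (-(5 / 4) : ℝ) (5 / 4), φ r = 1

/-- The dyadic functions `φ_j`, as functions of `|ξ|`. -/
noncomputable def dyadic (φ : ℝ → ℝ) : ℕ → ℝ → ℝ
  | 0, r => φ r
  | j + 1, r => φ (r / 2 ^ (j + 1)) - φ (r / 2 ^ j)

/-- The symbol `φ_j / ∑ₖ φ_k` of the Littlewood-Paley projector `P_j`. -/
noncomputable def lpSymbol (φ : ℝ → ℝ) (j : ℕ) (n : Freq) : ℝ :=
  dyadic φ j (freqNorm n) / ∑' k, dyadic φ k (freqNorm n)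

/-- The bilinear operator with symbol `σ(n₁, n₂)`:
`∑_n e_n ∑_{n = n₁ + n₂} σ(n₁, n₂) f̂(n₁) ĝ(n₂)`. -/
noncomputable def bilin (σ : Freq → Freq → ℝ) (f g : TDist) : TDist := fun n =>
  ∑' m, (σ m (n - m) : ℂ) * f m * g (n - m)

open Classical in
/-- The symbol of `∑ P_j f P_k g`, the sum being over the pairs `(j, k)` in `S`. -/
noncomputable def pairSymbol (φ : ℝ → ℝ) (S : Set (ℕ × ℕ)) (n₁ n₂ : Freq) : ℝ :=
  ∑' z : ℕ × ℕ, if z ∈ S then lpSymbol φ z.1 n₁ * lpSymbol φ z.2 n₂ else 0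

/-- The product `f g`. -/
noncomputable def prodT (f g : TDist) : TDist := bilin (fun _ _ => 1) f g

/-- The paraproduct of `g` by `f`: the part `j < k - 2` of the product `f g`. -/
noncomputable def paraLow (φ : ℝ → ℝ) (f g : TDist) : TDist :=
  bilin (pairSymbol φ {z | z.1 + 2 < z.2}) f g

/-- The paraproduct of `f` by `g`: the part `k < j - 2` of the product `f g`. -/
noncomputable def paraHigh (φ : ℝ → ℝ) (f g : TDist) : TDist :=
  bilin (pairSymbol φ {z | z.2 + 2 < z.1}) f g

/-- The resonant product: the part `|j - k| ≤ 2` of the product `f g`. -/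
noncomputable def resonant (φ : ℝ → ℝ) (f g : TDist) : TDist :=
  bilin (pairSymbol φ {z | z.1 ≤ z.2 + 2 ∧ z.2 ≤ z.1 + 2}) f g

/-- The part `θ k + c₀ ≤ j < k - 2` of the product `f g`. -/
noncomputable def paraLowCut (φ : ℝ → ℝ) (θ c₀ : ℝ) (f g : TDist) : TDist :=
  bilin (pairSymbol φ {z | θ * z.2 + c₀ ≤ z.1 ∧ z.1 + 2 < z.2}) f g

/-! ### Linear operators and the taming term -/

/-- Convolution with the Bessel potential of order `β`: `V * f = ⟨∇⟩^{-β} f`. -/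
noncomputable def besselConv (β : ℝ) (f : TDist) : TDist := fun n =>
  ((bracket n ^ (-β) : ℝ) : ℂ) * f n

/-- The symbol of the damped wave propagator `𝓓(t)`. -/
noncomputable def propagator (t : ℝ) (n : Freq) : ℝ :=
  Real.exp (-(t / 2)) * (Real.sin (t * waveBracket n) / waveBracket n)

/-- The linear evolution `S(t)(f, g) = ∂_t 𝓓(t) f + 𝓓(t) (f + g)`. -/
noncomputable def linEvol (f g : TDist) (t : ℝ) : TDist := fun n =>
  ((deriv (fun τ => propagator τ n) t : ℝ) : ℂ) * f n + (propagator t n : ℂ) * (f n + g n)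

/-- The Duhamel operator `𝓘 = (∂_t² + ∂_t + 1 - Δ)^{-1}`:
`𝓘 F (t) = ∫_0^t 𝓓(t - t') F(t') dt'`. -/
noncomputable def duhamel (F : ℝ → TDist) (t : ℝ) : TDist := fun n =>
  ∫ t' in (0 : ℝ)..t, (propagator (t - t') n : ℂ) * F t' n

/-- `M_γ(w) = 2 A γ |∫ w dx|^{γ-2} ∫ w dx`. The integral is the zeroth Fourier coefficient. -/
noncomputable def taming (A γ : ℝ) (w : TDist) : ℂ :=
  ((2 * A * γ * ‖w 0‖ ^ (γ - 2) : ℝ) : ℂ) * w 0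

/-- All Fourier coefficients of `F` are integrable on `[0, T]`. -/
def CoeffIntegrable (T : ℝ) (F : ℝ → TDist) : Prop :=
  ∀ n, IntervalIntegrable (fun t => F t n) volume 0 T

/-! ### Enhanced data -/

/-- Enhanced data `(X₀, X₁, Y₀, Y₁, Ψ, :Ψ²:, 𝔸, 𝔍)`. -/
structure EnhancedData where
  X₀ : TDist
  X₁ : TDist
  Y₀ : TDist
  Y₁ : TDist
  Ψ : ℝ → TDist
  Ψsq : ℝ → TDist
  K : ℝ → ℝ → TDist
  J : ParaOp

/-- The enhanced data belong to the class `𝓨_T^{s₁,s₂,ε}`. -/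
structure EnhancedData.Mem (T s₁ s₂ ε : ℝ) (Ξ : EnhancedData) : Prop where
  X₀ : MemSob s₁ 2 Ξ.X₀
  X₁ : MemSob (s₁ - 1) 2 Ξ.X₁
  Y₀ : MemSob s₂ 2 Ξ.Y₀
  Y₁ : MemSob (s₂ - 1) 2 Ξ.Y₁
  Ψ_C : MemC T (-(1 / 2) - ε) ∞ Ξ.Ψ
  Ψ_C1 : MemC1 T (-(3 / 2) - ε) ∞ Ξ.Ψ
  Ψsq : MemC T (-1 - ε) ∞ Ξ.Ψsq
  K : MemKernel T (-ε) Ξ.K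
  J : Causal Ξ.J

/-- The distance of two enhanced data in `𝓨_T^{s₁,s₂,ε}`. -/
noncomputable def EnhancedData.dist (T s₁ s₂ ε : ℝ) (Ξ Ξ' : EnhancedData) : ℝ≥0∞ :=
  sobNorm s₁ 2 (Ξ.X₀ - Ξ'.X₀) + sobNorm (s₁ - 1) 2 (Ξ.X₁ - Ξ'.X₁)
    + sobNorm s₂ 2 (Ξ.Y₀ - Ξ'.Y₀) + sobNorm (s₂ - 1) 2 (Ξ.Y₁ - Ξ'.Y₁)
    + normC1 T (-(1 / 2) - ε) ∞ (Ξ.Ψ - Ξ'.Ψ)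
    + normC T (-1 - ε) ∞ (Ξ.Ψsq - Ξ'.Ψsq)
    + normKernel T (-ε) (Ξ.K - Ξ'.K)
    + normOp T (Ξ.J - Ξ'.J)

/-! ### The system -/

/-- A triple `(X, Y, 𝔑)` of distribution-valued functions of time. -/
structure Triple where
  X : ℝ → TDist
  Y : ℝ → TDist
  R : ℝ → TDist

/-- The triple belongs to
`Z^{s₁,s₂,s₃}(T) = X^{s₁}(T) × X^{s₂}(T) × L³([0, T]; H^{s₃})`, where
`X^s(T) = C([0, T]; H^s) ∩ C¹([0, T]; H^{s-1})`. -/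
structure Triple.Mem (T s₁ s₂ s₃ : ℝ) (u : Triple) : Prop where
  X_C : MemC T s₁ 2 u.X
  X_C1 : MemC1 T (s₁ - 1) 2 u.X
  Y_C : MemC T s₂ 2 u.Y
  Y_C1 : MemC1 T (s₂ - 1) 2 u.Y
  R : MemLq T 3 s₃ u.R

/-- The distance in `Z^{s₁,s₂,s₃}(T)`. -/
noncomputable def Triple.dist (T s₁ s₂ s₃ : ℝ) (u v : Triple) : ℝ≥0∞ :=
  normC1 T s₁ 2 (u.X - v.X) + normC1 T s₂ 2 (u.Y - v.Y) + normLq T 3 s₃ (u.R - v.R)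

/-- Equality as elements of `Z^{s₁,s₂,s₃}(T)`. -/
def Triple.EqOn (T : ℝ) (u v : Triple) : Prop :=
  (∀ t ∈ Icc 0 T, u.X t = v.X t) ∧ (∀ t ∈ Icc 0 T, u.Y t = v.Y t) ∧
    ∀ᵐ t ∂timeMeasure T, u.R t = v.R t

/-- `Q_{X,Y} + 2 𝔑 + :Ψ²:`, the Wick square of `Ψ + X + Y`, where
`Q_{X,Y} = (X + Y)² + 2 (part of X Ψ with j < k - 2) + 2 (part of X Ψ with k < j - 2) + 2 Y Ψ`. -/
noncomputable def wickSquare (φ : ℝ → ℝ) (Ξ : EnhancedData) (u : Triple) (t : ℝ) : TDist :=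
  (prodT (u.X t + u.Y t) (u.X t + u.Y t)
      + (2 : ℂ) • paraLow φ (u.X t) (Ξ.Ψ t) + (2 : ℂ) • paraHigh φ (u.X t) (Ξ.Ψ t)
      + (2 : ℂ) • prodT (u.Y t) (Ξ.Ψ t))
    + (2 : ℂ) • u.R t + Ξ.Ψsq t

/-- The right-hand side of the `X`-equation. -/
noncomputable def forceX (φ : ℝ → ℝ) (β A γ : ℝ) (Ξ : EnhancedData) (u : Triple) (t : ℝ) :
    TDist :=
  paraLow φ (besselConv β (wickSquare φ Ξ u t)) (Ξ.Ψ t)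
    - taming A γ (wickSquare φ Ξ u t) • Ξ.Ψ t

/-- The right-hand side of the `Y`-equation. -/
noncomputable def forceY (φ : ℝ → ℝ) (β A γ : ℝ) (Ξ : EnhancedData) (u : Triple) (t : ℝ) :
    TDist :=
  prodT (besselConv β (wickSquare φ Ξ u t)) (u.X t + u.Y t)
    + (paraHigh φ (besselConv β (wickSquare φ Ξ u t)) (Ξ.Ψ t)
      + resonant φ (besselConv β (wickSquare φ Ξ u t)) (Ξ.Ψ t))
    - taming A γ (wickSquare φ Ξ u t) • (u.X t + u.Y t)

/-- The integrand of the operator `𝔍⁽¹⁾ = 𝓘 (· ⋅ Ψ)`, restricted to `θ k + c₀ ≤ j < k - 2`,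
at `V * (Q_{X,Y} + 2 𝔑 + :Ψ²:)`. -/
noncomputable def forceCut (φ : ℝ → ℝ) (θ c₀ β : ℝ) (Ξ : EnhancedData) (u : Triple) (t : ℝ) :
    TDist :=
  paraLowCut φ θ c₀ (besselConv β (wickSquare φ Ξ u t)) (Ξ.Ψ t)

/-- The triple solves the focusing system on `[0, T]` with enhanced data `Ξ`, in the Duhamel
formulation. In `R_eq`, `W` is the function `V * (Q_{X,Y} + 2 𝔑 + :Ψ²:)` on `[0, T]` as an
element of `L^{3/2}([0, T]; L²)`, extended by zero to `[0, 1]`. -/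
structure IsSolution (φ : ℝ → ℝ) (θ c₀ β A γ s₃ T : ℝ) (Ξ : EnhancedData) (u : Triple) :
    Prop where
  X_int : CoeffIntegrable T (forceX φ β A γ Ξ u)
  X_eq : ∀ t ∈ Icc 0 T, u.X t = linEvol Ξ.X₀ Ξ.X₁ t + duhamel (forceX φ β A γ Ξ u) t
  Y_int : CoeffIntegrable T (forceY φ β A γ Ξ u)
  Y_eq : ∀ t ∈ Icc 0 T, u.Y t = linEvol Ξ.Y₀ Ξ.Y₁ t + duhamel (forceY φ β A γ Ξ u) t
  R_int_cut : CoeffIntegrable T (forceCut φ θ c₀ β Ξ u)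
  R_int_K : ∀ᵐ t ∂timeMeasure T,
    CoeffIntegrable t (fun t' => taming A γ (wickSquare φ Ξ u t') • Ξ.K t t')
  R_eq : ∃ W : Lp (LpT 2) (3 / 2) (timeMeasure 1),
    (∀ᵐ t ∂timeMeasure 1, T < t → W t = 0) ∧
    (∀ᵐ t ∂timeMeasure T, besselConv β (wickSquare φ Ξ u t) = bessel 0 (W t)) ∧
    ∀ᵐ t ∂timeMeasure T, u.R t =
      resonant φ (duhamel (forceCut φ θ c₀ β Ξ u) t) (Ξ.Ψ t)
        + bessel s₃ (Ξ.J W t)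
        - (fun n => ∫ t' in (0 : ℝ)..t, taming A γ (wickSquare φ Ξ u t') * Ξ.K t t' n)

end HartreeWave

/-! The operator ⟨∇⟩^s identifies every H^s with one real space L². The unknowns then become paths
in L², and each nonlinear term becomes a bounded multilinear map of unknowns and data, apart from
the scalar factor M_γ. It remains to count derivatives, so that these maps are bounded, and to find
a contraction whose small factor is a power of the length of the time interval.

Derivatives. One auxiliary exponent p governs the count: Q + 2ℜ is placed in H^{-(β-p)}, so V * (Q +
2ℜ) is in H^p. The square (X + Y)² lands in H^{-(β-p)} if β - p + 2s₁ > 3/2, and the product of V *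
(Q + 2ℜ) with X + Y lands in H^{s₂-1} if 1 - s₂ + p + s₁ > 3/2. These two conditions on p are
compatible exactly when β > -3s₁ + s₂ + 2 (`exists_admissible`). Then V * N is in H^{3/4}, so its
high-low and resonant products with Ψ are in L². The low-high paraproduct only has the regularity of
Ψ, which suffices for X because s₁ < 1/2. In the equation for ℜ the cut θk + c₀ ≤ j bounds the low
frequency from below by a power of the high one, so the 3/4 derivative of V * N yields a gain
proportional to θ. After the Duhamel integral this term is in H^{1/2+θ/4}, and since ε ≤ θ/8 its
resonant product with Ψ is in L².

Products with W^{-a,∞}. A bounded ψ acts on L² as multiplication, with Toeplitz matrix ψ̂(n-m) and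
norm at most ‖ψ‖_∞. Multiplying the entries by c(n-m), where c is the Fourier transform of an
integrable function, costs at most the L¹ norm of that function. So the Littlewood-Paley blocks of
⟨∇⟩^a ψ act on L² with norm O(2^{ak}), and a geometric sum over pairs of blocks gives every
paraproduct estimate (`IsBump.exists_para`). Products of two Sobolev functions come from
Cauchy-Schwarz and Young on the Fourier side (`exists_prod`).

Time. The unknown ℜ is only in L³ in time. The Wick square N is linear in ℜ, and M_γ(N) is at most
quadratic because γ ≤ 3. So all forces are in L^{3/2} in time, and Hölder to L¹ yields τ^{1/3} (the
class `Tame`). The wave propagator turns L¹ in time into a gain of one derivative, 𝔍 maps L^{3/2} to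
L^∞, and the kernel 𝔸 maps L¹ to L³ by Minkowski. Altogether one Picard step is Lipschitz in the
unknowns with constant O(τ^{1/3}) on bounded sets (`Model.exists_step_close`).

Existence is Banach's theorem in a ball. Uniqueness in all of Z(T) needs in addition that every
solution stays in that ball. By causality of 𝔍 the estimates hold on each [0, τ], and the size of a
solution up to time τ is continuous in τ, so a continuity argument applies
(`Model.IsSol.close_zero`). The same difference estimate gives Lipschitz dependence on the data. The
time T depends only on the size of the data, hence one T serves a whole ball of data. Finally
`Model.Represents.isSolution_iff` transfers everything from the L² picture to the focusing system.
-/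

namespace HartreeWave

/-! ### Fourier coefficients of real functions on the torus -/

section FourierCoefficients

open UnitAddTorus ComplexConjugate

/-- The Fourier coefficients of a real function. -/
noncomputable def coef {p : ℝ≥0∞} (g : LpT p) : TDist := fun n =>
  mFourierCoeff (fun x => ((g x : ℝ) : ℂ)) n

lemma bessel_apply {s : ℝ} {p : ℝ≥0∞} (g : LpT p) (n : Freq) :
    bessel s g n = ((bracket n ^ (-s) : ℝ) : ℂ) * coef g n := rfl

lemma mFourierCoeff_torus (f : UnitAddTorus (Fin 3) → ℂ) (n : Freq) :
    mFourierCoeff f n = ∫ t, mFourier (-n) t * f t ∂torusMeasure := rfl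

lemma integrable_mFourier_mul {f : UnitAddTorus (Fin 3) → ℂ} (hf : Integrable f torusMeasure)
    (n : Freq) : Integrable (fun t => mFourier n t * f t) torusMeasure := by
  refine hf.bdd_mul (c := 1) (mFourier n).continuous.aestronglyMeasurable ?_
  filter_upwards with x
  calc ‖mFourier n x‖ ≤ ‖mFourier n‖ := (mFourier n).norm_coe_le_norm x
    _ ≤ 1 := mFourier_norm.le

lemma integrable_coe {p : ℝ≥0∞} [Fact (1 ≤ p)] (g : LpT p) :
    Integrable (fun x => ((g x : ℝ) : ℂ)) torusMeasure :=
  ((Lp.memLp g).integrable Fact.out).ofReal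

lemma coef_congr {p q : ℝ≥0∞} {g : LpT p} {h : LpT q} (hgh : g =ᵐ[torusMeasure] h) :
    coef g = coef h := by
  funext n
  refine integral_congr_ae ?_
  have : (g : _ → ℝ) =ᵐ[torusMeasure] h := hgh
  filter_upwards [this] with x hx
  rw [hx]

lemma coef_add {p : ℝ≥0∞} [Fact (1 ≤ p)] (g h : LpT p) : coef (g + h) = coef g + coef h := by
  funext n
  simp only [coef, mFourierCoeff_torus, Pi.add_apply]
  rw [← integral_add (integrable_mFourier_mul (integrable_coe g) _)
    (integrable_mFourier_mul (integrable_coe h) _)]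
  refine integral_congr_ae ?_
  filter_upwards [Lp.coeFn_add g h] with x hx
  rw [hx]; simp; ring

lemma coef_smul {p : ℝ≥0∞} [Fact (1 ≤ p)] (c : ℝ) (g : LpT p) :
    coef (c • g) = (c : ℂ) • coef g := by
  funext n
  simp only [coef, mFourierCoeff_torus, Pi.smul_apply, smul_eq_mul]
  rw [← integral_const_mul]
  refine integral_congr_ae ?_
  filter_upwards [Lp.coeFn_smul c g] with x hx
  rw [hx]; simp; ring

lemma coef_neg {p : ℝ≥0∞} [Fact (1 ≤ p)] (g : LpT p) : coef (-g) = -coef g := by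
  have := coef_smul (-1) g
  simpa using this

lemma coef_sub {p : ℝ≥0∞} [Fact (1 ≤ p)] (g h : LpT p) : coef (g - h) = coef g - coef h := by
  rw [sub_eq_add_neg, coef_add, coef_neg, sub_eq_add_neg]

lemma coef_neg_freq {p : ℝ≥0∞} (g : LpT p) (n : Freq) : coef g (-n) = conj (coef g n) := by
  simp only [coef, mFourierCoeff_torus]
  rw [← integral_conj]
  refine integral_congr_ae (Eventually.of_forall fun x => ?_)
  simp only [map_mul, Complex.conj_ofReal]
  rw [← mFourier_neg]

lemma mFourierCoeff_complexify (g : LpT 2) (n : Freq) :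
    mFourierCoeff (Complex.ofRealCLM.compLp g : Lp ℂ 2 torusMeasure) n = coef g n := by
  refine integral_congr_ae ?_
  have : _ =ᵐ[torusMeasure] _ := Complex.ofRealCLM.coeFn_compLp g
  filter_upwards [this] with x hx
  rw [hx]; rfl

lemma norm_complexify (g : LpT 2) :
    ‖(Complex.ofRealCLM.compLp g : Lp ℂ 2 torusMeasure)‖ = ‖g‖ := by
  rw [Lp.norm_def, Lp.norm_def]
  congr 1
  refine eLpNorm_congr_norm_ae ?_
  filter_upwards [Complex.ofRealCLM.coeFn_compLp g] with x hx
  rw [hx]; simp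

/-- The Hilbert basis of characters. -/
noncomputable def charBasis : HilbertBasis Freq ℂ (Lp ℂ 2 torusMeasure) :=
  UnitAddTorus.mFourierBasis

lemma charBasis_repr (f : Lp ℂ 2 torusMeasure) (n : Freq) :
    charBasis.repr f n = mFourierCoeff f n := mFourierBasis_repr f n

lemma hasSum_coef_sq (g : LpT 2) : HasSum (fun n => ‖coef g n‖ ^ 2) (‖g‖ ^ 2) := by
  have h := lp.hasSum_norm (p := 2) (by norm_num)
    (charBasis.repr (Complex.ofRealCLM.compLp g : Lp ℂ 2 torusMeasure))
  simp only [charBasis_repr, mFourierCoeff_complexify, LinearIsometryEquiv.norm_map,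
    norm_complexify] at h
  simpa using h

lemma norm_coef_le (g : LpT 2) (n : Freq) : ‖coef g n‖ ≤ ‖g‖ := by
  have h := le_hasSum (hasSum_coef_sq g) n (fun _ _ => by positivity)
  exact abs_le_of_sq_le_sq' h (norm_nonneg _) |>.2

lemma coef_injective : Function.Injective (coef : LpT 2 → TDist) := by
  intro g h hgh
  have h1 := hasSum_coef_sq (g - h)
  rw [coef_sub, hgh, sub_self] at h1
  have h0 : HasSum (fun n : Freq => ‖(0 : TDist) n‖ ^ 2) 0 := by
    simp
  have h2 := h1.unique h0
  rw [← sub_eq_zero, ← norm_eq_zero]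
  exact pow_eq_zero_iff (two_ne_zero) |>.1 h2

/-- Riesz-Fischer gives a complex G with coefficients c. Its real part has coefficients (c n + conj
(c (-n))) / 2, which is c n by the symmetry. -/
lemma exists_of_hermitian (c : TDist) (hc : ∀ n, c (-n) = conj (c n))
    (hs : Summable fun n => ‖c n‖ ^ 2) : ∃ g : LpT 2, coef g = c := by
  have hmem : Memℓp c 2 := by
    rw [memℓp_gen_iff (by norm_num)]
    simpa using hs
  set G : Lp ℂ 2 torusMeasure := charBasis.repr.symm ⟨c, hmem⟩ with hG
  have hGc : ∀ n, mFourierCoeff G n = c n := fun n => by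
    rw [← charBasis_repr, hG, LinearIsometryEquiv.apply_symm_apply]
  have hint : Integrable (G : _ → ℂ) torusMeasure := (Lp.memLp G).integrable (by norm_num)
  have hint' : Integrable (fun x => (starRingEnd ℂ) (G x)) torusMeasure :=
    (Complex.conjLIE.toContinuousLinearEquiv : ℂ →L[ℝ] ℂ).integrable_comp hint
  refine ⟨Complex.reCLM.compLp G, funext fun n => ?_⟩
  have h1 : coef (Complex.reCLM.compLp G : LpT 2) n =
      ∫ t, (mFourier (-n) t * G t + mFourier (-n) t * conj (G t)) / 2 ∂torusMeasure := by
    simp only [coef, mFourierCoeff_torus]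
    refine integral_congr_ae ?_
    filter_upwards [Complex.reCLM.coeFn_compLp G] with x hx
    rw [hx, ← mul_add, Complex.add_conj]
    simp only [Complex.reCLM_apply]
    push_cast
    ring
  have h2 : ∫ t, mFourier (-n) t * conj (G t) ∂torusMeasure = conj (c (-n)) := by
    rw [← hGc, mFourierCoeff_torus, ← integral_conj]
    refine integral_congr_ae (Eventually.of_forall fun x => ?_)
    simp only [map_mul]
    rw [← mFourier_neg, neg_neg]
  rw [h1, integral_div, integral_add (integrable_mFourier_mul hint _)
    (integrable_mFourier_mul hint' _), h2, hc, Complex.conj_conj, ← mFourierCoeff_torus, hGc]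
  ring

lemma summable_of_finset_bound {c : TDist} {C : ℝ}
    (h : ∀ F : Finset Freq, ∑ n ∈ F, ‖c n‖ ^ 2 ≤ C) : Summable fun n => ‖c n‖ ^ 2 :=
  summable_of_sum_le (fun _ => by positivity) h

lemma norm_le_of_finset_bound {g : LpT 2} {C : ℝ} (hC : 0 ≤ C)
    (h : ∀ F : Finset Freq, ∑ n ∈ F, ‖coef g n‖ ^ 2 ≤ C ^ 2) : ‖g‖ ≤ C := by
  have := hasSum_le_of_sum_le (hasSum_coef_sq g) h
  exact abs_le_of_sq_le_sq' this hC |>.2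

lemma sum_coef_sq_le (g : LpT 2) (F : Finset Freq) : ∑ n ∈ F, ‖coef g n‖ ^ 2 ≤ ‖g‖ ^ 2 :=
  sum_le_hasSum F (fun _ _ => by positivity) (hasSum_coef_sq g)

/-- A linear family of Hermitian sequences bounded in `ℓ²` defines a bounded operator. -/
lemma exists_clm {V : Type*} [NormedAddCommGroup V] [NormedSpace ℝ V] (L : V → TDist) (C : ℝ)
    (hC : 0 ≤ C) (hadd : ∀ v w, L (v + w) = L v + L w)
    (hsmul : ∀ (c : ℝ) v, L (c • v) = (c : ℂ) • L v) (hherm : ∀ v n, L v (-n) = conj (L v n))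
    (hb : ∀ v (F : Finset Freq), ∑ n ∈ F, ‖L v n‖ ^ 2 ≤ (C * ‖v‖) ^ 2) :
    ∃ T : V →L[ℝ] LpT 2, (∀ v, coef (T v) = L v) ∧ ∀ v, ‖T v‖ ≤ C * ‖v‖ := by
  choose T hT using fun v => exists_of_hermitian (L v) (hherm v)
    (summable_of_finset_bound (hb v))
  have hbound : ∀ v, ‖T v‖ ≤ C * ‖v‖ := fun v =>
    norm_le_of_finset_bound (by positivity) (fun F => by rw [hT]; exact hb v F)
  refine ⟨LinearMap.mkContinuous { toFun := T, map_add' := ?_, map_smul' := ?_ } C hbound,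
    hT, hbound⟩
  · intro v w
    apply coef_injective
    rw [coef_add, hT, hT, hT, hadd]
  · intro c v
    apply coef_injective
    rw [RingHom.id_apply, coef_smul, hT, hT, hsmul]

/-- All bilinear operations of the system are defined on Fourier coefficients. This converts an ℓ²
bound on finite sets of frequencies into a continuous bilinear map with values in real L²; linearity
is read off from the coefficients. -/
lemma exists_clm₂ {V W : Type*} [NormedAddCommGroup V] [NormedSpace ℝ V]
    [NormedAddCommGroup W] [NormedSpace ℝ W] (L : V → W → TDist) (C : ℝ) (hC : 0 ≤ C)
    (hadd : ∀ v v' w, L (v + v') w = L v w + L v' w)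
    (hsmul : ∀ (c : ℝ) v w, L (c • v) w = (c : ℂ) • L v w)
    (hadd' : ∀ v w w', L v (w + w') = L v w + L v w')
    (hsmul' : ∀ (c : ℝ) v w, L v (c • w) = (c : ℂ) • L v w)
    (hherm : ∀ v w n, L v w (-n) = conj (L v w n))
    (hb : ∀ v w (F : Finset Freq), ∑ n ∈ F, ‖L v w n‖ ^ 2 ≤ (C * ‖v‖ * ‖w‖) ^ 2) :
    ∃ T : V →L[ℝ] W →L[ℝ] LpT 2, ∀ v w, coef (T v w) = L v w := by
  choose T hT hTb using fun v => exists_clm (L v) (C * ‖v‖) (by positivity) (hadd' v)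
    (fun c w => hsmul' c v w) (hherm v) (hb v)
  refine ⟨LinearMap.mkContinuous { toFun := T, map_add' := ?_, map_smul' := ?_ } C ?_, hT⟩
  · intro v v'
    ext1 w
    apply coef_injective
    rw [add_apply, coef_add, hT, hT, hT, hadd]
  · intro c v
    ext1 w
    apply coef_injective
    rw [RingHom.id_apply, smul_apply, coef_smul, hT, hT, hsmul]
  · intro v
    exact ContinuousLinearMap.opNorm_le_bound _ (by positivity) (hTb v)

/-- Truncation of `L^∞` to `L²` keeps the Fourier coefficients. -/
lemma exists_inclusion : ∃ T : LpT ∞ →L[ℝ] LpT 2, (∀ ψ, coef (T ψ) = coef ψ) ∧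
    ∀ ψ, ‖T ψ‖ ≤ ‖ψ‖ := by
  have key : ∀ ψ : LpT ∞, ∃ g : LpT 2, coef g = coef ψ ∧ ‖g‖ ≤ ‖ψ‖ := fun ψ => by
    have hm : MemLp ψ 2 torusMeasure := (Lp.memLp ψ).mono_exponent le_top
    refine ⟨hm.toLp ψ, coef_congr hm.coeFn_toLp, ?_⟩
    rw [Lp.norm_toLp, Lp.norm_def]
    refine ENNReal.toReal_mono (Lp.eLpNorm_ne_top ψ) ?_
    exact eLpNorm_le_eLpNorm_of_exponent_le le_top (Lp.aestronglyMeasurable ψ)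
  obtain ⟨T, hT, hT'⟩ := exists_clm (coef : LpT ∞ → TDist) 1 zero_le_one coef_add
    (fun c v => coef_smul c v) coef_neg_freq (fun ψ F => by
      obtain ⟨g, hg, hg'⟩ := key ψ
      rw [← hg, one_mul]
      exact (sum_coef_sq_le g F).trans (by gcongr))
  exact ⟨T, hT, fun ψ => by simpa using hT' ψ⟩

/-- The inclusion of `L^∞` in `L²`. -/
noncomputable def inclL2 : LpT ∞ →L[ℝ] LpT 2 := exists_inclusion.choose

lemma coef_inclL2 (ψ : LpT ∞) : coef (inclL2 ψ) = coef ψ := exists_inclusion.choose_spec.1 ψ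

lemma coef_injective_top : Function.Injective (coef : LpT ∞ → TDist) := by
  intro ψ χ h
  have h1 : ∀ ψ : LpT ∞, ∃ hm : MemLp ψ 2 torusMeasure, coef (hm.toLp ψ) = coef ψ := fun ψ => by
    have hm : MemLp ψ 2 torusMeasure := (Lp.memLp ψ).mono_exponent le_top
    exact ⟨hm, coef_congr hm.coeFn_toLp⟩
  obtain ⟨h2, h3⟩ := h1 ψ
  obtain ⟨h4, h5⟩ := h1 χ
  have h6 := coef_injective (h3.trans (h.trans h5.symm))
  refine Lp.ext ?_
  exact h2.coeFn_toLp.symm.trans (by rw [h6]; exact h4.coeFn_toLp)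

/-! ### Toeplitz forms -/

/-- The Toeplitz form of the sequence `c` is bounded by `C` on `ℓ²`. -/
def ToeplitzBound (C : ℝ) (c : TDist) : Prop :=
  ∀ (F G : Finset Freq) (u v : TDist), ‖∑ n ∈ F, ∑ m ∈ G, u n * c (n - m) * v m‖ ≤
    C * (Real.sqrt (∑ n ∈ F, ‖u n‖ ^ 2) * Real.sqrt (∑ m ∈ G, ‖v m‖ ^ 2))

lemma norm_trigPoly (F : Finset Freq) (u : TDist) :
    ‖∑ n ∈ F, u n • (mFourierLp 2 n : Lp ℂ 2 torusMeasure)‖ = Real.sqrt (∑ n ∈ F, ‖u n‖ ^ 2) := by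
  have ho : Orthonormal ℂ (fun n : Freq => (mFourierLp 2 n : Lp ℂ 2 torusMeasure)) :=
    orthonormal_mFourier
  rw [@norm_eq_sqrt_re_inner ℂ, ho.inner_sum]
  congr 1
  simp [← Complex.normSq_eq_norm_sq, Complex.normSq_apply]

/-- The form is the inner product of U with ψV, for trigonometric polynomials U and V with
coefficients conj u and v, and multiplication by ψ has norm at most ‖ψ‖_∞ on L². -/
lemma toeplitzBound_coef (ψ : LpT ∞) : ToeplitzBound ‖ψ‖ (coef ψ) := by
  intro F G u v
  set U : Lp ℂ 2 torusMeasure := ∑ n ∈ F, conj (u n) • (mFourierLp 2 n : Lp ℂ 2 torusMeasure)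
    with hU
  set V : Lp ℂ 2 torusMeasure := ∑ n ∈ G, v n • (mFourierLp 2 n : Lp ℂ 2 torusMeasure) with hV
  have hUn : ‖U‖ = Real.sqrt (∑ n ∈ F, ‖u n‖ ^ 2) := by
    rw [hU, norm_trigPoly F (fun n => conj (u n))]; simp
  have hVn : ‖V‖ = Real.sqrt (∑ n ∈ G, ‖v n‖ ^ 2) := norm_trigPoly G v
  have hae : ∀ (F : Finset Freq) (u : TDist),
      ((∑ n ∈ F, u n • (mFourierLp 2 n : Lp ℂ 2 torusMeasure) : Lp ℂ 2 torusMeasure) : _ → ℂ)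
        =ᵐ[torusMeasure] fun x => ∑ n ∈ F, u n * mFourier n x := by
    intro F u
    induction F using Finset.induction_on with
    | empty => simpa using! Lp.coeFn_zero ℂ 2 torusMeasure
    | insert a s ha ih =>
      rw [Finset.sum_insert ha]
      have h0 : _ =ᵐ[torusMeasure] _ := coeFn_mFourierLp (d := Fin 3) 2 a
      filter_upwards [ih, Lp.coeFn_add (u a • (mFourierLp 2 a : Lp ℂ 2 torusMeasure))
        (∑ n ∈ s, u n • (mFourierLp 2 n : Lp ℂ 2 torusMeasure)),
        Lp.coeFn_smul (u a) (mFourierLp 2 a : Lp ℂ 2 torusMeasure), h0] with x h1 h2 h3 h4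
      rw [h2, Pi.add_apply, h1, h3, Finset.sum_insert ha, Pi.smul_apply, h4, smul_eq_mul]
  have hψV : MemLp (fun x => ((ψ x : ℝ) : ℂ) * V x) 2 torusMeasure := by
    have := (Lp.memLp V).mul (p := ∞) (r := 2) ((Lp.memLp ψ).ofReal (K := ℂ))
    exact this
  have hle : ‖hψV.toLp _‖ ≤ ‖ψ‖ * ‖V‖ := by
    rw [Lp.norm_toLp, Lp.norm_def ψ, Lp.norm_def V, ← ENNReal.toReal_mul]
    refine ENNReal.toReal_mono (ENNReal.mul_ne_top (Lp.eLpNorm_ne_top ψ)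
      (Lp.eLpNorm_ne_top V)) ?_
    have := eLpNorm_smul_le_eLpNorm_top_mul_eLpNorm (𝕜 := ℂ) 2 (μ := torusMeasure)
      (f := (V : _ → ℂ)) (Lp.aestronglyMeasurable V) (fun x => ((ψ x : ℝ) : ℂ))
    refine this.trans (le_of_eq ?_)
    congr 1
    exact eLpNorm_congr_norm_ae (Eventually.of_forall fun x => by simp)
  have hsum : ∑ n ∈ F, ∑ m ∈ G, u n * coef ψ (n - m) * v m = inner ℂ U (hψV.toLp _) := by
    rw [L2.inner_def]
    have h1 : ∫ x, inner ℂ (U x) ((hψV.toLp _ : Lp ℂ 2 torusMeasure) x) ∂torusMeasure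
        = ∫ x, ∑ n ∈ F, ∑ m ∈ G, u n * (mFourier (-(n - m)) x * ((ψ x : ℝ) : ℂ)) * v m
            ∂torusMeasure := by
      refine integral_congr_ae ?_
      filter_upwards [hae F (fun n => conj (u n)), hae G v, hψV.coeFn_toLp] with x h1 h2 h3
      rw [h3, h1, h2]
      simp only [RCLike.inner_apply, map_sum, map_mul, Complex.conj_conj, Finset.mul_sum,
        Finset.sum_mul]
      refine Finset.sum_congr rfl fun n _ => Finset.sum_congr rfl fun m _ => ?_
      rw [neg_sub, sub_eq_add_neg, mFourier_add, mFourier_neg]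
      ring
    rw [h1, integral_finsetSum _ (fun n _ => integrable_finsetSum _ fun m _ =>
      ((integrable_mFourier_mul (integrable_coe ψ) _).const_mul _).mul_const _)]
    refine Finset.sum_congr rfl fun n _ => ?_
    rw [integral_finsetSum _ (fun m _ =>
      ((integrable_mFourier_mul (integrable_coe ψ) _).const_mul _).mul_const _)]
    refine Finset.sum_congr rfl fun m _ => ?_
    rw [integral_mul_const, integral_const_mul]
    rfl
  rw [hsum, ← hUn, ← hVn]
  refine (norm_inner_le_norm _ _).trans ?_
  calc ‖U‖ * ‖hψV.toLp _‖ ≤ ‖U‖ * (‖ψ‖ * ‖V‖) := by gcongr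
    _ = _ := by ring

end FourierCoefficients

end HartreeWave

namespace HartreeWave

/-! ### Smooth dyadic multipliers of bounded functions -/

section Multipliers

lemma ToeplitzBound.mono {C C' : ℝ} {c : TDist} (h : ToeplitzBound C c) (hC : C ≤ C') :
    ToeplitzBound C' c := fun F G u v => (h F G u v).trans (by gcongr)

/-- Multiplication of a symbol by the Fourier transform of an integrable function. -/
lemma ToeplitzBound.fourier_mul {C : ℝ} {b : TDist} (hb : ToeplitzBound C b) (hC : 0 ≤ C)
    {V : Type*} [MeasurableSpace V] {ν : Measure V} {g : V → ℂ} (hg : Integrable g ν)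
    {e e' : Freq → V → ℂ} (hem : ∀ n, AEStronglyMeasurable (e n) ν)
    (hem' : ∀ n, AEStronglyMeasurable (e' n) ν) (he : ∀ n y, ‖e n y‖ ≤ 1)
    (he' : ∀ n y, ‖e' n y‖ ≤ 1) {c : TDist}
    (hc : ∀ n m, c (n - m) = ∫ y, g y * (e n y * e' m y) ∂ν) :
    ToeplitzBound ((∫ y, ‖g y‖ ∂ν) * C) (fun n => c n * b n) := by
  intro F G u v
  have hint : ∀ n m, Integrable (fun y => g y * (e n y * e' m y)) ν := fun n m => by
    have := hg.bdd_mul (c := 1) ((hem n).mul (hem' m)) (Eventually.of_forall fun y => by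
      simpa using mul_le_mul (he n y) (he' m y) (norm_nonneg _) zero_le_one)
    refine this.congr (Eventually.of_forall fun y => ?_)
    simp only [Pi.mul_apply]; ring
  have hint' : ∀ n m, Integrable (fun y => g y * ((u n * e n y) * b (n - m) * (e' m y * v m))) ν :=
    fun n m => ((hint n m).mul_const (u n * b (n - m) * v m)).congr
      (Eventually.of_forall fun y => by simp only; ring)
  -- Since c(n - m) is an average of products of a factor in n and a factor in m, both of modulus at
  -- most 1, the new form is an average of forms of b tested on modulated u and v.
  have h1 : ∑ n ∈ F, ∑ m ∈ G, u n * (c (n - m) * b (n - m)) * v m =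
      ∫ y, g y * ∑ n ∈ F, ∑ m ∈ G, (u n * e n y) * b (n - m) * (e' m y * v m) ∂ν := by
    simp only [hc, Finset.mul_sum]
    rw [integral_finsetSum _ (fun n _ => integrable_finsetSum _ fun m _ => hint' n m)]
    refine Finset.sum_congr rfl fun n _ => ?_
    rw [integral_finsetSum _ (fun m _ => hint' n m)]
    refine Finset.sum_congr rfl fun m _ => ?_
    rw [← integral_mul_const, ← integral_const_mul, ← integral_mul_const]
    refine integral_congr_ae (Eventually.of_forall fun y => ?_)
    simp only; ring
  rw [h1, mul_assoc, ← integral_mul_const]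
  refine norm_integral_le_of_norm_le (hg.norm.mul_const _) (Eventually.of_forall fun y => ?_)
  rw [norm_mul]
  refine mul_le_mul_of_nonneg_left ?_ (norm_nonneg _)
  refine (hb F G (fun n => u n * e n y) (fun m => e' m y * v m)).trans ?_
  gcongr with n _ m _
  · rw [norm_mul]
    exact mul_le_of_le_one_right (norm_nonneg _) (he n y)
  · rw [norm_mul]
    exact mul_le_of_le_one_left (norm_nonneg _) (he' m y)

/-- The vector `(1, n)`. -/
noncomputable def freqVec (n : Freq) : EuclideanSpace ℝ (Fin 4) :=
  WithLp.toLp 2 (Fin.cons 1 fun i => (n i : ℝ))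

/-- The length of the last three coordinates. -/
noncomputable def spatialNorm (x : EuclideanSpace ℝ (Fin 4)) : ℝ :=
  Real.sqrt (∑ i : Fin 3, x i.succ ^ 2)

lemma freqNorm_nonneg (n : Freq) : 0 ≤ freqNorm n := Real.sqrt_nonneg _

lemma freqNorm_sq (n : Freq) : freqNorm n ^ 2 = ∑ i, (n i : ℝ) ^ 2 :=
  Real.sq_sqrt (Finset.sum_nonneg fun _ _ => sq_nonneg _)

lemma bracket_sq (n : Freq) : bracket n ^ 2 = 1 + freqNorm n ^ 2 :=
  Real.sq_sqrt (by positivity)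

lemma one_le_bracket (n : Freq) : 1 ≤ bracket n := by
  rw [bracket, Real.one_le_sqrt]
  nlinarith [sq_nonneg (freqNorm n)]

lemma bracket_pos (n : Freq) : 0 < bracket n := one_pos.trans_le (one_le_bracket n)

lemma norm_freqVec (n : Freq) : ‖freqVec n‖ = bracket n := by
  rw [EuclideanSpace.norm_eq, bracket, freqNorm_sq, Fin.sum_univ_succ]
  simp [freqVec]

lemma spatialNorm_smul_freqVec {l : ℝ} (hl : 0 ≤ l) (n : Freq) :
    spatialNorm (l • freqVec n) = l * freqNorm n := by
  rw [spatialNorm, freqNorm]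
  rw [← Real.sqrt_sq hl, ← Real.sqrt_mul (sq_nonneg l), Real.sqrt_sq hl, Finset.mul_sum]
  simp [freqVec, mul_pow]

/-- The first coordinate is constantly 1, so n ↦ (1, n) is affine and not linear; the correction is
put into the factor that depends on m. -/
lemma freqVec_sub (n m : Freq) : freqVec (n - m) = freqVec n - (freqVec m - freqVec 0) := by
  ext i
  refine Fin.cases ?_ (fun j => ?_) i <;> simp [freqVec]

/-- In four variables ⟨n⟩ is the norm of (1, n), so the weight ⟨n⟩^a becomes homogeneous and one
smooth function H‖·‖^a serves all dyadic scales. Its Fourier transform is integrable, and the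
dilation l only enters the unimodular exponentials, so the constant does not depend on l. -/
lemma exists_toeplitzBound_of_contDiff {H : EuclideanSpace ℝ (Fin 4) → ℝ}
    (hH : ContDiff ℝ (⊤ : ℕ∞) H) (hc : HasCompactSupport H) (h0 : H =ᶠ[𝓝 0] 0) (a : ℝ) :
    ∃ C : ℝ, 0 ≤ C ∧ ∀ (l : ℝ) (ψ : LpT ∞), ToeplitzBound (C * ‖ψ‖)
      (fun n => ((H (l • freqVec n) * ‖l • freqVec n‖ ^ a : ℝ) : ℂ) * coef ψ n) := by
  set f : EuclideanSpace ℝ (Fin 4) → ℂ := fun x => ((H x * ‖x‖ ^ a : ℝ) : ℂ) with hf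
  have hfs : ContDiff ℝ (⊤ : ℕ∞) f := by
    refine Complex.ofRealCLM.contDiff.comp (contDiff_iff_contDiffAt.2 fun x => ?_)
    rcases eq_or_ne x 0 with rfl | hx
    · refine (contDiffAt_const (c := (0 : ℝ))).congr_of_eventuallyEq ?_
      filter_upwards [h0] with y hy
      rw [hy]; exact zero_mul _
    · exact hH.contDiffAt.mul ((contDiffAt_norm ℝ hx).rpow_const_of_ne (norm_ne_zero_iff.2 hx))
  have hfc : HasCompactSupport f := by
    refine hc.mono fun x hx => ?_
    simp only [Function.mem_support, hf] at hx ⊢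
    intro h
    simp [h] at hx
  set g := hfc.toSchwartzMap hfs
  have hinv : ∀ x, f x = ∫ y, Complex.exp (((2 * Real.pi * inner ℝ y x : ℝ) : ℂ) * Complex.I) •
      (FourierTransform.fourier g) y := by
    intro x
    have h1 : FourierTransformInv.fourierInv (FourierTransform.fourier (g : _ → ℂ)) = g :=
      g.continuous.fourierInv_fourier_eq g.integrable (by
        rw [← SchwartzMap.fourier_coe]; exact SchwartzMap.integrable _)
    have h2 : f x = g x := rfl
    rw [h2, ← h1, Real.fourierInv_eq', SchwartzMap.fourier_coe]
  refine ⟨∫ y, ‖(FourierTransform.fourier g) y‖, by positivity, fun l ψ => ?_⟩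
  have hexp : ∀ r : ℝ, ‖Complex.exp ((r : ℂ) * Complex.I)‖ ≤ 1 := fun r =>
    (Complex.norm_exp_ofReal_mul_I r).le
  refine (toeplitzBound_coef ψ).fourier_mul (norm_nonneg _) (SchwartzMap.integrable _)
    (e := fun n y => Complex.exp (((2 * Real.pi * inner ℝ y (l • freqVec n) : ℝ) : ℂ) * Complex.I))
    (e' := fun m y => Complex.exp (((-(2 * Real.pi * inner ℝ y (l • (freqVec m - freqVec 0))) :
      ℝ) : ℂ) * Complex.I)) (fun n => ?_) (fun n => ?_) (fun n y => hexp _) (fun n y => hexp _)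
    (c := fun n => f (l • freqVec n)) (fun n m => ?_)
  · exact Continuous.aestronglyMeasurable (by fun_prop)
  · exact Continuous.aestronglyMeasurable (by fun_prop)
  · rw [hinv]
    refine integral_congr_ae (Eventually.of_forall fun y => ?_)
    simp only
    rw [← Complex.exp_add, smul_eq_mul, mul_comm, freqVec_sub, smul_sub, inner_sub_right]
    congr 2
    push_cast
    ring

variable {φ : ℝ → ℝ}

lemma IsBump.eq_zero (hφ : IsBump φ) {r : ℝ} (hr : 8 / 5 < |r|) : φ r = 0 := by
  refine image_eq_zero_of_notMem_tsupport fun h => ?_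
  have := hφ.supp h
  rw [mem_Icc, ← abs_le] at this
  linarith

lemma IsBump.eq_one (hφ : IsBump φ) {r : ℝ} (hr : |r| ≤ 5 / 4) : φ r = 1 :=
  hφ.one r (abs_le.1 hr)

lemma norm_le_add_spatialNorm (x : EuclideanSpace ℝ (Fin 4)) : ‖x‖ ≤ |x 0| + spatialNorm x := by
  have h : ‖x‖ ^ 2 = |x 0| ^ 2 + spatialNorm x ^ 2 := by
    rw [EuclideanSpace.norm_sq_eq, spatialNorm, Fin.sum_univ_succ (n := 3),
      Real.sq_sqrt (by positivity)]
    simp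
  have h1 : 0 ≤ spatialNorm x := Real.sqrt_nonneg _
  nlinarith [norm_nonneg x, abs_nonneg (x 0), mul_nonneg (abs_nonneg (x 0)) h1]

lemma continuous_spatialNorm : Continuous spatialNorm := by
  unfold spatialNorm; fun_prop

/-- The length is not smooth where it vanishes, but there φ is locally constant. -/
lemma IsBump.contDiff_spatialNorm (hφ : IsBump φ) (c : ℝ) :
    ContDiff ℝ (⊤ : ℕ∞) (fun x => φ (c * spatialNorm x)) := by
  refine contDiff_iff_contDiffAt.2 fun x => ?_
  rcases eq_or_ne (spatialNorm x) 0 with hx | hx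
  · refine (contDiffAt_const (c := (1 : ℝ))).congr_of_eventuallyEq ?_
    have h1 : ∀ᶠ y in 𝓝 x, |c * spatialNorm y| < 5 / 4 := by
      refine ((continuous_const.mul continuous_spatialNorm).abs.tendsto x).eventually_lt_const ?_
      simp [hx]
    filter_upwards [h1] with y hy
    exact hφ.eq_one hy.le
  · have h1 : ContDiffAt ℝ (⊤ : ℕ∞) spatialNorm x := by
      refine ContDiffAt.sqrt ?_ fun h => hx (by rw [spatialNorm, h, Real.sqrt_zero])
      refine ContDiffAt.sum fun i _ => ContDiffAt.pow ?_ 2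
      exact (EuclideanSpace.proj (𝕜 := ℝ) (i.succ : Fin 4)).contDiff.contDiffAt
    exact hφ.smooth.contDiffAt.comp x (contDiffAt_const.mul h1)

/-- Littlewood-Paley blocks of `⟨∇⟩^a ψ` for bounded `ψ`, as multiplication operators. -/
lemma IsBump.exists_toeplitzBound (hφ : IsBump φ) (a : ℝ) :
    ∃ C : ℝ, 0 ≤ C ∧ ∀ (k : ℕ) (ψ : LpT ∞), ToeplitzBound (C * (2 : ℝ) ^ (a * k) * ‖ψ‖)
      (fun n => ((dyadic φ k (freqNorm n) * bracket n ^ a : ℝ) : ℂ) * coef ψ n) := by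
  have hproj : ContDiff ℝ (⊤ : ℕ∞) (fun x : EuclideanSpace ℝ (Fin 4) => x 0) :=
    (EuclideanSpace.proj (𝕜 := ℝ) (0 : Fin 4)).contDiff
  have hcs : ∀ H : EuclideanSpace ℝ (Fin 4) → ℝ,
      (∀ x, H x ≠ 0 → |x 0| ≤ 8 / 5 + 1 ∧ spatialNorm x ≤ 8 / 5) → HasCompactSupport H := by
    intro H hH
    refine HasCompactSupport.of_support_subset_isCompact (isCompact_closedBall 0 5) fun x hx => ?_
    obtain ⟨h1, h2⟩ := hH x hx
    rw [mem_closedBall_zero_iff]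
    linarith [norm_le_add_spatialNorm x]
  have hsn : ∀ x, 0 ≤ spatialNorm x := fun x => Real.sqrt_nonneg _
  -- Block 0. The second factor localizes the first coordinate near 1, its value at the vectors (1,
  -- n), and thereby keeps the support away from the origin.
  obtain ⟨C₀, hC₀, h₀⟩ := exists_toeplitzBound_of_contDiff
    (H := fun x => φ (1 * spatialNorm x) * φ (2 * (x 0 - 1)))
    ((hφ.contDiff_spatialNorm 1).mul
      (hφ.smooth.comp (contDiff_const.mul (hproj.sub contDiff_const))))
    (hcs _ fun x hx => by
      refine ⟨?_, ?_⟩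
      · by_contra! h
        refine hx (mul_eq_zero_of_right _ (hφ.eq_zero ?_))
        rw [abs_mul, abs_two]
        linarith [abs_sub_abs_le_abs_sub (x 0) 1, abs_one (α := ℝ)]
      · by_contra! h
        refine hx (mul_eq_zero_of_left (hφ.eq_zero ?_) _)
        rw [one_mul, abs_of_nonneg (hsn x)]
        exact h)
    (by
      have h1 : ∀ᶠ y : EuclideanSpace ℝ (Fin 4) in 𝓝 0, y 0 < 1 / 10 :=
        (hproj.continuous.tendsto 0).eventually_lt_const (by simp)
      filter_upwards [h1] with y hy
      refine mul_eq_zero_of_right _ (hφ.eq_zero ?_)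
      rw [abs_of_neg (by linarith)]
      linarith) a
  -- Blocks k ≥ 1, rescaled by 2^{-k}. The difference already vanishes near the origin. The factor
  -- φ(x 0) only makes the support compact: it equals 1 at the rescaled first coordinate 2^{-k} ≤ 1.
  obtain ⟨C₁, hC₁, h₁⟩ := exists_toeplitzBound_of_contDiff
    (H := fun x => (φ (1 * spatialNorm x) - φ (2 * spatialNorm x)) * φ (x 0))
    (((hφ.contDiff_spatialNorm 1).sub (hφ.contDiff_spatialNorm 2)).mul
      (hφ.smooth.comp hproj))
    (hcs _ fun x hx => by
      refine ⟨?_, ?_⟩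
      · by_contra! h
        exact hx (mul_eq_zero_of_right _ (hφ.eq_zero (by linarith)))
      · by_contra! h
        refine hx (mul_eq_zero_of_left ?_ _)
        rw [hφ.eq_zero, hφ.eq_zero, sub_zero]
        · rw [abs_mul, abs_two, abs_of_nonneg (hsn x)]; linarith
        · rw [one_mul, abs_of_nonneg (hsn x)]; exact h)
    (by
      have h1 : ∀ᶠ y : EuclideanSpace ℝ (Fin 4) in 𝓝 0, spatialNorm y < 1 / 2 :=
        (continuous_spatialNorm.tendsto 0).eventually_lt_const (by simp [spatialNorm])
      filter_upwards [h1] with y hy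
      refine mul_eq_zero_of_left ?_ _
      rw [hφ.eq_one, hφ.eq_one, sub_self]
      · rw [abs_mul, abs_two, abs_of_nonneg (hsn y)]; linarith
      · rw [one_mul, abs_of_nonneg (hsn y)]; linarith) a
  refine ⟨max C₀ C₁, le_max_of_le_left hC₀, fun k ψ => ?_⟩
  rcases k with _ | k
  · refine ToeplitzBound.mono (C := C₀ * ‖ψ‖) ?_ (by simp; gcongr; exact le_max_left _ _)
    convert h₀ 1 ψ using 4 with n
    rw [spatialNorm_smul_freqVec zero_le_one, one_smul, norm_freqVec, one_mul, one_mul, dyadic]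
    have : φ (2 * ((freqVec n).ofLp 0 - 1)) = 1 := hφ.eq_one (by simp [freqVec]; norm_num)
    rw [this, mul_one]
  · set l : ℝ := ((2 : ℝ) ^ (k + 1))⁻¹ with hl
    have hl0 : 0 < l := by positivity
    have hl1 : l ≤ 1 := inv_le_one_of_one_le₀ (one_le_pow₀ one_le_two)
    have hla : l ^ a * (2 : ℝ) ^ (a * ((k + 1 : ℕ) : ℝ)) = 1 := by
      rw [hl, Real.inv_rpow (by positivity), mul_comm a, Real.rpow_mul zero_le_two,
        Real.rpow_natCast]
      exact inv_mul_cancel₀ (by positivity)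
    intro F G u v
    have hb := h₁ l ψ F G u v
    have hterm : ∀ n : Freq, dyadic φ (k + 1) (freqNorm n) * bracket n ^ a =
        (2 : ℝ) ^ (a * ((k + 1 : ℕ) : ℝ)) *
          ((φ (1 * spatialNorm (l • freqVec n)) - φ (2 * spatialNorm (l • freqVec n))) *
            φ ((l • freqVec n) 0) * ‖l • freqVec n‖ ^ a) := by
      intro n
      have h3 : φ ((l • freqVec n) 0) = 1 := hφ.eq_one (by
        simp [freqVec, abs_of_pos hl0]; linarith)
      rw [h3, spatialNorm_smul_freqVec hl0.le, norm_smul, norm_freqVec, Real.norm_eq_abs,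
        abs_of_pos hl0, Real.mul_rpow hl0.le (bracket_pos n).le, dyadic]
      have h4 : 1 * (l * freqNorm n) = freqNorm n / 2 ^ (k + 1) := by rw [hl]; field_simp
      have h5 : 2 * (l * freqNorm n) = freqNorm n / 2 ^ k := by rw [hl, pow_succ]; field_simp
      rw [h4, h5]
      linear_combination (-(φ (freqNorm n / 2 ^ (k + 1)) - φ (freqNorm n / 2 ^ k)) *
        bracket n ^ a) * hla
    simp only [hterm]
    have hpull : ∑ n ∈ F, ∑ m ∈ G, u n * ((((2 : ℝ) ^ (a * ((k + 1 : ℕ) : ℝ)) *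
        ((φ (1 * spatialNorm (l • freqVec (n - m))) - φ (2 * spatialNorm (l • freqVec (n - m)))) *
            φ ((l • freqVec (n - m)) 0) * ‖l • freqVec (n - m)‖ ^ a) : ℝ) : ℂ) *
              coef ψ (n - m)) * v m = (((2 : ℝ) ^ (a * ((k + 1 : ℕ) : ℝ)) : ℝ) : ℂ) *
        ∑ n ∈ F, ∑ m ∈ G, u n * ((((φ (1 * spatialNorm (l • freqVec (n - m))) -
          φ (2 * spatialNorm (l • freqVec (n - m)))) *
            φ ((l • freqVec (n - m)) 0) * ‖l • freqVec (n - m)‖ ^ a : ℝ) : ℂ) *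
              coef ψ (n - m)) * v m := by
      simp only [Finset.mul_sum]
      refine Finset.sum_congr rfl fun n _ => Finset.sum_congr rfl fun m _ => ?_
      push_cast
      ring
    rw [hpull, norm_mul, Complex.norm_real, Real.norm_eq_abs, abs_of_pos (by positivity)]
    refine (mul_le_mul_of_nonneg_left hb (by positivity)).trans ?_
    calc (2 : ℝ) ^ (a * ((k + 1 : ℕ) : ℝ)) * (C₁ * ‖ψ‖ * (√(∑ n ∈ F, ‖u n‖ ^ 2) *
          √(∑ m ∈ G, ‖v m‖ ^ 2))) = C₁ * (2 : ℝ) ^ (a * ((k + 1 : ℕ) : ℝ)) * ‖ψ‖ *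
            (√(∑ n ∈ F, ‖u n‖ ^ 2) * √(∑ m ∈ G, ‖v m‖ ^ 2)) := by ring
      _ ≤ _ := by gcongr; exact le_max_right _ _

end Multipliers

end HartreeWave

namespace HartreeWave

/-! ### Littlewood-Paley symbols -/

section Symbols

variable {φ : ℝ → ℝ}

lemma sum_dyadic (φ : ℝ → ℝ) (r : ℝ) (J : ℕ) :
    ∑ j ∈ Finset.range (J + 1), dyadic φ j r = φ (r / 2 ^ J) := by
  induction J with
  | zero => simp [dyadic]
  | succ J ih => rw [Finset.sum_range_succ, ih, dyadic]; ring

/-- The partial sums telescope to φ(r / 2^J), which is 1 for large J. Hence the normalization in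
`lpSymbol` divides by 1. -/
lemma IsBump.hasSum_dyadic (hφ : IsBump φ) (r : ℝ) : HasSum (fun j => dyadic φ j r) 1 := by
  obtain ⟨J, hJ⟩ := pow_unbounded_of_one_lt |r| one_lt_two
  have h1 : ∀ j, J ≤ j → φ (r / 2 ^ j) = 1 := fun j hj => hφ.eq_one (by
    rw [abs_div, abs_of_pos (show (0 : ℝ) < 2 ^ j by positivity), div_le_iff₀ (by positivity)]
    have h0 : (2 : ℝ) ^ J ≤ 2 ^ j := pow_le_pow_right₀ one_le_two hj
    have h1 : (0 : ℝ) < 2 ^ j := by positivity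
    linarith)
  have h2 : ∀ j ∉ Finset.range (J + 1), dyadic φ j r = 0 := fun j hj => by
    rw [Finset.mem_range] at hj
    obtain ⟨i, rfl⟩ : ∃ i, j = i + 1 := ⟨j - 1, by omega⟩
    rw [dyadic, h1 _ (by omega), h1 _ (by omega), sub_self]
  have h : HasSum (fun j => dyadic φ j r) _ := hasSum_sum_of_ne_finset_zero h2
  rwa [sum_dyadic, h1 J le_rfl] at h

lemma IsBump.lpSymbol_eq (hφ : IsBump φ) (j : ℕ) (n : Freq) :
    lpSymbol φ j n = dyadic φ j (freqNorm n) := by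
  rw [lpSymbol, (hφ.hasSum_dyadic _).tsum_eq, div_one]

lemma freqNorm_neg (n : Freq) : freqNorm (-n) = freqNorm n := by simp [freqNorm]

lemma bracket_neg (n : Freq) : bracket (-n) = bracket n := by simp [bracket, freqNorm_neg]

lemma lpSymbol_neg (j : ℕ) (n : Freq) : lpSymbol φ j (-n) = lpSymbol φ j n := by
  simp [lpSymbol, freqNorm_neg]

lemma IsBump.abs_lpSymbol_le (hφ : IsBump φ) (j : ℕ) (n : Freq) : |lpSymbol φ j n| ≤ 1 := by
  rw [hφ.lpSymbol_eq]
  rcases j with _ | j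
  · have := hφ.range (freqNorm n)
    rw [dyadic, abs_le]; constructor <;> linarith [this.1, this.2]
  · have h1 := hφ.range (freqNorm n / 2 ^ (j + 1))
    have h2 := hφ.range (freqNorm n / 2 ^ j)
    rw [dyadic, abs_le]; constructor <;> linarith [h1.1, h1.2, h2.1, h2.2]

lemma IsBump.freqNorm_le (hφ : IsBump φ) {j : ℕ} {n : Freq} (h : lpSymbol φ j n ≠ 0) :
    freqNorm n ≤ 8 / 5 * 2 ^ j := by
  rw [hφ.lpSymbol_eq] at h
  by_contra! hlt
  refine h ?_
  have h0 := freqNorm_nonneg n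
  have key : ∀ i ≤ j, φ (freqNorm n / 2 ^ i) = 0 := fun i hi => hφ.eq_zero (by
    rw [abs_of_nonneg (by positivity), lt_div_iff₀ (by positivity)]
    have : (2 : ℝ) ^ i ≤ 2 ^ j := pow_le_pow_right₀ one_le_two hi
    linarith)
  rcases j with _ | j
  · simpa [dyadic] using key 0 le_rfl
  · rw [dyadic, key _ le_rfl, key j (by omega), sub_zero]

lemma IsBump.le_freqNorm (hφ : IsBump φ) {j : ℕ} {n : Freq} (h : lpSymbol φ (j + 1) n ≠ 0) :
    5 / 8 * 2 ^ (j + 1) ≤ freqNorm n := by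
  rw [hφ.lpSymbol_eq] at h
  by_contra! hlt
  refine h ?_
  have h0 := freqNorm_nonneg n
  have key : ∀ i, j ≤ i → φ (freqNorm n / 2 ^ i) = 1 := fun i hi => hφ.eq_one (by
    rw [abs_of_nonneg (by positivity), div_le_iff₀ (by positivity)]
    have : (2 : ℝ) ^ j ≤ 2 ^ i := pow_le_pow_right₀ one_le_two hi
    rw [pow_succ] at hlt
    linarith)
  rw [dyadic, key _ le_rfl, key (j + 1) (by omega), sub_self]

lemma freqNorm_le_bracket (n : Freq) : freqNorm n ≤ bracket n := by
  refine Real.le_sqrt_of_sq_le ?_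
  linarith

lemma IsBump.bracket_le (hφ : IsBump φ) {j : ℕ} {n : Freq} (h : lpSymbol φ j n ≠ 0) :
    bracket n ≤ 2 * 2 ^ j := by
  have h1 := hφ.freqNorm_le h
  have h2 := freqNorm_nonneg n
  have h3 : (1 : ℝ) ≤ 2 ^ j := one_le_pow₀ one_le_two
  have h4 := bracket_sq n
  refine (abs_le_of_sq_le_sq' (?_ : bracket n ^ 2 ≤ (2 * 2 ^ j) ^ 2) (by positivity)).2
  nlinarith

lemma IsBump.le_bracket (hφ : IsBump φ) {j : ℕ} {n : Freq} (h : lpSymbol φ j n ≠ 0) :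
    2⁻¹ * 2 ^ j ≤ bracket n := by
  rcases j with _ | j
  · linarith [one_le_bracket n, pow_zero (2 : ℝ)]
  · have h1 := hφ.le_freqNorm h
    have h2 := freqNorm_le_bracket n
    have h3 : (0 : ℝ) < 2 ^ (j + 1) := by positivity
    linarith

/-- On the support of `P_j`, the bracket is comparable to `2^j`. -/
lemma IsBump.bracket_rpow_le (hφ : IsBump φ) {j : ℕ} {n : Freq} (h : lpSymbol φ j n ≠ 0) (e : ℝ) :
    bracket n ^ e ≤ 2 ^ |e| * 2 ^ (e * j) := by
  have h0 := bracket_pos n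
  have hj : (2 : ℝ) ^ (e * j) = (2 ^ j) ^ e := by
    rw [mul_comm, Real.rpow_mul zero_le_two, Real.rpow_natCast]
  rcases le_total 0 e with he | he
  · rw [abs_of_nonneg he, hj, ← Real.mul_rpow zero_le_two (by positivity)]
    exact Real.rpow_le_rpow h0.le (hφ.bracket_le h) he
  · rw [abs_of_nonpos he, hj, Real.rpow_neg zero_le_two, ← Real.inv_rpow zero_le_two,
      ← Real.mul_rpow (by positivity) (by positivity)]
    exact Real.rpow_le_rpow_of_nonpos (by positivity) (hφ.le_bracket h) he

lemma freqNorm_eq (n : Freq) : freqNorm n = ‖(WithLp.toLp 2 fun i => (n i : ℝ) :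
    EuclideanSpace ℝ (Fin 3))‖ := by
  simp [freqNorm, EuclideanSpace.norm_eq]

lemma freqNorm_le_add (n m : Freq) : freqNorm n ≤ freqNorm (n + m) + freqNorm m := by
  rw [freqNorm_eq, freqNorm_eq, freqNorm_eq]
  refine le_trans (le_of_eq ?_) (norm_sub_le _ _)
  congr 1
  ext i
  simp

/-- A lower bound for the dyadic size of the frequencies of `P_j f P_k g`. -/
def outLevel (j k : ℕ) : ℕ := if j + 2 < k then k else if k + 2 < j then j else 0

/-- Separated frequencies cannot cancel: |d| ≥ (5/8) 2^k, while |m| ≤ (8/5) 2^j ≤ (1/5) 2^k because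
j + 3 ≤ k. -/
lemma IsBump.outLevel_le_aux (hφ : IsBump φ) {j k : ℕ} {m d : Freq} (hm : lpSymbol φ j m ≠ 0)
    (hd : lpSymbol φ k d ≠ 0) (hjk : j + 2 < k) : 4⁻¹ * 2 ^ k ≤ bracket (m + d) := by
  obtain ⟨i, rfl⟩ : ∃ i, k = j + (i + 2) + 1 := ⟨k - j - 3, by omega⟩
  have h1 := hφ.le_freqNorm hd
  have h2 := hφ.freqNorm_le hm
  have h3 := freqNorm_le_add d m
  rw [add_comm d m] at h3
  have h4 := freqNorm_le_bracket (m + d)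
  have h5 : (2 : ℝ) ^ (j + (i + 2) + 1) = 2 ^ j * 2 ^ i * 8 := by
    rw [pow_succ, pow_add, pow_add]; ring
  have h6 : (1 : ℝ) ≤ 2 ^ i := one_le_pow₀ one_le_two
  have h7 : (2 : ℝ) ^ j ≤ 2 ^ j * 2 ^ i := le_mul_of_one_le_right (by positivity) h6
  have h8 : (0 : ℝ) < 2 ^ j := by positivity
  rw [h5] at h1 ⊢
  linarith

lemma IsBump.outLevel_le (hφ : IsBump φ) {j k : ℕ} {m d : Freq} (hm : lpSymbol φ j m ≠ 0)
    (hd : lpSymbol φ k d ≠ 0) : 4⁻¹ * 2 ^ outLevel j k ≤ bracket (m + d) := by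
  rw [outLevel]
  split_ifs with h1 h2
  · exact hφ.outLevel_le_aux hm hd h1
  · rw [add_comm]; exact hφ.outLevel_le_aux hd hm h2
  · linarith [one_le_bracket (m + d), pow_zero (2 : ℝ)]

lemma bracket_rpow_le_of_outLevel {l : ℕ} {n : Freq} (h : 4⁻¹ * 2 ^ l ≤ bracket n) {b : ℝ}
    (hb : 0 ≤ b) : bracket n ^ (-b) ≤ 4 ^ b * 2 ^ (-b * l) := by
  have hj : (2 : ℝ) ^ (-b * l) = (2 ^ l) ^ (-b) := by
    rw [mul_comm, Real.rpow_mul zero_le_two, Real.rpow_natCast]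
  have h4 : (4 : ℝ) ^ b = 4⁻¹ ^ (-b) := by
    rw [Real.inv_rpow (by norm_num), Real.rpow_neg (by norm_num), inv_inv]
  rw [hj, h4, ← Real.mul_rpow (by positivity) (by positivity)]
  exact Real.rpow_le_rpow_of_nonpos (by positivity) h (by linarith)

lemma finite_bracket_le (R : ℝ) : {n : Freq | bracket n ≤ R}.Finite := by
  refine (Set.finite_Icc (fun _ => -⌈R⌉) (fun _ => ⌈R⌉ : Freq)).subset fun n hn => ?_
  have h1 : ∀ i, |(n i : ℝ)| ≤ ⌈R⌉ := fun i => by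
    refine le_trans ?_ ((freqNorm_le_bracket n).trans (le_trans hn (Int.le_ceil R)))
    rw [freqNorm, ← Real.sqrt_sq_eq_abs]
    exact Real.sqrt_le_sqrt (Finset.single_le_sum (f := fun i => (n i : ℝ) ^ 2)
      (fun i _ => sq_nonneg _) (Finset.mem_univ i))
  have h2 : ∀ i, |n i| ≤ ⌈R⌉ := fun i => by exact_mod_cast h1 i
  exact ⟨fun i => (abs_le.1 (h2 i)).1, fun i => (abs_le.1 (h2 i)).2⟩

lemma IsBump.finite_support (hφ : IsBump φ) (j : ℕ) : {n : Freq | lpSymbol φ j n ≠ 0}.Finite :=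
  (finite_bracket_le (2 * 2 ^ j)).subset fun _ hn => hφ.bracket_le hn

lemma pairSymbol_neg (S : Set (ℕ × ℕ)) (n m : Freq) :
    pairSymbol φ S (-n) (-m) = pairSymbol φ S n m := by
  simp only [pairSymbol, lpSymbol_neg]

lemma IsBump.pairSymbol_univ (hφ : IsBump φ) (n m : Freq) : pairSymbol φ univ n m = 1 := by
  have h1 := hφ.hasSum_dyadic (freqNorm n)
  have h2 := hφ.hasSum_dyadic (freqNorm m)
  simp only [pairSymbol, mem_univ, if_true, hφ.lpSymbol_eq]
  have h3 := h1.mul h2 (summable_mul_of_summable_norm h1.summable.norm h2.summable.norm)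
  simpa using h3.tsum_eq

end Symbols

end HartreeWave

namespace HartreeWave

/-! ### Bilinear estimates -/

section Bilinear

open ComplexConjugate

variable {φ : ℝ → ℝ}

/-- Minkowski's inequality in `ℓ²` for series. -/
lemma sum_sq_le_of_hasSum {ι κ : Type*} {F : Finset ι} {y : ι → ℂ} {Y : κ → ι → ℂ} {B : κ → ℝ}
    {b : ℝ} (hy : ∀ n ∈ F, HasSum (fun z => Y z n) (y n)) (hB : HasSum B b) (hB0 : ∀ z, 0 ≤ B z)
    (hY : ∀ z, ∑ n ∈ F, ‖Y z n‖ ^ 2 ≤ B z ^ 2) : ∑ n ∈ F, ‖y n‖ ^ 2 ≤ b ^ 2 := by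
  set S := ∑ n ∈ F, ‖y n‖ ^ 2 with hS
  have hS0 : 0 ≤ S := Finset.sum_nonneg fun _ _ => sq_nonneg _
  -- Duality: pairing with y itself reduces the claim to Cauchy-Schwarz for each z, and then one
  -- factor √S is divided out.
  have h1 : HasSum (fun z => ∑ n ∈ F, conj (y n) * Y z n) (∑ n ∈ F, conj (y n) * y n) :=
    hasSum_sum fun n hn => (hy n hn).mul_left _
  have h2 : ‖∑ n ∈ F, conj (y n) * y n‖ = S := by
    have : ∑ n ∈ F, conj (y n) * y n = ((S : ℝ) : ℂ) := by
      rw [hS]; push_cast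
      exact Finset.sum_congr rfl fun n _ => Complex.conj_mul' _
    rw [this, Complex.norm_real, Real.norm_of_nonneg hS0]
  have h3 : ‖∑ n ∈ F, conj (y n) * y n‖ ≤ Real.sqrt S * b := by
    refine h1.norm_le_of_bounded ((hB.mul_left (Real.sqrt S))) fun z => ?_
    refine (norm_sum_le _ _).trans ?_
    simp only [norm_mul, RCLike.norm_conj]
    refine (Real.sum_mul_le_sqrt_mul_sqrt _ _ _).trans ?_
    rw [← hS]
    gcongr
    exact Real.sqrt_le_iff.2 ⟨hB0 z, hY z⟩
  rw [h2] at h3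
  have hb : 0 ≤ b := hB.nonneg hB0
  have h4 : Real.sqrt S ≤ b := by
    rcases hS0.eq_or_lt with h | h
    · rw [← h, Real.sqrt_zero]; exact hb
    · have h5 := Real.sqrt_pos.2 h
      have h6 := Real.mul_self_sqrt hS0
      nlinarith
  calc S = Real.sqrt S ^ 2 := (Real.sq_sqrt hS0).symm
    _ ≤ b ^ 2 := by gcongr

lemma hasSum_sub_left {α : Type*} [AddCommMonoid α] [TopologicalSpace α] {f : Freq → α} {a : α}
    (n : Freq) : HasSum (fun m => f (n - m)) a ↔ HasSum f a :=
  (Equiv.subLeft n).hasSum_iff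

lemma exists_hasSum_mul {f g : TDist} {A B : ℝ} (hA : 0 ≤ A) (hB : 0 ≤ B)
    (hf : HasSum (fun n => ‖f n‖ ^ 2) (A ^ 2)) (hg : HasSum (fun n => ‖g n‖ ^ 2) (B ^ 2))
    (n : Freq) : ∃ C, 0 ≤ C ∧ C ≤ A * B ∧ HasSum (fun m => ‖f m‖ * ‖g (n - m)‖) C := by
  refine Real.inner_le_Lp_mul_Lq_hasSum_of_nonneg (p := 2) (q := 2) Real.HolderConjugate.two_two hA hB
    (fun _ => norm_nonneg _) (fun _ => norm_nonneg _) ?_ ?_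
  · simpa using hf
  · simpa using (hasSum_sub_left n).2 hg

lemma summable_two_rpow {κ : ℝ} (hκ : 0 < κ) :
    Summable fun z : ℕ × ℕ => (2 : ℝ) ^ (-(κ * (z.1 + z.2))) := by
  have h1 : Summable fun j : ℕ => (2 : ℝ) ^ (-κ * j) := by
    have : ∀ j : ℕ, (2 : ℝ) ^ (-κ * j) = (2 ^ (-κ)) ^ j := fun j => by
      rw [Real.rpow_mul zero_le_two, Real.rpow_natCast]
    simp only [this]
    exact summable_geometric_of_lt_one (by positivity)
      (Real.rpow_lt_one_of_one_lt_of_neg one_lt_two (by linarith))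
  refine (h1.mul_of_nonneg h1 (fun _ => by positivity) (fun _ => by positivity)).congr fun z => ?_
  rw [← Real.rpow_add two_pos]
  ring_nf

lemma bilin_neg {σ : Freq → Freq → ℝ} (hσ : ∀ n m, σ (-n) (-m) = σ n m) {f g : TDist}
    (hf : ∀ n, f (-n) = conj (f n)) (hg : ∀ n, g (-n) = conj (g n)) (n : Freq) :
    bilin σ f g (-n) = conj (bilin σ f g n) := by
  simp only [bilin]
  rw [Complex.conj_tsum, ← (Equiv.neg Freq).tsum_eq]
  refine tsum_congr fun m => ?_
  have : -n - (Equiv.neg Freq) m = -(n - m) := by simp [neg_sub]; abel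
  rw [this, Equiv.neg_apply, hσ, hf, hg]
  simp

lemma bessel_neg {s : ℝ} {p : ℝ≥0∞} (g : LpT p) (n : Freq) :
    bessel s g (-n) = conj (bessel s g n) := by
  simp [bessel_apply, bracket_neg, coef_neg_freq]

lemma bessel_add {s : ℝ} {p : ℝ≥0∞} [Fact (1 ≤ p)] (g h : LpT p) :
    bessel s (g + h) = bessel s g + bessel s h := by
  funext n; simp [bessel_apply, coef_add, mul_add]

lemma bessel_smul {s : ℝ} {p : ℝ≥0∞} [Fact (1 ≤ p)] (c : ℝ) (g : LpT p) :
    bessel s (c • g) = (c : ℂ) • bessel s g := by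
  funext n; simp [bessel_apply, coef_smul]; ring

lemma bessel_sub {s : ℝ} {p : ℝ≥0∞} [Fact (1 ≤ p)] (g h : LpT p) :
    bessel s (g - h) = bessel s g - bessel s h := by
  funext n; simp [bessel_apply, coef_sub, mul_sub]

lemma norm_bessel {s : ℝ} {p : ℝ≥0∞} (g : LpT p) (n : Freq) :
    ‖bessel s g n‖ = bracket n ^ (-s) * ‖coef g n‖ := by
  rw [bessel_apply, norm_mul, Complex.norm_real, Real.norm_of_nonneg
    (Real.rpow_nonneg (bracket_pos n).le _)]

lemma bilin_add_left {σ : Freq → Freq → ℝ} {f f' g : TDist} {n : Freq}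
    (h : Summable fun m => (σ m (n - m) : ℂ) * f m * g (n - m))
    (h' : Summable fun m => (σ m (n - m) : ℂ) * f' m * g (n - m)) :
    bilin σ (f + f') g n = bilin σ f g n + bilin σ f' g n := by
  simp only [bilin]
  rw [← h.tsum_add h']
  refine tsum_congr fun m => ?_
  simp only [Pi.add_apply]; ring

lemma bilin_add_right {σ : Freq → Freq → ℝ} {f g g' : TDist} {n : Freq}
    (h : Summable fun m => (σ m (n - m) : ℂ) * f m * g (n - m))
    (h' : Summable fun m => (σ m (n - m) : ℂ) * f m * g' (n - m)) :
    bilin σ f (g + g') n = bilin σ f g n + bilin σ f g' n := by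
  simp only [bilin]
  rw [← h.tsum_add h']
  refine tsum_congr fun m => ?_
  simp only [Pi.add_apply]; ring

lemma bilin_smul_left (σ : Freq → Freq → ℝ) (c : ℂ) (f g : TDist) :
    bilin σ (c • f) g = c • bilin σ f g := by
  funext n
  simp only [bilin, Pi.smul_apply, smul_eq_mul]
  rw [← tsum_mul_left]
  refine tsum_congr fun m => ?_
  ring

lemma bilin_smul_right (σ : Freq → Freq → ℝ) (c : ℂ) (f g : TDist) :
    bilin σ f (c • g) = c • bilin σ f g := by
  funext n
  simp only [bilin, Pi.smul_apply, smul_eq_mul]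
  rw [← tsum_mul_left]
  refine tsum_congr fun m => ?_
  ring

/-- Bounded bilinear operators from bounds in `ℓ²` of `⟨n⟩^{-b}` times the coefficients. -/
lemma exists_clm_bilin {p q : ℝ≥0∞} [Fact (1 ≤ p)] [Fact (1 ≤ q)] {σ : Freq → Freq → ℝ}
    (hσ : ∀ n m, σ (-n) (-m) = σ n m) (s t b C : ℝ) (hC : 0 ≤ C)
    (hsum : ∀ (f : LpT p) (g : LpT q) n,
      Summable fun m => (σ m (n - m) : ℂ) * bessel s f m * bessel t g (n - m))
    (hb : ∀ (f : LpT p) (g : LpT q) (F : Finset Freq),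
      ∑ n ∈ F, ‖((bracket n ^ (-b) : ℝ) : ℂ) * bilin σ (bessel s f) (bessel t g) n‖ ^ 2 ≤
        (C * ‖f‖ * ‖g‖) ^ 2) :
    ∃ T : LpT p →L[ℝ] LpT q →L[ℝ] LpT 2, ∀ f g,
      bilin σ (bessel s f) (bessel t g) = bessel (-b) (T f g) := by
  obtain ⟨T, hT⟩ := exists_clm₂ (fun (f : LpT p) (g : LpT q) n =>
      ((bracket n ^ (-b) : ℝ) : ℂ) * bilin σ (bessel s f) (bessel t g) n) C hC
    (fun f f' g => by
      funext n
      rw [bessel_add, bilin_add_left (hsum f g n) (hsum f' g n), Pi.add_apply, mul_add])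
    (fun c f g => by
      funext n
      rw [bessel_smul, bilin_smul_left, Pi.smul_apply, Pi.smul_apply]
      simp only [smul_eq_mul]; ring)
    (fun f g g' => by
      funext n
      rw [bessel_add, bilin_add_right (hsum f g n) (hsum f g' n), Pi.add_apply, mul_add])
    (fun c f g => by
      funext n
      rw [bessel_smul, bilin_smul_right, Pi.smul_apply, Pi.smul_apply]
      simp only [smul_eq_mul]; ring)
    (fun f g n => by
      rw [bilin_neg hσ (bessel_neg f) (bessel_neg g), bracket_neg, map_mul, Complex.conj_ofReal])
    hb
  refine ⟨T, fun f g => funext fun n => ?_⟩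
  rw [bessel_apply, hT, ← mul_assoc, ← Complex.ofReal_mul, ← Real.rpow_add (bracket_pos n)]
  simp

end Bilinear

end HartreeWave

namespace HartreeWave

/-! ### Paraproducts of Sobolev functions with W^{-a,∞}, block by block -/

section Paraproducts

open ComplexConjugate

variable {φ : ℝ → ℝ}

open Classical in
/-- The summand of `⟨∇⟩^{-s} f` against `⟨∇⟩^a ψ` in the block `(j, k)` of the product. -/
noncomputable def paraTerm (φ : ℝ → ℝ) (S : Set (ℕ × ℕ)) (s a : ℝ) (f : LpT 2) (ψ : LpT ∞)
    (n m : Freq) (z : ℕ × ℕ) : ℂ :=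
  ((if z ∈ S then lpSymbol φ z.1 m * lpSymbol φ z.2 (n - m) else 0 : ℝ) : ℂ) *
    bessel s f m * bessel (-a) ψ (n - m)

lemma tsum_paraTerm (S : Set (ℕ × ℕ)) (s a : ℝ) (f : LpT 2) (ψ : LpT ∞) (n m : Freq) :
    ∑' z, paraTerm φ S s a f ψ n m z =
      (pairSymbol φ S m (n - m) : ℂ) * bessel s f m * bessel (-a) ψ (n - m) := by
  simp only [paraTerm]
  rw [tsum_mul_right, tsum_mul_right, pairSymbol, Complex.ofReal_tsum]

/-- Weight of the block `(j, k)`. -/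
lemma IsBump.norm_paraTerm_le (hφ : IsBump φ) {S : Set (ℕ × ℕ)} {s a b κ C : ℝ} (hb : 0 ≤ b)
    (hS : ∀ z ∈ S, -s * z.1 + a * z.2 - b * outLevel z.1 z.2 ≤ C - κ * (z.1 + z.2))
    (f : LpT 2) (ψ : LpT ∞) (n m : Freq) (z : ℕ × ℕ) :
    ‖paraTerm φ S s a f ψ n m z‖ ≤ bracket n ^ b * (2 ^ |s| * 2 ^ |a| * 4 ^ b * 2 ^ C *
      2 ^ (-(κ * (z.1 + z.2)))) * (‖coef f m‖ * ‖coef ψ (n - m)‖) := by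
  have hn := bracket_pos n
  rw [paraTerm]
  by_cases h : z ∈ S ∧ lpSymbol φ z.1 m ≠ 0 ∧ lpSymbol φ z.2 (n - m) ≠ 0
  · obtain ⟨hz, h1, h2⟩ := h
    rw [if_pos hz, norm_mul, norm_mul, norm_bessel, norm_bessel, Complex.norm_real,
      Real.norm_eq_abs, abs_mul, neg_neg]
    have e1 := hφ.bracket_rpow_le h1 (-s)
    have e2 := hφ.bracket_rpow_le h2 a
    have e3 := hφ.outLevel_le h1 h2
    rw [add_sub_cancel] at e3
    have e4 := bracket_rpow_le_of_outLevel e3 hb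
    have e5 := hφ.abs_lpSymbol_le z.1 m
    have e6 := hφ.abs_lpSymbol_le z.2 (n - m)
    have p1 := bracket_pos m
    have p2 := bracket_pos (n - m)
    have e7 : (2 : ℝ) ^ (-s * z.1) * 2 ^ (a * z.2) * 2 ^ (-b * outLevel z.1 z.2) ≤
        2 ^ C * 2 ^ (-(κ * (z.1 + z.2))) := by
      rw [← Real.rpow_add two_pos, ← Real.rpow_add two_pos, ← Real.rpow_add two_pos]
      refine Real.rpow_le_rpow_of_exponent_le one_le_two ?_
      linarith [hS z hz]
    have e8 : 1 = bracket n ^ b * bracket n ^ (-b) := by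
      rw [← Real.rpow_add hn, add_neg_cancel, Real.rpow_zero]
    rw [abs_neg] at e1
    calc |lpSymbol φ z.1 m| * |lpSymbol φ z.2 (n - m)| * (bracket m ^ (-s) * ‖coef f m‖) *
          (bracket (n - m) ^ a * ‖coef ψ (n - m)‖)
        ≤ 1 * 1 * (2 ^ |s| * 2 ^ (-s * z.1) * ‖coef f m‖) *
          (2 ^ |a| * 2 ^ (a * z.2) * ‖coef ψ (n - m)‖) := by gcongr
      _ = (bracket n ^ b * bracket n ^ (-b)) * (2 ^ |s| * 2 ^ (-s * z.1) * ‖coef f m‖ *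
          (2 ^ |a| * 2 ^ (a * z.2) * ‖coef ψ (n - m)‖)) := by rw [← e8]; ring
      _ ≤ (bracket n ^ b * (4 ^ b * 2 ^ (-b * outLevel z.1 z.2))) *
          (2 ^ |s| * 2 ^ (-s * z.1) * ‖coef f m‖ *
          (2 ^ |a| * 2 ^ (a * z.2) * ‖coef ψ (n - m)‖)) := by gcongr
      _ = bracket n ^ b * (2 ^ |s| * 2 ^ |a| * 4 ^ b *
          (2 ^ (-s * z.1) * 2 ^ (a * z.2) * 2 ^ (-b * outLevel z.1 z.2))) *
          (‖coef f m‖ * ‖coef ψ (n - m)‖) := by ring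
      _ ≤ bracket n ^ b * (2 ^ |s| * 2 ^ |a| * 4 ^ b *
          (2 ^ C * 2 ^ (-(κ * (z.1 + z.2))))) * (‖coef f m‖ * ‖coef ψ (n - m)‖) := by gcongr
      _ = _ := by ring
  · have h0 : z ∈ S → lpSymbol φ z.1 m * lpSymbol φ z.2 (n - m) = 0 := fun hz => by
      by_contra h1
      exact h ⟨hz, left_ne_zero_of_mul h1, right_ne_zero_of_mul h1⟩
    split_ifs with hz
    · rw [h0 hz, Complex.ofReal_zero, zero_mul, zero_mul, norm_zero]
      positivity
    · rw [Complex.ofReal_zero, zero_mul, zero_mul, norm_zero]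
      positivity

lemma hasSum_coef_inclL2 (ψ : LpT ∞) : HasSum (fun n => ‖coef ψ n‖ ^ 2) (‖inclL2 ψ‖ ^ 2) := by
  rw [← coef_inclL2]; exact hasSum_coef_sq _

lemma summable_norm_coef_mul (f : LpT 2) (ψ : LpT ∞) (n : Freq) :
    Summable fun m => ‖coef f m‖ * ‖coef ψ (n - m)‖ :=
  let ⟨_, _, _, h⟩ := exists_hasSum_mul (norm_nonneg f) (norm_nonneg _) (hasSum_coef_sq f)
    (hasSum_coef_inclL2 ψ) n
  h.summable

/-- Absolute summability jointly in the frequency and in the block. It permits exchanging the sum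
over (j, k) in the symbol with the convolution sum. -/
lemma IsBump.summable_paraTerm (hφ : IsBump φ) {S : Set (ℕ × ℕ)} {s a b κ C : ℝ} (hb : 0 ≤ b)
    (hκ : 0 < κ) (hS : ∀ z ∈ S, -s * z.1 + a * z.2 - b * outLevel z.1 z.2 ≤ C - κ * (z.1 + z.2))
    (f : LpT 2) (ψ : LpT ∞) (n : Freq) :
    Summable (Function.uncurry fun m z => paraTerm φ S s a f ψ n m z) := by
  have h1 := (summable_norm_coef_mul f ψ n).mul_of_nonneg (summable_two_rpow hκ)
    (fun _ => by positivity) (fun _ => by positivity)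
  refine Summable.of_norm_bounded
    (h1.mul_left (bracket n ^ b * (2 ^ |s| * 2 ^ |a| * 4 ^ b * 2 ^ C))) fun z => ?_
  refine (hφ.norm_paraTerm_le hb hS f ψ n z.1 z.2).trans (le_of_eq ?_)
  ring

/-- The `ℓ²` bound of one block. -/
lemma IsBump.exists_block_bound (hφ : IsBump φ) {S : Set (ℕ × ℕ)} {s a b κ C : ℝ} (hb : 0 ≤ b)
    (hS : ∀ z ∈ S, -s * z.1 + a * z.2 - b * outLevel z.1 z.2 ≤ C - κ * (z.1 + z.2)) :
    ∃ D : ℝ, 0 ≤ D ∧ ∀ (f : LpT 2) (ψ : LpT ∞) (z : ℕ × ℕ) (F : Finset Freq),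
      ∑ n ∈ F, ‖((bracket n ^ (-b) : ℝ) : ℂ) * ∑' m, paraTerm φ S s a f ψ n m z‖ ^ 2 ≤
        (D * 2 ^ (-(κ * (z.1 + z.2))) * (‖f‖ * ‖ψ‖)) ^ 2 := by
  obtain ⟨M, hM, hT⟩ := hφ.exists_toeplitzBound a
  refine ⟨M * 2 ^ |s| * 4 ^ b * 2 ^ C, by positivity, fun f ψ z F => ?_⟩
  by_cases hz : z ∈ S
  swap
  · simp only [paraTerm, if_neg hz, Complex.ofReal_zero, zero_mul, tsum_zero, mul_zero, norm_zero]
    simp only [ne_eq, OfNat.ofNat_ne_zero, not_false_eq_true, zero_pow, Finset.sum_const_zero]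
    positivity
  -- P_j f has finitely many frequencies, so the block is a finite Toeplitz form applied to v.
  set G := (hφ.finite_support z.1).toFinset with hG
  set y : TDist := fun n => ((bracket n ^ (-b) : ℝ) : ℂ) * ∑' m, paraTerm φ S s a f ψ n m z with hy
  set v : TDist := fun m => (lpSymbol φ z.1 m : ℂ) * bessel s f m with hv
  set c : TDist := fun n => ((dyadic φ z.2 (freqNorm n) * bracket n ^ a : ℝ) : ℂ) * coef ψ n with hc
  have hsum : ∀ n, ∑' m, paraTerm φ S s a f ψ n m z = ∑ m ∈ G, c (n - m) * v m := by
    intro n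
    rw [tsum_eq_sum (s := G)]
    · refine Finset.sum_congr rfl fun m _ => ?_
      simp only [paraTerm, if_pos hz, hc, hv, bessel_apply (s := -a), neg_neg, ← hφ.lpSymbol_eq]
      push_cast
      ring
    · intro m hm
      have : lpSymbol φ z.1 m = 0 := by simpa [hG] using hm
      rw [paraTerm, if_pos hz, this]
      simp
  set W : ℝ := 4 ^ b * 2 ^ (-b * outLevel z.1 z.2) with hW
  have hW0 : 0 ≤ W := by positivity
  -- The weight ⟨n⟩^{-b} is traded for 2^{-b l}, l the output level, only at frequencies that the
  -- block reaches.
  have hyW : ∀ n, y n ≠ 0 → bracket n ^ (-b) ≤ W := by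
    intro n hn
    refine bracket_rpow_le_of_outLevel ?_ hb
    by_contra hlt
    refine hn ?_
    simp only [hy]
    rw [hsum, Finset.sum_eq_zero, mul_zero]
    intro m _
    by_cases h1 : lpSymbol φ z.1 m = 0
    · simp [hv, h1]
    by_cases h2 : lpSymbol φ z.2 (n - m) = 0
    · rw [hφ.lpSymbol_eq] at h2
      simp [hc, h2]
    · have := hφ.outLevel_le h1 h2
      rw [add_sub_cancel] at this
      exact absurd this hlt
  set Q := ∑ n ∈ F, ‖y n‖ ^ 2 with hQ
  have hQ0 : 0 ≤ Q := Finset.sum_nonneg fun _ _ => sq_nonneg _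
  -- The block is tested on its own output: for this u the form equals Q = Σ |y n|², and the
  -- Toeplitz bound becomes Q ≤ R √Q.
  set u : TDist := fun n => conj (y n) * ((bracket n ^ (-b) : ℝ) : ℂ) with hu
  have hform : ∑ n ∈ F, ∑ m ∈ G, u n * c (n - m) * v m = ((Q : ℝ) : ℂ) := by
    rw [hQ]; push_cast
    refine Finset.sum_congr rfl fun n _ => ?_
    have hyn : y n = ((bracket n ^ (-b) : ℝ) : ℂ) * ∑ m ∈ G, c (n - m) * v m := by
      rw [← hsum]
    rw [← Complex.conj_mul' (y n)]
    nth_rewrite 2 [hyn]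
    simp only [Finset.mul_sum, hu]
    refine Finset.sum_congr rfl fun m _ => ?_
    ring
  have hu2 : Real.sqrt (∑ n ∈ F, ‖u n‖ ^ 2) ≤ W * Real.sqrt Q := by
    rw [Real.sqrt_le_left (by positivity), mul_pow, Real.sq_sqrt hQ0, hQ, Finset.mul_sum]
    refine Finset.sum_le_sum fun n _ => ?_
    rw [hu]
    simp only [norm_mul, RCLike.norm_conj, Complex.norm_real]
    rw [Real.norm_of_nonneg (Real.rpow_nonneg (bracket_pos n).le _), mul_pow, mul_comm]
    by_cases h : y n = 0
    · simp [h]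
    · gcongr
      · exact Real.rpow_nonneg (bracket_pos n).le _
      · exact hyW n h
  have hv2 : Real.sqrt (∑ m ∈ G, ‖v m‖ ^ 2) ≤ 2 ^ |s| * 2 ^ (-s * z.1) * ‖f‖ := by
    rw [Real.sqrt_le_left (by positivity), mul_pow]
    refine le_trans ?_ (mul_le_mul_of_nonneg_left (sum_coef_sq_le f G) (by positivity))
    rw [Finset.mul_sum]
    refine Finset.sum_le_sum fun m hm => ?_
    rw [← mul_pow]
    have h1 : lpSymbol φ z.1 m ≠ 0 := by simpa [hG] using hm
    have h2 := hφ.bracket_rpow_le h1 (-s)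
    rw [abs_neg] at h2
    have h3 := hφ.abs_lpSymbol_le z.1 m
    have h4 := Real.rpow_nonneg (bracket_pos m).le (-s)
    rw [hv]
    simp only [norm_mul, norm_bessel, Complex.norm_real, Real.norm_eq_abs]
    refine pow_le_pow_left₀ (by positivity) ?_ 2
    calc |lpSymbol φ z.1 m| * (bracket m ^ (-s) * ‖coef f m‖)
        ≤ 1 * (2 ^ |s| * 2 ^ (-s * z.1) * ‖coef f m‖) := by gcongr
      _ = _ := one_mul _
  have hmain : Q ≤ (M * 2 ^ |s| * 4 ^ b * 2 ^ C * 2 ^ (-(κ * (z.1 + z.2))) * (‖f‖ * ‖ψ‖)) *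
      Real.sqrt Q := by
    have h1 := hT z.2 ψ F G u v
    rw [hform, Complex.norm_real, Real.norm_of_nonneg hQ0] at h1
    have e7 : (2 : ℝ) ^ (-s * z.1) * 2 ^ (a * z.2) * 2 ^ (-b * outLevel z.1 z.2) ≤
        2 ^ C * 2 ^ (-(κ * (z.1 + z.2))) := by
      rw [← Real.rpow_add two_pos, ← Real.rpow_add two_pos, ← Real.rpow_add two_pos]
      refine Real.rpow_le_rpow_of_exponent_le one_le_two ?_
      linarith [hS z hz]
    calc Q ≤ M * 2 ^ (a * z.2) * ‖ψ‖ * (√(∑ n ∈ F, ‖u n‖ ^ 2) * √(∑ m ∈ G, ‖v m‖ ^ 2)) := h1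
      _ ≤ M * 2 ^ (a * z.2) * ‖ψ‖ * (W * Real.sqrt Q * (2 ^ |s| * 2 ^ (-s * z.1) * ‖f‖)) := by
        gcongr
      _ = M * 2 ^ |s| * 4 ^ b * (2 ^ (-s * z.1) * 2 ^ (a * z.2) * 2 ^ (-b * outLevel z.1 z.2)) *
          (‖f‖ * ‖ψ‖) * Real.sqrt Q := by rw [hW]; ring
      _ ≤ M * 2 ^ |s| * 4 ^ b * (2 ^ C * 2 ^ (-(κ * (z.1 + z.2)))) *
          (‖f‖ * ‖ψ‖) * Real.sqrt Q := by gcongr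
      _ = _ := by ring
  set R := M * 2 ^ |s| * 4 ^ b * 2 ^ C * 2 ^ (-(κ * (z.1 + z.2))) * (‖f‖ * ‖ψ‖) with hR
  have hR0 : 0 ≤ R := by positivity
  have h4 : Real.sqrt Q ≤ R := by
    rcases hQ0.eq_or_lt with h | h
    · rw [← h, Real.sqrt_zero]; exact hR0
    · have h5 := Real.sqrt_pos.2 h
      have h6 := Real.mul_self_sqrt hQ0
      nlinarith
  calc Q = Real.sqrt Q ^ 2 := (Real.sq_sqrt hQ0).symm
    _ ≤ R ^ 2 := by gcongr

/-- Paraproduct estimate `H^s × W^{-a,∞} → H^{-b}` for the part `S` of the product. -/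
theorem IsBump.exists_para (hφ : IsBump φ) {S : Set (ℕ × ℕ)} {s a b κ C : ℝ} (hb : 0 ≤ b)
    (hκ : 0 < κ) (hS : ∀ z ∈ S, -s * z.1 + a * z.2 - b * outLevel z.1 z.2 ≤ C - κ * (z.1 + z.2)) :
    ∃ T : LpT 2 →L[ℝ] LpT ∞ →L[ℝ] LpT 2, ∀ f ψ,
      bilin (pairSymbol φ S) (bessel s f) (bessel (-a) ψ) = bessel (-b) (T f ψ) := by
  obtain ⟨D, hD, hDb⟩ := hφ.exists_block_bound hb hS
  have hs2 := summable_two_rpow hκ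
  have hts0 : 0 ≤ ∑' z : ℕ × ℕ, (2 : ℝ) ^ (-(κ * (z.1 + z.2))) := tsum_nonneg fun _ => by positivity
  refine exists_clm_bilin (fun n m => pairSymbol_neg S n m) s (-a) b
    (D * ∑' z : ℕ × ℕ, (2 : ℝ) ^ (-(κ * (z.1 + z.2)))) (by positivity) ?_ ?_
  · intro f ψ n
    have h := (hφ.summable_paraTerm hb hκ hS f ψ n).prod
    simp only [Function.uncurry, tsum_paraTerm] at h
    exact h
  · intro f ψ F
    have h1 : ∀ n, HasSum (fun z => ((bracket n ^ (-b) : ℝ) : ℂ) *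
        ∑' m, paraTerm φ S s a f ψ n m z) (((bracket n ^ (-b) : ℝ) : ℂ) *
          bilin (pairSymbol φ S) (bessel s f) (bessel (-a) ψ) n) := by
      intro n
      refine HasSum.mul_left _ ?_
      have h2 := hφ.summable_paraTerm hb hκ hS f ψ n
      have h3 : bilin (pairSymbol φ S) (bessel s f) (bessel (-a) ψ) n =
          ∑' z, ∑' m, paraTerm φ S s a f ψ n m z := by
        rw [h2.tsum_comm]
        simp only [tsum_paraTerm]
        rfl
      rw [h3]
      exact (h2.prod_symm.prod).hasSum
    refine (sum_sq_le_of_hasSum (fun n _ => h1 n)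
      ((hs2.hasSum.mul_left D).mul_right (‖f‖ * ‖ψ‖)) (fun z => by positivity)
      (fun z => hDb f ψ z F)).trans (le_of_eq ?_)
    ring

end Paraproducts

end HartreeWave

namespace HartreeWave

/-! ### Products of two Sobolev functions -/

section Products

/-- The threshold 3 is the rank of the lattice ℤ³. The sup norm of n is at most ⟨n⟩, and the point n
= 0, where the lattice norm vanishes, is added separately. -/
lemma summable_bracket {r : ℝ} (hr : 3 < r) : Summable fun n : Freq => bracket n ^ (-r) := by
  set L := Submodule.span ℤ (Set.range (Pi.basisFun ℝ (Fin 3))) with hL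
  have hfr : Module.finrank ℤ L = 3 := by
    rw [hL, ZLattice.rank ℝ]; simp
  have h := ZLattice.summable_norm_rpow L (-r) (by rw [hfr]; norm_num; exact hr)
  have hmem : ∀ n : Freq, (fun i => (n i : ℝ)) ∈ L := fun n => by
    rw [hL, Module.Basis.mem_span_iff_repr_mem ℤ]
    intro i; exact ⟨n i, by simp⟩
  have hinj : Function.Injective fun n : Freq => (⟨_, hmem n⟩ : L) := by
    intro n m hnm
    have h1 : (fun i => (n i : ℝ)) = fun i => (m i : ℝ) := congrArg Subtype.val hnm
    funext i
    exact Int.cast_injective (congrFun h1 i)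
  have h2 := h.comp_injective hinj
  refine (summable_of_ne_finset_zero (s := {0}) (f := fun n : Freq => if n = 0 then (1 : ℝ) else 0)
    (by intro n hn; simpa using hn)).add h2 |>.of_nonneg_of_le
      (fun n => Real.rpow_nonneg (bracket_pos n).le _) fun n => ?_
  by_cases hn : n = 0
  · subst hn
    have : bracket 0 = 1 := by simp [bracket, freqNorm]
    simp only [this, Real.one_rpow, if_true, Function.comp]
    linarith [Real.rpow_nonneg (norm_nonneg (⟨_, hmem 0⟩ : L)) (-r)]
  · simp only [hn, if_false, zero_add, Function.comp]
    have hpos : 0 < ‖(fun i => (n i : ℝ))‖ := by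
      rw [norm_pos_iff]; intro h0; apply hn; funext i; exact Int.cast_eq_zero.1 (congrFun h0 i)
    refine Real.rpow_le_rpow_of_nonpos hpos ?_ (by linarith)
    refine le_trans ?_ (freqNorm_le_bracket n)
    refine (pi_norm_le_iff_of_nonneg (freqNorm_nonneg n)).2 ?_
    intro i
    rw [Real.norm_eq_abs, freqNorm, ← Real.sqrt_sq_eq_abs]
    exact Real.sqrt_le_sqrt (Finset.single_le_sum (f := fun i => (n i : ℝ) ^ 2)
      (fun i _ => sq_nonneg _) (Finset.mem_univ i))

/-- Each factor is at most the corresponding power of the smallest of the three bases, so the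
product is at most one of the three terms on the right. -/
lemma three_weights {x y z u s t : ℝ} (hx : 1 ≤ x) (hy : 1 ≤ y) (hz : 1 ≤ z) (hu : 0 ≤ u)
    (hs : 0 ≤ s) (ht : 0 ≤ t) : x ^ (-u) * y ^ (-s) * z ^ (-t) ≤
      x ^ (-(u + s + t)) + y ^ (-(u + s + t)) + z ^ (-(u + s + t)) := by
  have key : ∀ w : ℝ, 1 ≤ w → w ≤ x → w ≤ y → w ≤ z →
      x ^ (-u) * y ^ (-s) * z ^ (-t) ≤ w ^ (-(u + s + t)) := by
    intro w hw h1 h2 h3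
    have hw0 : 0 < w := by linarith
    rw [show -(u + s + t) = -u + -s + -t by ring, Real.rpow_add hw0, Real.rpow_add hw0]
    have e1 := Real.rpow_le_rpow_of_nonpos hw0 h1 (neg_nonpos.2 hu)
    have e2 := Real.rpow_le_rpow_of_nonpos hw0 h2 (neg_nonpos.2 hs)
    have e3 := Real.rpow_le_rpow_of_nonpos hw0 h3 (neg_nonpos.2 ht)
    gcongr
  have p1 : 0 ≤ x ^ (-(u + s + t)) := by positivity
  have p2 : 0 ≤ y ^ (-(u + s + t)) := by positivity
  have p3 : 0 ≤ z ^ (-(u + s + t)) := by positivity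
  rcases le_total x y with h1 | h1 <;> rcases le_total y z with h2 | h2 <;>
    rcases le_total x z with h3 | h3
  all_goals first
    | linarith [key x hx le_rfl (by linarith) (by linarith)]
    | linarith [key y hy (by linarith) le_rfl (by linarith)]
    | linarith [key z hz (by linarith) (by linarith) le_rfl]

/-- The product estimate `H^s × H^t → H^{-u}`. -/
theorem exists_prod {s t u : ℝ} (hs : 0 ≤ s) (ht : 0 ≤ t) (hu : 0 ≤ u) (hsum : 3 / 2 < u + s + t) :
    ∃ T : LpT 2 →L[ℝ] LpT 2 →L[ℝ] LpT 2, ∀ f g,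
      prodT (bessel s f) (bessel t g) = bessel (-u) (T f g) := by
  set κ := u + s + t with hκ
  have hB := summable_bracket (r := 2 * κ) (by linarith)
  set B := Real.sqrt (∑' n : Freq, bracket n ^ (-(2 * κ))) with hBdef
  have hB0 : 0 ≤ B := Real.sqrt_nonneg _
  have hBn : ∀ n : Freq, ‖((bracket n ^ (-κ) : ℝ) : ℂ)‖ ^ 2 = bracket n ^ (-(2 * κ)) := fun n => by
    rw [Complex.norm_real, Real.norm_of_nonneg (Real.rpow_nonneg (bracket_pos n).le _),
      ← Real.rpow_natCast, ← Real.rpow_mul (bracket_pos n).le]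
    congr 1; push_cast; ring
  have hBsum : HasSum (fun n : Freq => ‖((bracket n ^ (-κ) : ℝ) : ℂ)‖ ^ 2) (B ^ 2) := by
    rw [hBdef, Real.sq_sqrt (tsum_nonneg fun n => Real.rpow_nonneg (bracket_pos n).le _)]
    simp only [hBn]
    exact hB.hasSum
  -- A single frequency absorbs all κ = u + s + t > 3/2 derivatives, and ⟨·⟩^{-κ} is in ℓ². If it is
  -- the output frequency, Cauchy-Schwarz bounds the convolution in ℓ^∞; if it is an input
  -- frequency, that input is in ℓ¹ and Young applies.
  have hterm : ∀ (f g : LpT 2) (n m : Freq),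
      bracket n ^ (-u) * ‖bessel s f m * bessel t g (n - m)‖ ≤
        bracket n ^ (-κ) * (‖coef f m‖ * ‖coef g (n - m)‖) +
        (bracket m ^ (-κ) * ‖coef f m‖) * ‖coef g (n - m)‖ +
        (bracket (n - m) ^ (-κ) * ‖coef g (n - m)‖) * ‖coef f m‖ := by
    intro f g n m
    have h := three_weights (one_le_bracket n) (one_le_bracket m) (one_le_bracket (n - m)) hu hs ht
    rw [norm_mul, norm_bessel, norm_bessel]
    calc bracket n ^ (-u) * (bracket m ^ (-s) * ‖coef f m‖ *
          (bracket (n - m) ^ (-t) * ‖coef g (n - m)‖))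
        = (bracket n ^ (-u) * bracket m ^ (-s) * bracket (n - m) ^ (-t)) *
          (‖coef f m‖ * ‖coef g (n - m)‖) := by ring
      _ ≤ _ := mul_le_mul_of_nonneg_right h (by positivity)
      _ = _ := by ring
  have hl1 : ∀ f : LpT 2, ∃ D, 0 ≤ D ∧ D ≤ B * ‖f‖ ∧
      HasSum (fun m => bracket m ^ (-κ) * ‖coef f m‖) D := by
    intro f
    have hf : HasSum (fun n => ‖coef f (-n)‖ ^ 2) (‖f‖ ^ 2) :=
      (Equiv.neg Freq).hasSum_iff.2 (hasSum_coef_sq f)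
    obtain ⟨D, h1, h2, h3⟩ := exists_hasSum_mul (f := fun n => ((bracket n ^ (-κ) : ℝ) : ℂ))
      (g := fun n => coef f (-n)) hB0 (norm_nonneg f) hBsum hf 0
    refine ⟨D, h1, h2, ?_⟩
    simpa [abs_of_nonneg (Real.rpow_nonneg (bracket_pos _).le _)] using h3
  have hsm1 : ∀ (f g : LpT 2) n, Summable fun m => ‖coef f m‖ * ‖coef g (n - m)‖ := fun f g n =>
    let ⟨_, _, _, h⟩ := exists_hasSum_mul (norm_nonneg f) (norm_nonneg g) (hasSum_coef_sq f)
      (hasSum_coef_sq g) n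
    h.summable
  have hle1 : ∀ n, bracket n ^ (-κ) ≤ 1 := fun n =>
    Real.rpow_le_one_of_one_le_of_nonpos (one_le_bracket n) (by linarith)
  have hsm2 : ∀ (f g : LpT 2) n,
      Summable fun m => (bracket m ^ (-κ) * ‖coef f m‖) * ‖coef g (n - m)‖ := fun f g n =>
    (hsm1 f g n).of_nonneg_of_le (fun m => mul_nonneg (mul_nonneg
      (Real.rpow_nonneg (bracket_pos m).le _) (norm_nonneg _)) (norm_nonneg _)) fun m => by
      gcongr; exact mul_le_of_le_one_left (norm_nonneg _) (hle1 m)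
  have hsm3 : ∀ (f g : LpT 2) n,
      Summable fun m => (bracket (n - m) ^ (-κ) * ‖coef g (n - m)‖) * ‖coef f m‖ := fun f g n =>
    (hsm1 f g n).of_nonneg_of_le (fun m => mul_nonneg (mul_nonneg
      (Real.rpow_nonneg (bracket_pos _).le _) (norm_nonneg _)) (norm_nonneg _)) fun m => by
      rw [mul_comm ‖coef f m‖]
      gcongr; exact mul_le_of_le_one_left (norm_nonneg _) (hle1 _)
  have hyoung : ∀ (f g : LpT 2) (F : Finset Freq), ∑ n ∈ F,
      ‖((∑' m, (bracket m ^ (-κ) * ‖coef f m‖) * ‖coef g (n - m)‖ : ℝ) : ℂ)‖ ^ 2 ≤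
        (B * ‖f‖ * ‖g‖) ^ 2 := by
    intro f g F
    obtain ⟨D, h1, h2, h3⟩ := hl1 f
    refine (sum_sq_le_of_hasSum (Y := fun m n => (((bracket m ^ (-κ) * ‖coef f m‖) *
      ‖coef g (n - m)‖ : ℝ) : ℂ)) (fun n _ => Complex.hasSum_ofReal.2 (hsm2 f g n).hasSum)
      (h3.mul_right ‖g‖) (fun m => mul_nonneg (mul_nonneg
      (Real.rpow_nonneg (bracket_pos m).le _) (norm_nonneg _)) (norm_nonneg _))
      (fun m => ?_)).trans (by gcongr)
    simp only [Complex.norm_real, Real.norm_eq_abs, sq_abs, mul_pow]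
    rw [← Finset.mul_sum]
    refine mul_le_mul_of_nonneg_left ?_ (by positivity)
    exact sum_le_hasSum F (fun _ _ => by positivity) ((Equiv.subRight m).hasSum_iff.2
      (hasSum_coef_sq g))
  refine exists_clm_bilin (fun _ _ => rfl) s t u (3 * B) (by positivity) (fun f g n => ?_)
    (fun f g F => ?_)
  · refine Summable.of_norm_bounded ((((hsm1 f g n).mul_left (bracket n ^ (-κ))).add
      (hsm2 f g n) |>.add (hsm3 f g n)).mul_left (bracket n ^ u)) fun m => ?_
    rw [Complex.ofReal_one, one_mul]
    have h1 := mul_le_mul_of_nonneg_left (hterm f g n m) (Real.rpow_nonneg (bracket_pos n).le u)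
    rwa [← mul_assoc, ← Real.rpow_add (bracket_pos n), add_neg_cancel, Real.rpow_zero,
      one_mul] at h1
  · set y₁ : Freq → ℝ := fun n => bracket n ^ (-κ) * ∑' m, ‖coef f m‖ * ‖coef g (n - m)‖ with hy₁
    set y₂ : Freq → ℝ := fun n => ∑' m, (bracket m ^ (-κ) * ‖coef f m‖) * ‖coef g (n - m)‖ with hy₂
    set y₃ : Freq → ℝ := fun n => ∑' m, (bracket (n - m) ^ (-κ) * ‖coef g (n - m)‖) * ‖coef f m‖
      with hy₃
    have b1 : ∑ n ∈ F, y₁ n ^ 2 ≤ (B * ‖f‖ * ‖g‖) ^ 2 := by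
      have h1 : ∀ n, y₁ n ^ 2 ≤ ‖((bracket n ^ (-κ) : ℝ) : ℂ)‖ ^ 2 * (‖f‖ * ‖g‖) ^ 2 := by
        intro n
        obtain ⟨D, e1, e2, e3⟩ := exists_hasSum_mul (norm_nonneg f) (norm_nonneg g)
          (hasSum_coef_sq f) (hasSum_coef_sq g) n
        simp only [hy₁]
        rw [e3.tsum_eq, mul_pow, Complex.norm_real, Real.norm_eq_abs, sq_abs]
        gcongr
      refine (Finset.sum_le_sum fun n _ => h1 n).trans ?_
      rw [← Finset.sum_mul, mul_assoc B, mul_pow B]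
      gcongr
      exact sum_le_hasSum F (fun _ _ => by positivity) hBsum
    have b2 : ∑ n ∈ F, y₂ n ^ 2 ≤ (B * ‖f‖ * ‖g‖) ^ 2 := by
      simpa [Complex.norm_real, sq_abs] using hyoung f g F
    have b3 : ∑ n ∈ F, y₃ n ^ 2 ≤ (B * ‖f‖ * ‖g‖) ^ 2 := by
      have h1 := hyoung g f F
      have h2 : ∀ n, y₃ n = ∑' m, (bracket m ^ (-κ) * ‖coef g m‖) * ‖coef f (n - m)‖ := fun n => by
        rw [hy₃, ← (Equiv.subLeft n).tsum_eq]
        simp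
      simp only [h2]
      refine le_trans (le_of_eq ?_) (h1.trans (le_of_eq (by ring)))
      simp [Complex.norm_real, sq_abs]
    have hle : ∀ n, ‖((bracket n ^ (-u) : ℝ) : ℂ) *
        bilin (fun _ _ => 1) (bessel s f) (bessel t g) n‖ ≤ y₁ n + y₂ n + y₃ n := by
      intro n
      have e1 := (hsm1 f g n).mul_left (bracket n ^ (-κ))
      simp only [hy₁, hy₂, hy₃, bilin]
      rw [← tsum_mul_left (a := bracket n ^ (-κ)), ← e1.tsum_add (hsm2 f g n),
        ← (e1.add (hsm2 f g n)).tsum_add (hsm3 f g n), ← tsum_mul_left]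
      refine tsum_of_norm_bounded ((e1.add (hsm2 f g n)).add (hsm3 f g n)).hasSum fun m => ?_
      refine le_trans (le_of_eq ?_) (hterm f g n m)
      rw [Complex.ofReal_one, one_mul, norm_mul, Complex.norm_real,
        Real.norm_of_nonneg (Real.rpow_nonneg (bracket_pos n).le _)]
    calc ∑ n ∈ F, ‖((bracket n ^ (-u) : ℝ) : ℂ) *
          bilin (fun _ _ => 1) (bessel s f) (bessel t g) n‖ ^ 2
        ≤ ∑ n ∈ F, (3 * (y₁ n ^ 2 + y₂ n ^ 2 + y₃ n ^ 2)) := by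
          refine Finset.sum_le_sum fun n _ => ?_
          refine (pow_le_pow_left₀ (norm_nonneg _) (hle n) 2).trans ?_
          nlinarith [sq_nonneg (y₁ n - y₂ n), sq_nonneg (y₁ n - y₃ n), sq_nonneg (y₂ n - y₃ n)]
      _ ≤ _ := by
          rw [← Finset.mul_sum, Finset.sum_add_distrib, Finset.sum_add_distrib]
          nlinarith

end Products

end HartreeWave

namespace HartreeWave

/-! ### Fourier multipliers on `L²` and the damped wave equation -/

section FourierMultipliers

open ComplexConjugate

/-- An even real symbol bounded by `B`. -/
structure IsSymbol (B : ℝ) (c : Freq → ℝ) : Prop where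
  even : ∀ n, c (-n) = c n
  bound : ∀ n, |c n| ≤ B

lemma IsSymbol.nonneg {B : ℝ} {c : Freq → ℝ} (h : IsSymbol B c) : 0 ≤ B :=
  (abs_nonneg _).trans (h.bound 0)

lemma IsSymbol.exists_clm {B : ℝ} {c : Freq → ℝ} (h : IsSymbol B c) :
    ∃ T : LpT 2 →L[ℝ] LpT 2, (∀ g, coef (T g) = fun n => (c n : ℂ) * coef g n) ∧
      ∀ g, ‖T g‖ ≤ B * ‖g‖ := by
  refine HartreeWave.exists_clm (fun g n => (c n : ℂ) * coef g n) B h.nonneg ?_ ?_ ?_ ?_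
  · intro f g; funext n; simp [coef_add, mul_add]
  · intro r f; funext n; simp [coef_smul]; ring
  · intro f n; simp [h.even, coef_neg_freq]
  · intro f F
    rw [mul_pow]
    refine le_trans ?_ (mul_le_mul_of_nonneg_left (sum_coef_sq_le f F) (sq_nonneg B))
    rw [Finset.mul_sum]
    refine Finset.sum_le_sum fun n _ => ?_
    rw [norm_mul, mul_pow, Complex.norm_real, Real.norm_eq_abs]
    gcongr
    exact h.bound n

open Classical in
/-- The Fourier multiplier with symbol `c`. -/
noncomputable def multiplier (c : Freq → ℝ) : LpT 2 →L[ℝ] LpT 2 :=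
  if h : ∃ B, IsSymbol B c then h.choose_spec.exists_clm.choose else 0

lemma IsSymbol.coef_multiplier {B : ℝ} {c : Freq → ℝ} (h : IsSymbol B c) (g : LpT 2) (n : Freq) :
    coef (multiplier c g) n = (c n : ℂ) * coef g n := by
  have h' : ∃ B, IsSymbol B c := ⟨B, h⟩
  rw [multiplier, dif_pos h']
  exact congrFun (h'.choose_spec.exists_clm.choose_spec.1 g) n

lemma IsSymbol.norm_multiplier_le {B : ℝ} {c : Freq → ℝ} (h : IsSymbol B c) (g : LpT 2) :
    ‖multiplier c g‖ ≤ B * ‖g‖ := by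
  obtain ⟨T, hT, hT'⟩ := h.exists_clm
  have : multiplier c g = T g := coef_injective (by
    funext n; rw [h.coef_multiplier, hT])
  rw [this]; exact hT' g

/-- The coefficient functionals. -/
noncomputable def coefCLM (n : Freq) : LpT 2 →L[ℝ] ℂ :=
  LinearMap.mkContinuous
    { toFun := fun g => coef g n
      map_add' := fun g h => by rw [coef_add]; rfl
      map_smul' := fun c g => by rw [coef_smul]; rfl } 1
    (fun g => by rw [one_mul]; exact norm_coef_le g n)

lemma coefCLM_apply (n : Freq) (g : LpT 2) : coefCLM n g = coef g n := rfl

/-- A family of even symbols bounded by `B` and continuous in the parameter. -/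
structure SymbolFamily {X : Type*} [TopologicalSpace X] (B : ℝ) (p : X → Freq → ℝ) : Prop where
  symbol : ∀ x, IsSymbol B (p x)
  cont : ∀ n, Continuous fun x => p x n

/-- For fixed g this is dominated convergence in Parseval's sum, and the uniform bound B makes it
joint continuity. Only strong continuity is claimed: symbols like cos(t⟦n⟧) are not continuous in t
uniformly in n. -/
lemma SymbolFamily.continuous {X : Type*} [TopologicalSpace X] [FirstCountableTopology X]
    {B : ℝ} {p : X → Freq → ℝ}
    (h : SymbolFamily B p) : Continuous fun z : X × LpT 2 => multiplier (p z.1) z.2 := by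
  have hstrong : ∀ g : LpT 2, Continuous fun x => multiplier (p x) g := by
    intro g
    rw [continuous_iff_continuousAt]
    intro x₀
    rw [ContinuousAt, tendsto_iff_norm_sub_tendsto_zero]
    have hsq : Tendsto (fun x => ‖multiplier (p x) g - multiplier (p x₀) g‖ ^ 2) (𝓝 x₀)
        (𝓝 0) := by
      have hB := (h.symbol x₀).nonneg
      have h1 : ∀ x, ‖multiplier (p x) g - multiplier (p x₀) g‖ ^ 2 =
          ∑' n, |p x n - p x₀ n| ^ 2 * ‖coef g n‖ ^ 2 := by
        intro x
        rw [← (hasSum_coef_sq _).tsum_eq]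
        refine tsum_congr fun n => ?_
        rw [coef_sub, Pi.sub_apply, (h.symbol x).coef_multiplier, (h.symbol x₀).coef_multiplier,
          ← sub_mul, norm_mul, mul_pow, ← Complex.ofReal_sub, Complex.norm_real, Real.norm_eq_abs]
      simp only [h1]
      have h2 : (0 : ℝ) = ∑' n : Freq, 0 * ‖coef g n‖ ^ 2 := by simp
      rw [h2]
      refine tendsto_tsum_of_dominated_convergence
        (bound := fun n => (2 * B) ^ 2 * ‖coef g n‖ ^ 2)
        ((hasSum_coef_sq g).summable.mul_left _) (fun n => ?_) (Eventually.of_forall fun x n => ?_)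
      · refine Tendsto.mul_const _ ?_
        have := (((h.cont n).sub (continuous_const (y := p x₀ n))).pow 2).tendsto x₀
        simpa [sq_abs] using! this
      · rw [Real.norm_of_nonneg (by positivity)]
        have : |p x n - p x₀ n| ≤ 2 * B := by
          have e1 := (h.symbol x).bound n
          have e2 := (h.symbol x₀).bound n
          calc |p x n - p x₀ n| ≤ |p x n| + |p x₀ n| := abs_sub _ _
            _ ≤ _ := by linarith
        gcongr
    have := hsq.sqrt
    simpa [Real.sqrt_sq (norm_nonneg _)] using this
  rw [continuous_iff_continuousAt]
  rintro ⟨x₀, g₀⟩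
  have h1 : Tendsto (fun z : X × LpT 2 => multiplier (p z.1) g₀) (𝓝 (x₀, g₀))
      (𝓝 (multiplier (p x₀) g₀)) := ((hstrong g₀).tendsto x₀).comp continuousAt_fst
  have h2 : Tendsto (fun z : X × LpT 2 => multiplier (p z.1) (z.2 - g₀)) (𝓝 (x₀, g₀)) (𝓝 0) := by
    refine squeeze_zero_norm (fun z => (h.symbol z.1).norm_multiplier_le _) ?_
    have : Continuous fun z : X × LpT 2 => B * ‖z.2 - g₀‖ := by fun_prop
    simpa using this.tendsto (x₀, g₀)
  have h3 := h1.add h2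
  rw [add_zero] at h3
  refine h3.congr fun z => ?_
  rw [← map_add, add_sub_cancel]

variable {B : ℝ} {p : ℝ → Freq → ℝ}

/-- The Duhamel integral `∫_0^t p(t - t') F(t') dt'` of a family of multipliers. -/
noncomputable def convMul (p : ℝ → Freq → ℝ) (F : ℝ → LpT 2) (t : ℝ) : LpT 2 :=
  ∫ t' in (0 : ℝ)..t, multiplier (p (t - t')) (F t')

lemma SymbolFamily.aestronglyMeasurable {μ : Measure ℝ} (h : SymbolFamily B p) {F : ℝ → LpT 2}
    (hF : AEStronglyMeasurable F μ) (t : ℝ) :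
    AEStronglyMeasurable (fun t' => multiplier (p (t - t')) (F t')) μ :=
  h.continuous.comp_aestronglyMeasurable
    ((continuous_const.sub continuous_id).aestronglyMeasurable.prodMk hF)

lemma SymbolFamily.intervalIntegrable (h : SymbolFamily B p) {F : ℝ → LpT 2} {a b : ℝ}
    (hF : IntervalIntegrable F volume a b) (t : ℝ) :
    IntervalIntegrable (fun t' => multiplier (p (t - t')) (F t')) volume a b := by
  refine (hF.norm.const_mul B).mono_fun ?_ ?_
  · exact h.aestronglyMeasurable hF.aestronglyMeasurable_restrict_uIoc t
  · refine Eventually.of_forall fun t' => ?_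
    simp only
    rw [Real.norm_of_nonneg (mul_nonneg (h.symbol 0).nonneg (norm_nonneg _))]
    exact (h.symbol _).norm_multiplier_le _

lemma SymbolFamily.norm_convMul_le (h : SymbolFamily B p) {F : ℝ → LpT 2} {t : ℝ} (ht : 0 ≤ t)
    (hF : IntervalIntegrable F volume 0 t) :
    ‖convMul p F t‖ ≤ B * ∫ t' in (0 : ℝ)..t, ‖F t'‖ := by
  rw [convMul, ← intervalIntegral.integral_const_mul]
  refine intervalIntegral.norm_integral_le_of_norm_le ht (Eventually.of_forall fun t' _ =>
    (h.symbol _).norm_multiplier_le _) (hF.norm.const_mul B)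

lemma SymbolFamily.convMul_sub (h : SymbolFamily B p) {F F' : ℝ → LpT 2} {t : ℝ}
    (hF : IntervalIntegrable F volume 0 t) (hF' : IntervalIntegrable F' volume 0 t) :
    convMul p (fun τ => F τ - F' τ) t = convMul p F t - convMul p F' t := by
  simp only [convMul, map_sub]
  exact intervalIntegral.integral_sub (h.intervalIntegrable hF t) (h.intervalIntegrable hF' t)

lemma SymbolFamily.coef_convMul (h : SymbolFamily B p) {F : ℝ → LpT 2} {t : ℝ}
    (hF : IntervalIntegrable F volume 0 t) (n : Freq) :
    coef (convMul p F t) n = ∫ t' in (0 : ℝ)..t, (p (t - t') n : ℂ) * coef (F t') n := by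
  rw [← coefCLM_apply, convMul, ← ContinuousLinearMap.intervalIntegral_comp_comm _
    (h.intervalIntegrable hF t)]
  refine intervalIntegral.integral_congr fun t' _ => ?_
  simp only [coefCLM_apply]
  rw [(h.symbol _).coef_multiplier]

/-- The integral up to t is rewritten over the fixed interval (0, T] with the integrand cut off at
t' ≤ t. The cut-off integrand is dominated by B‖F t'‖ and, for t' ≠ t₀, continuous in t at t₀. -/
lemma SymbolFamily.continuousOn_convMul (h : SymbolFamily B p) {F : ℝ → LpT 2} {T : ℝ}
    (hF : IntervalIntegrable F volume 0 T) : ContinuousOn (convMul p F) (Icc 0 T) := by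
  intro t₀ ht₀
  have hT : 0 ≤ T := ht₀.1.trans ht₀.2
  have hFi : IntegrableOn F (Ioc 0 T) := (intervalIntegrable_iff_integrableOn_Ioc_of_le hT).1 hF
  have heq : ∀ t ∈ Icc 0 T, convMul p F t = ∫ t' in Ioc 0 T,
      (Iic t).indicator (fun t' => multiplier (p (t - t')) (F t')) t' := by
    intro t ht
    rw [convMul, intervalIntegral.integral_of_le ht.1, setIntegral_indicator measurableSet_Iic]
    congr 2
    ext x; simp only [mem_Ioc, mem_inter_iff, mem_Iic]
    exact ⟨fun hx => ⟨⟨hx.1, hx.2.trans ht.2⟩, hx.2⟩, fun hx => ⟨hx.1.1, hx.2⟩⟩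
  refine ContinuousWithinAt.congr ?_ heq (heq t₀ ht₀)
  refine continuousWithinAt_of_dominated (bound := fun t' => B * ‖F t'‖)
    (Eventually.of_forall fun t => ?_) (Eventually.of_forall fun t => ?_)
    (hFi.norm.const_mul B) ?_
  · exact (h.aestronglyMeasurable hFi.aestronglyMeasurable t).indicator measurableSet_Iic
  · refine Eventually.of_forall fun t' => ?_
    refine (norm_indicator_le_norm_self _ _).trans ((h.symbol _).norm_multiplier_le _)
  · have hne : ∀ᵐ t' ∂(volume.restrict (Ioc 0 T)), t' ≠ t₀ :=
      ae_restrict_of_ae (Measure.ae_ne volume t₀)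
    filter_upwards [hne] with t' ht'
    have hc : ContinuousAt (fun t => multiplier (p (t - t')) (F t')) t₀ :=
      (h.continuous.comp ((continuous_id.sub continuous_const).prodMk continuous_const)).continuousAt
    rcases lt_or_gt_of_ne ht' with hlt | hlt
    · refine (hc.congr ?_).continuousWithinAt
      filter_upwards [lt_mem_nhds hlt] with t ht
      rw [indicator_of_mem (show t' ∈ Iic t from le_of_lt ht)]
    · refine ((continuousAt_const (y := (0 : LpT 2))).congr ?_).continuousWithinAt
      filter_upwards [gt_mem_nhds hlt] with t ht
      rw [indicator_of_notMem (show t' ∉ Iic t from not_le.2 ht)]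

end FourierMultipliers

/-! ### Differentiation of Duhamel integrals -/

section Volterra

/-- Fubini on the triangle t' ≤ τ: the integral of k'(τ - t') over τ from t' to t is k(t - t') -
k(0). -/
lemma integral_convolution_deriv {k k' : ℝ → ℝ} (hk : ∀ t, HasDerivAt k (k' t) t)
    (hk' : Continuous k') (hk0 : k 0 = 0) {f : ℝ → ℂ} {t : ℝ} (ht : 0 ≤ t)
    (hf : IntervalIntegrable f volume 0 t) :
    ∫ τ in (0 : ℝ)..t, ∫ t' in (0 : ℝ)..τ, (k' (τ - t') : ℂ) * f t' =
      ∫ t' in (0 : ℝ)..t, (k (t - t') : ℂ) * f t' := by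
  have hfi : IntegrableOn f (Ioc 0 t) := (intervalIntegrable_iff_integrableOn_Ioc_of_le ht).1 hf
  set G : ℝ → ℝ → ℂ := fun τ t' => (Iic τ).indicator (fun t' => (k' (τ - t') : ℂ) * f t') t' with hG
  have h1 : ∫ τ in (0 : ℝ)..t, ∫ t' in (0 : ℝ)..τ, (k' (τ - t') : ℂ) * f t' =
      ∫ τ in Ioc 0 t, ∫ t' in Ioc 0 t, G τ t' := by
    rw [intervalIntegral.integral_of_le ht]
    refine setIntegral_congr_fun measurableSet_Ioc fun τ hτ => ?_
    simp only [hG]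
    rw [intervalIntegral.integral_of_le hτ.1.le, setIntegral_indicator measurableSet_Iic]
    congr 2
    ext x; simp only [mem_Ioc, mem_inter_iff, mem_Iic]
    exact ⟨fun hx => ⟨⟨hx.1, hx.2.trans hτ.2⟩, hx.2⟩, fun hx => ⟨hx.1.1, hx.2⟩⟩
  obtain ⟨M, hM⟩ : ∃ M, ∀ s ∈ Icc 0 t, ‖k' s‖ ≤ M :=
    isCompact_Icc.exists_bound_of_continuousOn hk'.continuousOn
  have hM0 : 0 ≤ M := (norm_nonneg _).trans (hM 0 ⟨le_rfl, ht⟩)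
  have hGu : Function.uncurry G = {z : ℝ × ℝ | z.2 ≤ z.1}.indicator
      (fun z => (k' (z.1 - z.2) : ℂ) * f z.2) := by
    funext z
    simp only [Function.uncurry, hG, indicator, mem_Iic, mem_ofPred_eq]
  have hint : Integrable (Function.uncurry G)
      ((volume.restrict (Ioc 0 t)).prod (volume.restrict (Ioc 0 t))) := by
    rw [hGu]
    have hf2 : Integrable (fun z : ℝ × ℝ => f z.2)
        ((volume.restrict (Ioc 0 t)).prod (volume.restrict (Ioc 0 t))) := hfi.comp_snd _
    have hcont : Continuous fun z : ℝ × ℝ => (k' (z.1 - z.2) : ℂ) := by fun_prop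
    refine ((hf2.norm.const_mul M).mono'
      ((hcont.aestronglyMeasurable.mul hf2.aestronglyMeasurable).indicator
        (measurableSet_le measurable_snd measurable_fst)) ?_)
    rw [Measure.prod_restrict]
    filter_upwards [ae_restrict_mem (measurableSet_Ioc.prod measurableSet_Ioc)] with z hz
    by_cases hz' : z.2 ≤ z.1
    · rw [indicator_of_mem (show z ∈ {z : ℝ × ℝ | z.2 ≤ z.1} from hz'), norm_mul,
        Complex.norm_real]
      gcongr
      exact hM _ ⟨by linarith, by linarith [hz.1.2, hz.2.1]⟩
    · rw [indicator_of_notMem (show z ∉ {z : ℝ × ℝ | z.2 ≤ z.1} from hz'), norm_zero]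
      positivity
  rw [h1, integral_integral_swap hint, intervalIntegral.integral_of_le ht]
  refine setIntegral_congr_fun measurableSet_Ioc fun t' ht' => ?_
  have h2 : ∀ τ, G τ t' = (Ici t').indicator (fun τ => (k' (τ - t') : ℂ) * f t') τ := fun τ => by
    simp only [hG, indicator, mem_Iic, mem_Ici]
  simp only [h2]
  rw [setIntegral_indicator measurableSet_Ici]
  have h3 : Ioc 0 t ∩ Ici t' = Icc t' t := by
    ext x; simp only [mem_Ioc, mem_inter_iff, mem_Ici, mem_Icc]
    exact ⟨fun hx => ⟨hx.2, hx.1.2⟩, fun hx => ⟨⟨ht'.1.trans_le hx.1, hx.2⟩, hx.1⟩⟩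
  rw [h3, integral_Icc_eq_integral_Ioc, ← intervalIntegral.integral_of_le ht'.2,
    intervalIntegral.integral_mul_const, intervalIntegral.integral_ofReal]
  congr 2
  have h4 : ∫ τ in t'..t, k' (τ - t') = k (t - t') - k (t' - t') :=
    intervalIntegral.integral_eq_sub_of_hasDerivAt (f := fun τ => k (τ - t'))
      (fun τ _ => by simpa using (hk (τ - t')).comp_sub_const τ t')
      (Continuous.intervalIntegrable (by fun_prop) _ _)
  rw [h4, sub_self, hk0, sub_zero]

/-- A curve whose coefficients are primitives of those of a continuous curve. -/
lemma hasDerivWithinAt_of_coef {V G : ℝ → LpT 2} {T : ℝ} (hT : 0 < T)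
    (hG : ContinuousOn G (Icc 0 T))
    (h : ∀ t ∈ Icc 0 T, ∀ n, coef (V t) n = coef (V 0) n + ∫ τ in (0 : ℝ)..t, coef (G τ) n) :
    ContDiffOn ℝ 1 V (Icc 0 T) ∧ ∀ t ∈ Icc 0 T, HasDerivWithinAt V (G t) (Icc 0 T) t := by
  have hGi : ∀ t ∈ Icc 0 T, IntervalIntegrable G volume 0 t := fun t ht =>
    (hG.mono (by rw [uIcc_of_le ht.1]; exact Icc_subset_Icc_right ht.2)).intervalIntegrable
  have hV : ∀ t ∈ Icc 0 T, V t = V 0 + ∫ τ in (0 : ℝ)..t, G τ := by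
    intro t ht
    apply coef_injective
    funext n
    rw [h t ht n, coef_add, Pi.add_apply, ← coefCLM_apply n (∫ τ in (0 : ℝ)..t, G τ),
      ← ContinuousLinearMap.intervalIntegral_comp_comm _ (hGi t ht)]
    rfl
  have hd : ∀ t ∈ Icc 0 T, HasDerivWithinAt V (G t) (Icc 0 T) t := by
    intro t ht
    -- Extending G by constants beyond [0, T] makes it continuous on the line, so the fundamental
    -- theorem of calculus also covers the end points.
    have hGe : Continuous (IccExtend hT.le (Set.domRestrict (Icc 0 T) G)) :=
      (continuousOn_iff_continuous_domRestrict.1 hG).Icc_extend'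
    have h1 : HasDerivAt (fun t => V 0 + ∫ τ in (0 : ℝ)..t,
        IccExtend hT.le (Set.domRestrict (Icc 0 T) G) τ) (G t) t := by
      have := (hGe.integral_hasStrictDerivAt 0 t).hasDerivAt.const_add (V 0)
      rwa [IccExtend_of_mem hT.le _ ht] at this
    refine h1.hasDerivWithinAt.congr (fun s hs => ?_) ?_
    all_goals
      rw [hV _ (by assumption)]
      congr 1
      refine intervalIntegral.integral_congr fun τ hτ => ?_
    · rw [uIcc_of_le hs.1] at hτ
      rw [IccExtend_of_mem hT.le _ ⟨hτ.1, hτ.2.trans hs.2⟩]; rfl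
    · rw [uIcc_of_le ht.1] at hτ
      rw [IccExtend_of_mem hT.le _ ⟨hτ.1, hτ.2.trans ht.2⟩]; rfl
  refine ⟨?_, hd⟩
  have hu := uniqueDiffOn_Icc hT
  rw [show (1 : WithTop ℕ∞) = 0 + 1 by norm_num, contDiffOn_succ_iff_derivWithin hu]
  refine ⟨fun t ht => (hd t ht).differentiableWithinAt, by simp, ?_⟩
  rw [contDiffOn_zero]
  exact hG.congr fun t ht => (hd t ht).derivWithin (hu t ht)

end Volterra

end HartreeWave

namespace HartreeWave

/-! ### The damped wave propagator -/

section Propagator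

lemma waveBracket_neg (n : Freq) : waveBracket (-n) = waveBracket n := by
  simp [waveBracket, freqNorm_neg]

lemma waveBracket_sq (n : Freq) : waveBracket n ^ 2 = 3 / 4 + freqNorm n ^ 2 :=
  Real.sq_sqrt (by positivity)

lemma waveBracket_pos (n : Freq) : 0 < waveBracket n := Real.sqrt_pos.2 (by positivity)

lemma bracket_le_two_waveBracket (n : Freq) : bracket n ≤ 2 * waveBracket n := by
  have h1 := bracket_sq n
  have h2 := waveBracket_sq n
  have h3 := waveBracket_pos n
  nlinarith [sq_nonneg (freqNorm n)]

/-- The time derivative of the symbol of the propagator. -/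
noncomputable def propagatorDeriv (t : ℝ) (n : Freq) : ℝ :=
  Real.exp (-(t / 2)) *
    (Real.cos (t * waveBracket n) - Real.sin (t * waveBracket n) / (2 * waveBracket n))

lemma hasDerivAt_propagator (t : ℝ) (n : Freq) :
    HasDerivAt (fun t => propagator t n) (propagatorDeriv t n) t := by
  have hw := (waveBracket_pos n).ne'
  have h1 : HasDerivAt (fun t : ℝ => Real.exp (-(t / 2))) (Real.exp (-(t / 2)) * (-(1 / 2))) t :=
    ((hasDerivAt_id t).div_const 2).neg.exp
  have h2 : HasDerivAt (fun t : ℝ => Real.sin (t * waveBracket n) / waveBracket n)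
      (Real.cos (t * waveBracket n) * (1 * waveBracket n) / waveBracket n) t :=
    (((hasDerivAt_id t).mul_const (waveBracket n)).sin).div_const _
  refine (h1.mul h2).congr_deriv ?_
  rw [propagatorDeriv]
  field_simp
  ring

/-- Each mode solves p'' + p' + ⟨n⟩² p = 0; removing the damping factor e^{-t/2} lowers the squared
frequency by 1/4, from ⟨n⟩² to ⟦n⟧². -/
lemma hasDerivAt_propagatorDeriv (t : ℝ) (n : Freq) :
    HasDerivAt (fun t => propagatorDeriv t n)
      (-propagatorDeriv t n - bracket n ^ 2 * propagator t n) t := by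
  have hw := (waveBracket_pos n).ne'
  have h1 : HasDerivAt (fun t : ℝ => Real.exp (-(t / 2))) (Real.exp (-(t / 2)) * (-(1 / 2))) t :=
    ((hasDerivAt_id t).div_const 2).neg.exp
  have h2 : HasDerivAt (fun t : ℝ => Real.sin (t * waveBracket n) / (2 * waveBracket n))
      (Real.cos (t * waveBracket n) * (1 * waveBracket n) / (2 * waveBracket n)) t :=
    (((hasDerivAt_id t).mul_const (waveBracket n)).sin).div_const _
  have h3 : HasDerivAt (fun t : ℝ => Real.cos (t * waveBracket n))
      (-Real.sin (t * waveBracket n) * (1 * waveBracket n)) t :=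
    ((hasDerivAt_id t).mul_const (waveBracket n)).cos
  refine (h1.mul (h3.sub h2)).congr_deriv ?_
  have h4 : bracket n ^ 2 = waveBracket n ^ 2 + 1 / 4 := by
    rw [bracket_sq, waveBracket_sq]; ring
  rw [h4, propagatorDeriv, propagator]
  simp only [Pi.sub_apply]
  field_simp
  ring

lemma deriv_propagator (t : ℝ) (n : Freq) :
    deriv (fun τ => propagator τ n) t = propagatorDeriv t n := (hasDerivAt_propagator t n).deriv

lemma propagator_zero (n : Freq) : propagator 0 n = 0 := by simp [propagator]

lemma abs_sin_div_le (t : ℝ) (n : Freq) :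
    |Real.sin (t * waveBracket n) / waveBracket n| * bracket n ≤ 2 := by
  have hw := waveBracket_pos n
  have h1 := Real.abs_sin_le_one (t * waveBracket n)
  have h2 := bracket_le_two_waveBracket n
  have h3 := bracket_pos n
  rw [abs_div, abs_of_pos hw, div_mul_eq_mul_div, div_le_iff₀ hw]
  calc |Real.sin (t * waveBracket n)| * bracket n ≤ 1 * (2 * waveBracket n) := by gcongr
    _ = _ := one_mul _

lemma exp_le_one_of_nonneg {t : ℝ} (ht : 0 ≤ t) : Real.exp (-(t / 2)) ≤ 1 :=
  Real.exp_le_one_iff.2 (by linarith)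

/-- The symbol of `𝓓(t) : H^{s-1} → H^s`, extended by its value at `0` to negative times. -/
noncomputable def waveSym (t : ℝ) (n : Freq) : ℝ := bracket n * propagator (max t 0) n

/-- The symbol of `∂_t 𝓓(t)`, extended by its value at `0` to negative times. -/
noncomputable def waveSymDeriv (t : ℝ) (n : Freq) : ℝ := propagatorDeriv (max t 0) n

/-- The symbol of `𝓓(t)`, extended by its value at `0` to negative times. -/
noncomputable def waveSymLow (t : ℝ) (n : Freq) : ℝ := propagator (max t 0) n

/-- The bound 2 comes from ⟨n⟩ ≤ 2⟦n⟧ and e^{-t/2} ≤ 1. The latter fails for negative times, which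
is why the symbol is frozen there; Duhamel integrals only see t - t' ≥ 0. -/
lemma symbolFamily_waveSym : SymbolFamily 2 waveSym where
  symbol t := ⟨fun n => by simp [waveSym, propagator, bracket_neg, waveBracket_neg], fun n => by
    have h1 := abs_sin_div_le (max t 0) n
    have h2 := exp_le_one_of_nonneg (le_max_right t 0)
    rw [waveSym, propagator, abs_mul, abs_mul, abs_of_pos (bracket_pos n), Real.abs_exp]
    calc bracket n * (Real.exp (-(max t 0 / 2)) *
          |Real.sin (max t 0 * waveBracket n) / waveBracket n|)
        = Real.exp (-(max t 0 / 2)) *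
          (|Real.sin (max t 0 * waveBracket n) / waveBracket n| * bracket n) := by ring
      _ ≤ 1 * 2 := by
        have := bracket_pos n
        gcongr
      _ = 2 := one_mul _⟩
  cont n := by unfold waveSym propagator; fun_prop

lemma symbolFamily_waveSymLow : SymbolFamily 2 waveSymLow where
  symbol t := ⟨fun n => by simp [waveSymLow, propagator, waveBracket_neg], fun n => by
    have h1 := (symbolFamily_waveSym.symbol t).bound n
    rw [waveSym, abs_mul, abs_of_pos (bracket_pos n)] at h1
    exact (le_mul_of_one_le_left (abs_nonneg _) (one_le_bracket n)).trans h1⟩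
  cont n := by unfold waveSymLow propagator; fun_prop

lemma symbolFamily_waveSymDeriv : SymbolFamily 2 waveSymDeriv where
  symbol t := ⟨fun n => by simp [waveSymDeriv, propagatorDeriv, waveBracket_neg], fun n => by
    have h1 := abs_sin_div_le (max t 0) n
    have h2 := exp_le_one_of_nonneg (le_max_right t 0)
    have h3 := Real.abs_cos_le_one (max t 0 * waveBracket n)
    have h4 : |Real.sin (max t 0 * waveBracket n) / waveBracket n| ≤ 2 :=
      (le_mul_of_one_le_right (abs_nonneg _) (one_le_bracket n)).trans h1
    have h5 : |Real.sin (max t 0 * waveBracket n) / (2 * waveBracket n)| ≤ 1 := by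
      rw [mul_comm 2, ← div_div, abs_div, abs_two]; linarith
    rw [waveSymDeriv, propagatorDeriv, abs_mul, Real.abs_exp]
    calc Real.exp (-(max t 0 / 2)) * |Real.cos (max t 0 * waveBracket n) -
          Real.sin (max t 0 * waveBracket n) / (2 * waveBracket n)| ≤ 1 * (1 + 1) := by
          gcongr
          exact (abs_sub _ _).trans (by linarith)
      _ = 2 := by norm_num⟩
  cont n := by unfold waveSymDeriv propagatorDeriv; fun_prop

lemma isSymbol_inv_bracket : IsSymbol 1 fun n => (bracket n)⁻¹ where
  even n := by rw [bracket_neg]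
  bound n := by
    rw [abs_of_pos (inv_pos.2 (bracket_pos n))]
    exact inv_le_one_of_one_le₀ (one_le_bracket n)

/-- The solution of the damped wave equation with data `(x₀, x₁)` and forcing `F`, where the
positions are expressed in `H^s` and the velocities and the forcing in `H^{s-1}`. -/
noncomputable def waveSol (x₀ x₁ : LpT 2) (F : ℝ → LpT 2) (t : ℝ) : LpT 2 :=
  multiplier (waveSymDeriv t) x₀ + multiplier (waveSymLow t) x₀ + multiplier (waveSym t) x₁
    + convMul waveSym F t

/-- The time derivative of `waveSol`, expressed in `H^{s-1}`. -/
noncomputable def waveVel (x₀ x₁ : LpT 2) (F : ℝ → LpT 2) (t : ℝ) : LpT 2 :=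
  multiplier (waveSymDeriv t) x₁ - multiplier (waveSym t) x₀ + convMul waveSymDeriv F t

variable {x₀ x₁ : LpT 2} {F : ℝ → LpT 2} {T : ℝ}

lemma SymbolFamily.continuous_apply {B : ℝ} {p : ℝ → Freq → ℝ} (h : SymbolFamily B p)
    (x : LpT 2) : Continuous fun t => multiplier (p t) x :=
  h.continuous.comp (continuous_id.prodMk continuous_const)

lemma continuousOn_waveSol (hF : IntervalIntegrable F volume 0 T) :
    ContinuousOn (waveSol x₀ x₁ F) (Icc 0 T) :=
  (((symbolFamily_waveSymDeriv.continuous_apply x₀).add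
    (symbolFamily_waveSymLow.continuous_apply x₀)).add
    (symbolFamily_waveSym.continuous_apply x₁)).continuousOn.add
    (symbolFamily_waveSym.continuousOn_convMul hF)

lemma continuousOn_waveVel (hF : IntervalIntegrable F volume 0 T) :
    ContinuousOn (waveVel x₀ x₁ F) (Icc 0 T) :=
  ((symbolFamily_waveSymDeriv.continuous_apply x₁).sub
    (symbolFamily_waveSym.continuous_apply x₀)).continuousOn.add
    (symbolFamily_waveSymDeriv.continuousOn_convMul hF)

lemma norm_waveSol_le {t : ℝ} (ht : 0 ≤ t) (hF : IntervalIntegrable F volume 0 t) :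
    ‖waveSol x₀ x₁ F t‖ ≤ 4 * (‖x₀‖ + ‖x₁‖) + 2 * ∫ t' in (0 : ℝ)..t, ‖F t'‖ := by
  have h1 := (symbolFamily_waveSymDeriv.symbol t).norm_multiplier_le x₀
  have h2 := (symbolFamily_waveSymLow.symbol t).norm_multiplier_le x₀
  have h3 := (symbolFamily_waveSym.symbol t).norm_multiplier_le x₁
  have h4 := symbolFamily_waveSym.norm_convMul_le ht hF
  rw [waveSol]
  refine (norm_add₄_le).trans ?_
  linarith [norm_nonneg x₁]

lemma norm_waveVel_le {t : ℝ} (ht : 0 ≤ t) (hF : IntervalIntegrable F volume 0 t) :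
    ‖waveVel x₀ x₁ F t‖ ≤ 4 * (‖x₀‖ + ‖x₁‖) + 2 * ∫ t' in (0 : ℝ)..t, ‖F t'‖ := by
  have h1 := (symbolFamily_waveSymDeriv.symbol t).norm_multiplier_le x₁
  have h2 := (symbolFamily_waveSym.symbol t).norm_multiplier_le x₀
  have h4 := symbolFamily_waveSymDeriv.norm_convMul_le ht hF
  rw [waveVel]
  refine (norm_add_le _ _).trans ?_
  have h5 := norm_sub_le (multiplier (waveSymDeriv t) x₁) (multiplier (waveSym t) x₀)
  linarith [norm_nonneg x₁, norm_nonneg x₀]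

lemma waveSol_sub {x₀' x₁' : LpT 2} {F' : ℝ → LpT 2} {t : ℝ}
    (hF : IntervalIntegrable F volume 0 t) (hF' : IntervalIntegrable F' volume 0 t) :
    waveSol x₀ x₁ F t - waveSol x₀' x₁' F' t =
      waveSol (x₀ - x₀') (x₁ - x₁') (fun τ => F τ - F' τ) t := by
  simp only [waveSol, symbolFamily_waveSym.convMul_sub hF hF', map_sub]
  abel

lemma waveVel_sub {x₀' x₁' : LpT 2} {F' : ℝ → LpT 2} {t : ℝ}
    (hF : IntervalIntegrable F volume 0 t) (hF' : IntervalIntegrable F' volume 0 t) :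
    waveVel x₀ x₁ F t - waveVel x₀' x₁' F' t =
      waveVel (x₀ - x₀') (x₁ - x₁') (fun τ => F τ - F' τ) t := by
  simp only [waveVel, symbolFamily_waveSymDeriv.convMul_sub hF hF', map_sub]
  abel

lemma bracket_rpow_sub_one (s : ℝ) (n : Freq) :
    bracket n ^ (-(s - 1)) = bracket n ^ (-s) * bracket n := by
  rw [show -(s - 1) = -s + 1 by ring, Real.rpow_add (bracket_pos n), Real.rpow_one]

/-- The Duhamel integral gains one derivative. -/
lemma duhamel_bessel {s t : ℝ} (ht : 0 ≤ t) (hF : IntervalIntegrable F volume 0 t) :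
    duhamel (fun τ => bessel (s - 1) (F τ)) t = bessel s (convMul waveSym F t) := by
  funext n
  rw [bessel_apply, symbolFamily_waveSym.coef_convMul hF, duhamel,
    ← intervalIntegral.integral_const_mul]
  refine intervalIntegral.integral_congr fun t' ht' => ?_
  rw [uIcc_of_le ht] at ht'
  simp only [bessel_apply, waveSym, bracket_rpow_sub_one]
  rw [max_eq_left (by linarith [ht'.2])]
  push_cast
  ring

lemma duhamel_congr {T t : ℝ} {F G : ℝ → TDist} (ht : t ∈ Icc 0 T)
    (h : ∀ᵐ τ ∂timeMeasure T, F τ = G τ) : duhamel F t = duhamel G t := by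
  funext n
  rw [duhamel, duhamel, intervalIntegral.integral_of_le ht.1, intervalIntegral.integral_of_le ht.1]
  refine integral_congr_ae ?_
  have : ∀ᵐ τ ∂(volume.restrict (Ioc 0 t)), F τ = G τ :=
    ae_restrict_of_ae_restrict_of_subset
      (Ioc_subset_Icc_self.trans (Icc_subset_Icc_right ht.2)) h
  filter_upwards [this] with τ hτ
  rw [hτ]

lemma bessel_waveSol {s t : ℝ} (ht : 0 ≤ t) (hF : IntervalIntegrable F volume 0 t) :
    linEvol (bessel s x₀) (bessel (s - 1) x₁) t + duhamel (fun τ => bessel (s - 1) (F τ)) t =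
      bessel s (waveSol x₀ x₁ F t) := by
  rw [duhamel_bessel ht hF, waveSol, bessel_add]
  congr 1
  funext n
  rw [bessel_apply, coef_add, coef_add, Pi.add_apply, Pi.add_apply,
    (symbolFamily_waveSymDeriv.symbol t).coef_multiplier,
    (symbolFamily_waveSymLow.symbol t).coef_multiplier,
    (symbolFamily_waveSym.symbol t).coef_multiplier]
  simp only [linEvol, deriv_propagator, bessel_apply, waveSymDeriv, waveSymLow, waveSym,
    max_eq_left ht, bracket_rpow_sub_one]
  push_cast
  ring

lemma coef_waveSol {t : ℝ} (ht : 0 ≤ t) (hF : IntervalIntegrable F volume 0 t) (n : Freq) :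
    coef (waveSol x₀ x₁ F t) n = (propagatorDeriv t n + propagator t n : ℝ) * coef x₀ n
      + (bracket n * propagator t n : ℝ) * coef x₁ n
      + ∫ t' in (0 : ℝ)..t, ((bracket n * propagator (t - t') n : ℝ) : ℂ) * coef (F t') n := by
  rw [waveSol, coef_add, coef_add, coef_add, Pi.add_apply, Pi.add_apply, Pi.add_apply,
    (symbolFamily_waveSymDeriv.symbol t).coef_multiplier,
    (symbolFamily_waveSymLow.symbol t).coef_multiplier,
    (symbolFamily_waveSym.symbol t).coef_multiplier, symbolFamily_waveSym.coef_convMul hF]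
  have : ∫ t' in (0 : ℝ)..t, (waveSym (t - t') n : ℂ) * coef (F t') n =
      ∫ t' in (0 : ℝ)..t, ((bracket n * propagator (t - t') n : ℝ) : ℂ) * coef (F t') n := by
    refine intervalIntegral.integral_congr fun t' ht' => ?_
    rw [uIcc_of_le ht] at ht'
    simp only [waveSym]
    rw [max_eq_left (by linarith [ht'.2])]
  rw [this]
  simp only [waveSymDeriv, waveSymLow, waveSym, max_eq_left ht]
  push_cast
  ring

lemma coef_waveVel {t : ℝ} (ht : 0 ≤ t) (hF : IntervalIntegrable F volume 0 t) (n : Freq) :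
    coef (waveVel x₀ x₁ F t) n = (propagatorDeriv t n : ℝ) * coef x₁ n
      - (bracket n * propagator t n : ℝ) * coef x₀ n
      + ∫ t' in (0 : ℝ)..t, (propagatorDeriv (t - t') n : ℂ) * coef (F t') n := by
  rw [waveVel, coef_add, coef_sub, Pi.add_apply, Pi.sub_apply,
    (symbolFamily_waveSymDeriv.symbol t).coef_multiplier,
    (symbolFamily_waveSym.symbol t).coef_multiplier, symbolFamily_waveSymDeriv.coef_convMul hF]
  have : ∫ t' in (0 : ℝ)..t, (waveSymDeriv (t - t') n : ℂ) * coef (F t') n =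
      ∫ t' in (0 : ℝ)..t, (propagatorDeriv (t - t') n : ℂ) * coef (F t') n := by
    refine intervalIntegral.integral_congr fun t' ht' => ?_
    rw [uIcc_of_le ht] at ht'
    simp only [waveSymDeriv]
    rw [max_eq_left (by linarith [ht'.2])]
  rw [this]
  simp only [waveSymDeriv, waveSym, max_eq_left ht]

lemma continuous_propagator (n : Freq) : Continuous fun t => propagator t n := by
  unfold propagator; fun_prop

lemma continuous_propagatorDeriv (n : Freq) : Continuous fun t => propagatorDeriv t n := by
  unfold propagatorDeriv; fun_prop

lemma intervalIntegrable_mono {f : ℝ → LpT 2} {t : ℝ} (hf : IntervalIntegrable f volume 0 T)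
    (ht : t ∈ Icc 0 T) : IntervalIntegrable f volume 0 t :=
  hf.mono_set (by
    rw [uIcc_of_le ht.1, uIcc_of_le (ht.1.trans ht.2)]; exact Icc_subset_Icc_right ht.2)

/-- Dividing by ⟨n⟩ reads the position in H^{s-1}, where it is differentiable. The data part has the
primitive Φ by the mode equation, and the forcing part is `integral_convolution_deriv` with the
propagator as k. -/
lemma coef_waveSol_integral (hT : 0 ≤ T) (hF : IntervalIntegrable F volume 0 T) (n : Freq) {t : ℝ}
    (ht : t ∈ Icc 0 T) : ((bracket n)⁻¹ : ℝ) * coef (waveSol x₀ x₁ F t) n =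
      ((bracket n)⁻¹ : ℝ) * coef (waveSol x₀ x₁ F 0) n +
        ∫ τ in (0 : ℝ)..t, coef (waveVel x₀ x₁ F τ) n := by
  have hb := (bracket_pos n).ne'
  have hbc : (bracket n : ℂ) ≠ 0 := by exact_mod_cast hb
  have hFt := intervalIntegrable_mono hF ht
  have hfc : IntervalIntegrable (fun t' => coef (F t') n) volume 0 t :=
    ⟨(coefCLM n).integrable_comp hFt.1, (coefCLM n).integrable_comp hFt.2⟩
  have h1 := integral_convolution_deriv (fun t => hasDerivAt_propagator t n)
    (continuous_propagatorDeriv n) (propagator_zero n) ht.1 hfc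
  set A : ℝ → ℂ := fun τ => (propagatorDeriv τ n : ℝ) * coef x₁ n
      - (bracket n * propagator τ n : ℝ) * coef x₀ n with hA
  have hAc : Continuous A := by
    have e1 := continuous_propagator n
    have e2 := continuous_propagatorDeriv n
    fun_prop
  set Φ : ℝ → ℂ := fun τ => ((bracket n)⁻¹ * (propagatorDeriv τ n + propagator τ n) : ℝ) *
    coef x₀ n + (propagator τ n : ℝ) * coef x₁ n with hΦ
  have hΦd : ∀ τ, HasDerivAt Φ (A τ) τ := by
    intro τ
    have e1 := (((hasDerivAt_propagatorDeriv τ n).add (hasDerivAt_propagator τ n)).const_mul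
      ((bracket n)⁻¹)).ofReal_comp.mul_const (coef x₀ n)
    have e2 := (hasDerivAt_propagator τ n).ofReal_comp.mul_const (coef x₁ n)
    refine (e1.add e2).congr_deriv ?_
    simp only [hA]
    push_cast
    field_simp
    ring
  have h2 : ∫ τ in (0 : ℝ)..t, A τ = Φ t - Φ 0 :=
    intervalIntegral.integral_eq_sub_of_hasDerivAt (fun τ _ => hΦd τ)
      (hAc.intervalIntegrable _ _)
  have h3 : ∫ τ in (0 : ℝ)..t, coef (waveVel x₀ x₁ F τ) n = ∫ τ in (0 : ℝ)..t, (A τ +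
      ∫ t' in (0 : ℝ)..τ, (propagatorDeriv (τ - t') n : ℂ) * coef (F t') n) := by
    refine intervalIntegral.integral_congr fun τ hτ => ?_
    rw [uIcc_of_le ht.1] at hτ
    exact coef_waveVel hτ.1 (intervalIntegrable_mono hF ⟨hτ.1, hτ.2.trans ht.2⟩) n
  have h4 : IntervalIntegrable (fun τ =>
      ∫ t' in (0 : ℝ)..τ, (propagatorDeriv (τ - t') n : ℂ) * coef (F t') n) volume 0 t := by
    have hc : ContinuousOn (fun τ => coef (convMul waveSymDeriv F τ) n) (uIcc 0 t) := by
      rw [uIcc_of_le ht.1]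
      exact (coefCLM n).continuous.comp_continuousOn
        (symbolFamily_waveSymDeriv.continuousOn_convMul hFt)
    refine (hc.congr fun τ hτ => ?_).intervalIntegrable
    rw [uIcc_of_le ht.1] at hτ
    rw [symbolFamily_waveSymDeriv.coef_convMul
      (intervalIntegrable_mono hF ⟨hτ.1, hτ.2.trans ht.2⟩)]
    refine intervalIntegral.integral_congr fun t' ht' => ?_
    rw [uIcc_of_le hτ.1] at ht'
    simp only [waveSymDeriv]
    rw [max_eq_left (by linarith [ht'.2])]
  rw [h3, intervalIntegral.integral_add (hAc.intervalIntegrable _ _) h4, h1, h2,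
    coef_waveSol ht.1 hFt, coef_waveSol le_rfl (intervalIntegrable_mono hF ⟨le_rfl, hT⟩),
    intervalIntegral.integral_same]
  have h5 : ∫ t' in (0 : ℝ)..t, ((bracket n * propagator (t - t') n : ℝ) : ℂ) * coef (F t') n =
      bracket n * ∫ t' in (0 : ℝ)..t, (propagator (t - t') n : ℂ) * coef (F t') n := by
    rw [← intervalIntegral.integral_const_mul]
    refine intervalIntegral.integral_congr fun t' _ => ?_
    push_cast; ring
  rw [h5]
  simp only [hΦ, propagator_zero]
  push_cast
  field_simp
  ring

/-- The position is continuously differentiable with values in `H^{s-1}`. -/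
lemma contDiffOn_waveSol (hT : 0 < T) (hF : IntervalIntegrable F volume 0 T) :
    ContDiffOn ℝ 1 (fun t => multiplier (fun n => (bracket n)⁻¹) (waveSol x₀ x₁ F t)) (Icc 0 T) ∧
    ∀ t ∈ Icc 0 T, HasDerivWithinAt
      (fun t => multiplier (fun n => (bracket n)⁻¹) (waveSol x₀ x₁ F t))
      (waveVel x₀ x₁ F t) (Icc 0 T) t := by
  refine hasDerivWithinAt_of_coef hT (continuousOn_waveVel hF) fun t ht n => ?_
  rw [isSymbol_inv_bracket.coef_multiplier, isSymbol_inv_bracket.coef_multiplier]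
  exact coef_waveSol_integral hT.le hF n ht

lemma bessel_multiplier_inv_bracket (s : ℝ) (g : LpT 2) :
    bessel (s - 1) (multiplier (fun n => (bracket n)⁻¹) g) = bessel s g := by
  funext n
  have hb : (bracket n : ℂ) ≠ 0 := by exact_mod_cast (bracket_pos n).ne'
  rw [bessel_apply, isSymbol_inv_bracket.coef_multiplier, bessel_apply, bracket_rpow_sub_one]
  push_cast
  field_simp

/-- The time derivative of the position. -/
lemma timeDeriv_waveSol {s : ℝ} (hT : 0 < T) (hF : IntervalIntegrable F volume 0 T)
    {u : ℝ → TDist} (hu : ∀ t ∈ Icc 0 T, u t = bessel s (waveSol x₀ x₁ F t)) {t : ℝ}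
    (ht : t ∈ Icc 0 T) : timeDeriv T u t = bessel (s - 1) (waveVel x₀ x₁ F t) := by
  funext n
  have h1 := ((coefCLM n).hasFDerivAt.comp_hasDerivWithinAt t
    ((contDiffOn_waveSol (x₀ := x₀) (x₁ := x₁) hT hF).2 t ht)).const_mul
      (((bracket n ^ (-(s - 1)) : ℝ) : ℂ))
  have h2 : HasDerivWithinAt (fun τ => u τ n) (bessel (s - 1) (waveVel x₀ x₁ F t) n)
      (Icc 0 T) t := by
    refine h1.congr (fun τ hτ => ?_) ?_
    all_goals rw [hu _ (by assumption), ← bessel_multiplier_inv_bracket]; rfl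
  exact h2.derivWithin (uniqueDiffOn_Icc hT t ht)

end Propagator

end HartreeWave

namespace HartreeWave

/-! ### Locally Lipschitz nonlinearities -/

section TameMaps

set_option linter.unusedSectionVars false

variable {P E G H M : Type*} [NormedAddCommGroup P] [NormedSpace ℝ P] [NormedAddCommGroup E]
  [NormedSpace ℝ E] [NormedAddCommGroup G] [NormedSpace ℝ G] [NormedAddCommGroup H]
  [NormedSpace ℝ H] [NormedAddCommGroup M] [NormedSpace ℝ M]

/-- Continuous maps, locally Lipschitz in `p`, with growth of degree `j + 1` in `r`. -/
structure Tame (j : ℕ) (F : P → E → G) : Prop where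
  cont : Continuous fun z : P × E => F z.1 z.2
  zero : F 0 0 = 0
  lip : ∀ K, 0 ≤ K → ∃ C, 0 ≤ C ∧ ∀ p p' r r', ‖p‖ ≤ K → ‖p'‖ ≤ K → ‖F p r - F p' r'‖ ≤
    C * (1 + ‖r‖ + ‖r'‖) ^ j * ((1 + ‖r‖ + ‖r'‖) * ‖p - p'‖ + ‖r - r'‖)

lemma tame_fst (L : P →L[ℝ] G) : Tame 0 (fun p (_ : E) => L p) where
  cont := by fun_prop
  zero := map_zero L
  lip K _ := ⟨‖L‖, norm_nonneg _, fun p p' r r' _ _ => by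
    rw [← map_sub, pow_zero, mul_one]
    refine (L.le_opNorm _).trans ?_
    gcongr
    nlinarith [norm_nonneg r, norm_nonneg r', norm_nonneg (p - p'), norm_nonneg (r - r'),
      mul_nonneg (norm_nonneg r) (norm_nonneg (p - p')),
      mul_nonneg (norm_nonneg r') (norm_nonneg (p - p'))]⟩

lemma tame_snd (L : E →L[ℝ] G) : Tame 0 (fun (_ : P) r => L r) where
  cont := by fun_prop
  zero := map_zero L
  lip K _ := ⟨‖L‖, norm_nonneg _, fun p p' r r' _ _ => by
    rw [← map_sub, pow_zero, mul_one]
    refine (L.le_opNorm _).trans ?_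
    gcongr
    have : 0 ≤ (1 + ‖r‖ + ‖r'‖) * ‖p - p'‖ := by positivity
    linarith⟩

variable {j : ℕ} {F F' : P → E → G}

lemma Tame.add (h : Tame j F) (h' : Tame j F') : Tame j (fun p r => F p r + F' p r) where
  cont := h.cont.add h'.cont
  zero := by rw [h.zero, h'.zero, add_zero]
  lip K hK := by
    obtain ⟨C, hC, hl⟩ := h.lip K hK
    obtain ⟨C', hC', hl'⟩ := h'.lip K hK
    refine ⟨C + C', by positivity, fun p p' r r' hp hp' => ?_⟩
    rw [add_sub_add_comm]
    refine (norm_add_le _ _).trans ((add_le_add (hl p p' r r' hp hp')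
      (hl' p p' r r' hp hp')).trans (le_of_eq (by ring)))

lemma Tame.clm (h : Tame j F) (L : G →L[ℝ] H) : Tame j (fun p r => L (F p r)) where
  cont := L.continuous.comp h.cont
  zero := by rw [h.zero, map_zero]
  lip K hK := by
    obtain ⟨C, hC, hl⟩ := h.lip K hK
    refine ⟨‖L‖ * C, by positivity, fun p p' r r' hp hp' => ?_⟩
    rw [← map_sub]
    refine (L.le_opNorm _).trans ?_
    rw [mul_assoc, mul_assoc]
    gcongr
    rw [← mul_assoc]
    exact hl p p' r r' hp hp'

lemma Tame.sub (h : Tame j F) (h' : Tame j F') : Tame j (fun p r => F p r - F' p r) := by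
  simpa [sub_eq_add_neg] using h.add (h'.clm (-ContinuousLinearMap.id ℝ G))

/-- Comparison with F 0 0 = 0. The spare r' lets two points of a difference share the weight 1 + ‖r‖
+ ‖r'‖. -/
lemma Tame.growth (h : Tame j F) {K : ℝ} (hK : 0 ≤ K) : ∃ C, 0 ≤ C ∧
    ∀ (p : P) (r r' : E), ‖p‖ ≤ K → ‖F p r‖ ≤ C * (1 + ‖r‖ + ‖r'‖) ^ (j + 1) := by
  obtain ⟨C, hC, hl⟩ := h.lip K hK
  refine ⟨C * (K + 1), by positivity, fun p r (r' : E) hp => ?_⟩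
  have h1 := hl p 0 r 0 hp (by simpa using hK)
  rw [h.zero, sub_zero, sub_zero, sub_zero, norm_zero, add_zero] at h1
  have h2 : (1 + ‖r‖) ^ j ≤ (1 + ‖r‖ + ‖r'‖) ^ j := by
    exact pow_le_pow_left₀ (by positivity) (by linarith [norm_nonneg r']) j
  have h3 : (1 + ‖r‖) * ‖p‖ + ‖r‖ ≤ (K + 1) * (1 + ‖r‖ + ‖r'‖) := by
    nlinarith [norm_nonneg r, norm_nonneg r', norm_nonneg p, mul_nonneg hK (norm_nonneg r'),
      mul_le_mul_of_nonneg_left hp (norm_nonneg r)]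
  calc ‖F p r‖ ≤ C * (1 + ‖r‖) ^ j * ((1 + ‖r‖) * ‖p‖ + ‖r‖) := h1
    _ ≤ C * (1 + ‖r‖ + ‖r'‖) ^ j * ((K + 1) * (1 + ‖r‖ + ‖r'‖)) := by gcongr
    _ = _ := by ring

/-- The second factor depends linearly on p alone, so the degree in r does not increase; ‖p‖ ≤ K is
absorbed into the constant. -/
lemma Tame.bilin (h : Tame j F) (B : G →L[ℝ] H →L[ℝ] M) (L : P →L[ℝ] H) :
    Tame j (fun p r => B (F p r) (L p)) where
  cont := (B.continuous.comp h.cont).clm_apply (L.continuous.comp continuous_fst)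
  zero := by rw [h.zero, map_zero, zero_apply]
  lip K hK := by
    obtain ⟨C, hC, hl⟩ := h.lip K hK
    obtain ⟨C', hC', hg⟩ := h.growth hK
    refine ⟨‖B‖ * ‖L‖ * (C * K + C'), by positivity, fun p p' r r' hp hp' => ?_⟩
    have h1 : B (F p r) (L p) - B (F p' r') (L p') =
        B (F p r - F p' r') (L p) + B (F p' r') (L (p - p')) := by
      simp only [map_sub, sub_apply]; abel
    have h2 := hl p p' r r' hp hp'
    have h3 := hg p' r' r hp'
    rw [h1]
    set ρ := 1 + ‖r‖ + ‖r'‖ with hρ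
    have hρ' : 1 + ‖r'‖ + ‖r‖ = ρ := by rw [hρ]; ring
    rw [hρ'] at h3
    have hρ0 : 0 ≤ ρ := by positivity
    calc ‖B (F p r - F p' r') (L p) + B (F p' r') (L (p - p'))‖
        ≤ ‖B‖ * ‖F p r - F p' r'‖ * (‖L‖ * ‖p‖) + ‖B‖ * ‖F p' r'‖ * (‖L‖ * ‖p - p'‖) := by
          refine (norm_add_le _ _).trans (add_le_add ?_ ?_)
          · refine (B.le_opNorm₂ _ _).trans ?_
            gcongr; exact L.le_opNorm _
          · refine (B.le_opNorm₂ _ _).trans ?_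
            gcongr; exact L.le_opNorm _
      _ ≤ ‖B‖ * (C * ρ ^ j * (ρ * ‖p - p'‖ + ‖r - r'‖)) * (‖L‖ * K) +
          ‖B‖ * (C' * ρ ^ (j + 1)) * (‖L‖ * ‖p - p'‖) := by gcongr
      _ = ‖B‖ * ‖L‖ * (C * K) * ρ ^ j * (ρ * ‖p - p'‖ + ‖r - r'‖) +
          ‖B‖ * ‖L‖ * C' * ρ ^ j * (ρ * ‖p - p'‖) := by ring
      _ ≤ ‖B‖ * ‖L‖ * (C * K) * ρ ^ j * (ρ * ‖p - p'‖ + ‖r - r'‖) +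
          ‖B‖ * ‖L‖ * C' * ρ ^ j * (ρ * ‖p - p'‖ + ‖r - r'‖) := by
          gcongr
          exact le_add_of_nonneg_right (norm_nonneg _)
      _ = _ := by ring

lemma Tame.succ (h : Tame 0 F) : Tame 1 F where
  cont := h.cont
  zero := h.zero
  lip K hK := by
    obtain ⟨C, hC, hl⟩ := h.lip K hK
    refine ⟨C, hC, fun p p' r r' hp hp' => (hl p p' r r' hp hp').trans ?_⟩
    have : 1 ≤ 1 + ‖r‖ + ‖r'‖ := by linarith [norm_nonneg r, norm_nonneg r']
    gcongr
    simp

/-- For |y| ≤ |x| the only delicate term is (|x|^p - |y|^p) |y|. It is at most |y|^p |x - y|,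
because z ↦ z^{p-1} is nonincreasing for p ≤ 1. Then z^p ≤ 1 + z leaves a Lipschitz constant of
linear growth. In the taming term p = γ - 2, and this is the role of γ ≤ 3. -/
lemma abs_rpow_mul_sub_le {p : ℝ} (hp : 0 < p) (hp1 : p ≤ 1) (a b : ℝ) :
    |(|a| ^ p * a - |b| ^ p * b)| ≤ 2 * (2 + |a| + |b|) * |a - b| := by
  have hle : ∀ x : ℝ, 0 ≤ x → x ^ p ≤ 1 + x := by
    intro x hx
    rcases le_total x 1 with h | h
    · linarith [Real.rpow_le_one hx h hp.le]
    · calc x ^ p ≤ x ^ (1 : ℝ) := Real.rpow_le_rpow_of_exponent_le h hp1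
        _ ≤ 1 + x := by rw [Real.rpow_one]; linarith
  have key : ∀ x y : ℝ, |y| ≤ |x| → |(|x| ^ p * x - |y| ^ p * y)| ≤
      2 * (2 + |x| + |y|) * |x - y| := by
    intro x y hxy
    have hx0 := abs_nonneg x
    have hy0 := abs_nonneg y
    have hxp : 0 ≤ |x| ^ p := by positivity
    have hyp : 0 ≤ |y| ^ p := by positivity
    have h1 : (|x| ^ p - |y| ^ p) * |y| ≤ |y| ^ p * |x - y| := by
      rcases hy0.eq_or_lt with h | h
      · rw [← h]; simp; positivity
      · have hx : 0 < |x| := h.trans_le hxy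
        have h2 : |x| ^ p * |y| ≤ |y| ^ p * |x| := by
          have h3 : |x| ^ (p - 1) ≤ |y| ^ (p - 1) :=
            Real.rpow_le_rpow_of_nonpos h hxy (by linarith)
          have e1 : |x| ^ p = |x| ^ (p - 1) * |x| := by
            rw [← Real.rpow_add_one hx.ne']; ring_nf
          have e2 : |y| ^ p = |y| ^ (p - 1) * |y| := by
            rw [← Real.rpow_add_one h.ne']; ring_nf
          rw [e1, e2]
          nlinarith [mul_le_mul_of_nonneg_right h3 (mul_nonneg hx0 hy0)]
        have h4 : |x| - |y| ≤ |x - y| := abs_sub_abs_le_abs_sub x y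
        nlinarith [mul_le_mul_of_nonneg_left h4 hyp]
    have h5 : |y| ^ p ≤ |x| ^ p := Real.rpow_le_rpow hy0 hxy hp.le
    have h6 : |x| ^ p * x - |y| ^ p * y = |x| ^ p * (x - y) + (|x| ^ p - |y| ^ p) * y := by ring
    rw [h6]
    refine (abs_add_le _ _).trans ?_
    rw [abs_mul, abs_mul, abs_of_nonneg hxp, abs_of_nonneg (sub_nonneg.2 h5)]
    have h7 := hle _ hx0
    have h8 := hle _ hy0
    have h9 := abs_nonneg (x - y)
    nlinarith [mul_le_mul_of_nonneg_right h7 h9, mul_le_mul_of_nonneg_right h8 h9,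
      mul_nonneg hx0 h9, mul_nonneg hy0 h9]
  rcases le_total |b| |a| with h | h
  · exact key a b h
  · have := key b a h
    rw [abs_sub_comm, abs_sub_comm b a] at this
    linarith

/-- The taming nonlinearity of a scalar map. -/
lemma Tame.rpow {N : P → E → ℝ} (h : Tame 0 N) (c : ℝ) {p : ℝ} (hp : 0 < p) (hp1 : p ≤ 1) :
    Tame 1 (fun z r => c * |N z r| ^ p * N z r) where
  cont := by
    refine (continuous_const.mul (Continuous.rpow_const h.cont.abs fun _ => Or.inr hp.le)).mul h.cont
  zero := by rw [h.zero, mul_zero]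
  lip K hK := by
    obtain ⟨C, hC, hl⟩ := h.lip K hK
    obtain ⟨C', hC', hg⟩ := h.growth hK
    refine ⟨|c| * (2 * (2 + C' + C') * C), by positivity, fun z z' r r' hz hz' => ?_⟩
    have h1 := abs_rpow_mul_sub_le hp hp1 (N z r) (N z' r')
    have h2 := hl z z' r r' hz hz'
    have h3 := hg z r r' hz
    have h4 := hg z' r' r hz'
    rw [show 1 + ‖r'‖ + ‖r‖ = 1 + ‖r‖ + ‖r'‖ by ring] at h4
    set ρ := 1 + ‖r‖ + ‖r'‖ with hρ
    have hρ1 : 1 ≤ ρ := by linarith [norm_nonneg r, norm_nonneg r']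
    rw [pow_zero, mul_one] at h2
    rw [zero_add, pow_one, Real.norm_eq_abs] at h3 h4
    rw [Real.norm_eq_abs] at h2
    rw [Real.norm_eq_abs, pow_one]
    have h5 : c * |N z r| ^ p * N z r - c * |N z' r'| ^ p * N z' r' =
        c * (|N z r| ^ p * N z r - |N z' r'| ^ p * N z' r') := by ring
    rw [h5, abs_mul]
    calc |c| * |(|N z r| ^ p * N z r - |N z' r'| ^ p * N z' r')|
        ≤ |c| * (2 * (2 * ρ + C' * ρ + C' * ρ) * (C * (ρ * ‖z - z'‖ + ‖r - r'‖))) := by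
          refine mul_le_mul_of_nonneg_left (h1.trans ?_) (abs_nonneg _)
          gcongr
          linarith
      _ = _ := by ring

end TameMaps

/-! ### Space-time estimates -/

section SpaceTime

set_option linter.unusedSectionVars false

lemma holderTriple_three_three : ENNReal.HolderTriple 3 3 (3 / 2) := ⟨by
  rw [ENNReal.inv_div (by simp) (by simp), ← two_mul, ENNReal.div_eq_inv_mul, mul_comm]⟩

attribute [instance] holderTriple_three_three

/-- Hölder's inequality on a time interval. -/
lemma eLpNorm_mul_time_le {τ : ℝ} {g k : ℝ → ℝ} (hg : AEStronglyMeasurable g (timeMeasure τ))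
    (hk : AEStronglyMeasurable k (timeMeasure τ)) {a b : ℝ} (ha : 0 ≤ a)
    (h1 : eLpNorm g 3 (timeMeasure τ) ≤ ENNReal.ofReal a)
    (h2 : eLpNorm k 3 (timeMeasure τ) ≤ ENNReal.ofReal b) :
    eLpNorm (fun t => g t * k t) (3 / 2) (timeMeasure τ) ≤ ENNReal.ofReal (a * b) := by
  rw [ENNReal.ofReal_mul ha]
  have h3 : eLpNorm (g • k) (3 / 2) (timeMeasure τ) ≤
      eLpNorm g 3 (timeMeasure τ) * eLpNorm k 3 (timeMeasure τ) :=
    eLpNorm_smul_le_mul_eLpNorm hk hg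
  exact h3.trans (mul_le_mul' h1 h2)

lemma isFiniteMeasure_timeMeasure (T : ℝ) : IsFiniteMeasure (timeMeasure T) :=
  ⟨by rw [timeMeasure]; simp⟩

attribute [instance] isFiniteMeasure_timeMeasure

lemma timeMeasure_univ (T : ℝ) : timeMeasure T univ = ENNReal.ofReal T := by
  simp [timeMeasure]

lemma timeMeasure_mono {t T : ℝ} (h : t ≤ T) : timeMeasure t ≤ timeMeasure T :=
  Measure.restrict_mono (Icc_subset_Icc_right h) le_rfl

lemma ae_timeMeasure_mem (T : ℝ) : ∀ᵐ t ∂timeMeasure T, t ∈ Icc 0 T :=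
  ae_restrict_mem measurableSet_Icc

/-- Together with the next lemma, the source of the small factor in the contraction: passing from L³
to L^{3/2}, or from L^{3/2} to L¹, gains the power 1/3 of the length of the interval. -/
lemma eLpNorm_le_time {E : Type*} [NormedAddCommGroup E] {τ : ℝ} {f : ℝ → E}
    (hf : AEStronglyMeasurable f (timeMeasure τ)) :
    eLpNorm f (3 / 2) (timeMeasure τ) ≤
      eLpNorm f 3 (timeMeasure τ) * ENNReal.ofReal τ ^ (1 / 3 : ℝ) := by
  have h := eLpNorm_le_eLpNorm_mul_rpow_measure_univ (p := 3 / 2) (q := 3)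
    (by rw [ENNReal.div_le_iff_le_mul (by simp) (by simp)]; norm_num) hf
  rw [timeMeasure_univ] at h
  refine h.trans (le_of_eq ?_)
  congr 2
  rw [ENNReal.toReal_div]; norm_num

lemma eLpNorm_one_le_time {E : Type*} [NormedAddCommGroup E] {τ : ℝ} {f : ℝ → E}
    (hf : AEStronglyMeasurable f (timeMeasure τ)) :
    eLpNorm f 1 (timeMeasure τ) ≤
      eLpNorm f (3 / 2) (timeMeasure τ) * ENNReal.ofReal τ ^ (1 / 3 : ℝ) := by
  have h := eLpNorm_le_eLpNorm_mul_rpow_measure_univ (p := 1) (q := 3 / 2)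
    (by rw [ENNReal.le_div_iff_mul_le (by simp) (by simp)]; norm_num) hf
  rw [timeMeasure_univ] at h
  refine h.trans (le_of_eq ?_)
  congr 2
  rw [ENNReal.toReal_div]; norm_num

lemma eLpNorm_const_time_le {τ : ℝ} (hτ1 : τ ≤ 1) {c : ℝ} (hc : 0 ≤ c) :
    eLpNorm (fun _ : ℝ => c) 3 (timeMeasure τ) ≤ ENNReal.ofReal c := by
  rw [eLpNorm_const' _ (by norm_num) (by norm_num), timeMeasure_univ, ← Real.norm_of_nonneg hc,
    ofReal_norm, Real.norm_of_nonneg hc]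
  refine mul_le_of_le_one_right' ?_
  refine ENNReal.rpow_le_one ?_ (by positivity)
  rw [← ENNReal.ofReal_one]
  exact ENNReal.ofReal_le_ofReal hτ1

variable {P E G : Type*} [NormedAddCommGroup P] [NormedAddCommGroup E] [NormedAddCommGroup G]
  [NormedSpace ℝ P] [NormedSpace ℝ E] [NormedSpace ℝ G]

/-- The weight `1 + ‖r‖ + ‖r'‖` in `L³`. -/
lemma eLpNorm_weight_le {τ K : ℝ} (hτ1 : τ ≤ 1) (hK : 0 ≤ K) {r r' : ℝ → E}
    (hr : AEStronglyMeasurable r (timeMeasure τ)) (hr' : AEStronglyMeasurable r' (timeMeasure τ))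
    (hrK : eLpNorm r 3 (timeMeasure τ) ≤ ENNReal.ofReal K)
    (hrK' : eLpNorm r' 3 (timeMeasure τ) ≤ ENNReal.ofReal K) :
    eLpNorm (fun t => 1 + ‖r t‖ + ‖r' t‖) 3 (timeMeasure τ) ≤ ENNReal.ofReal (1 + K + K) := by
  have h1 := eLpNorm_add_le ((aestronglyMeasurable_const (b := (1 : ℝ))).add hr.norm) hr'.norm
    (p := 3) (by norm_num)
  have h2 := eLpNorm_add_le (aestronglyMeasurable_const (b := (1 : ℝ)) (μ := timeMeasure τ)) hr.norm
    (p := 3) (by norm_num)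
  refine h1.trans ?_
  rw [ENNReal.ofReal_add (by positivity) hK, ENNReal.ofReal_add zero_le_one hK]
  refine add_le_add (h2.trans (add_le_add (eLpNorm_const_time_le hτ1 zero_le_one) ?_)) ?_
  · rwa [eLpNorm_norm]
  · rwa [eLpNorm_norm]

lemma eLpNorm_increment_le {τ K δ : ℝ} (hτ1 : τ ≤ 1) (hK : 0 ≤ K) (hδ : 0 ≤ δ) {r r' : ℝ → E}
    (hr : AEStronglyMeasurable r (timeMeasure τ)) (hr' : AEStronglyMeasurable r' (timeMeasure τ))
    (hrK : eLpNorm r 3 (timeMeasure τ) ≤ ENNReal.ofReal K)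
    (hrK' : eLpNorm r' 3 (timeMeasure τ) ≤ ENNReal.ofReal K)
    (hd : eLpNorm (fun t => r t - r' t) 3 (timeMeasure τ) ≤ ENNReal.ofReal δ) :
    eLpNorm (fun t => (1 + ‖r t‖ + ‖r' t‖) * δ + ‖r t - r' t‖) 3 (timeMeasure τ) ≤
      ENNReal.ofReal ((2 + K + K) * δ) := by
  have hw : AEStronglyMeasurable (fun t => 1 + ‖r t‖ + ‖r' t‖) (timeMeasure τ) :=
    (aestronglyMeasurable_const.add hr.norm).add hr'.norm
  have h1 := eLpNorm_add_le (hw.mul_const δ) (hr.sub hr').norm (p := 3) (by norm_num)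
  refine h1.trans ?_
  rw [show (2 + K + K) * δ = (1 + K + K) * δ + δ by ring, ENNReal.ofReal_add (by positivity) hδ]
  refine add_le_add ?_ ?_
  · have h2 : (fun t => (1 + ‖r t‖ + ‖r' t‖) * δ) = δ • fun t => 1 + ‖r t‖ + ‖r' t‖ := by
      funext t; simp [mul_comm]
    rw [h2, eLpNorm_const_smul, mul_comm, ENNReal.ofReal_mul (by positivity), ← ofReal_norm,
      Real.norm_of_nonneg hδ]
    gcongr
    exact eLpNorm_weight_le hτ1 hK hr hr' hrK hrK'
  · rw [eLpNorm_norm]; exact hd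

/-- Hypotheses on two paths that are bounded by `K` and at distance at most `δ` on `[0, τ]`. -/
structure PathPair (τ K δ : ℝ) (a a' : ℝ → P) (r r' : ℝ → E) : Prop where
  cont : ContinuousOn a (Icc 0 τ)
  cont' : ContinuousOn a' (Icc 0 τ)
  meas : AEStronglyMeasurable r (timeMeasure τ)
  meas' : AEStronglyMeasurable r' (timeMeasure τ)
  bound : ∀ t ∈ Icc 0 τ, ‖a t‖ ≤ K
  bound' : ∀ t ∈ Icc 0 τ, ‖a' t‖ ≤ K
  rbound : eLpNorm r 3 (timeMeasure τ) ≤ ENNReal.ofReal K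
  rbound' : eLpNorm r' 3 (timeMeasure τ) ≤ ENNReal.ofReal K
  diff : ∀ t ∈ Icc 0 τ, ‖a t - a' t‖ ≤ δ
  rdiff : eLpNorm (fun t => r t - r' t) 3 (timeMeasure τ) ≤ ENNReal.ofReal δ

/-- Since the nonlinearities vanish at zero, comparison with the zero path turns a difference
estimate into a size estimate. -/
lemma PathPair.left {τ K δ : ℝ} {a a' : ℝ → P} {r r' : ℝ → E} (hK : 0 ≤ K)
    (h : PathPair τ K δ a a' r r') : PathPair τ K K a (fun _ => 0) r (fun _ => 0) :=
  ⟨h.cont, continuousOn_const, h.meas, aestronglyMeasurable_const, h.bound,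
    fun _ _ => by simpa using hK, h.rbound, by simp, by simpa using h.bound,
    by simpa using h.rbound⟩

lemma PathPair.symm {τ K δ : ℝ} {a a' : ℝ → P} {r r' : ℝ → E} (h : PathPair τ K δ a a' r r') :
    PathPair τ K δ a' a r' r :=
  ⟨h.cont', h.cont, h.meas', h.meas, h.bound', h.bound, h.rbound', h.rbound,
    fun t ht => by rw [norm_sub_rev]; exact h.diff t ht, by
      refine (eLpNorm_congr_norm_ae (Eventually.of_forall fun t => ?_)).trans_le h.rdiff
      exact norm_sub_rev _ _⟩

lemma Tame.aestronglyMeasurable {j : ℕ} {F : P → E → G} (hF : Tame j F) {τ : ℝ} {a : ℝ → P}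
    {r : ℝ → E} (ha : ContinuousOn a (Icc 0 τ)) (hr : AEStronglyMeasurable r (timeMeasure τ)) :
    AEStronglyMeasurable (fun t => F (a t) (r t)) (timeMeasure τ) :=
  hF.cont.comp_aestronglyMeasurable
    ((ha.aestronglyMeasurable_of_isCompact isCompact_Icc measurableSet_Icc).prodMk hr)

/-- With linear growth the difference is in L³ in time, and lowering the exponent to 3/2 yields
τ^{1/3}. -/
lemma Tame.time_bound_zero {F : P → E → G} (hF : Tame 0 F) {K : ℝ} (hK : 0 ≤ K) :
    ∃ C, 0 ≤ C ∧ ∀ (τ δ : ℝ) (a a' : ℝ → P) (r r' : ℝ → E), 0 ≤ τ → τ ≤ 1 → 0 ≤ δ →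
      PathPair τ K δ a a' r r' →
      eLpNorm (fun t => F (a t) (r t) - F (a' t) (r' t)) (3 / 2) (timeMeasure τ) ≤
        ENNReal.ofReal (C * τ ^ (1 / 3 : ℝ) * δ) := by
  obtain ⟨C, hC, hl⟩ := hF.lip K hK
  refine ⟨C * (2 + K + K), by positivity, fun τ δ a a' r r' hτ hτ1 hδ h => ?_⟩
  have hm : AEStronglyMeasurable (fun t => F (a t) (r t) - F (a' t) (r' t)) (timeMeasure τ) :=
    (hF.aestronglyMeasurable h.cont h.meas).sub (hF.aestronglyMeasurable h.cont' h.meas')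
  refine (eLpNorm_le_time hm).trans ?_
  have h1 : eLpNorm (fun t => F (a t) (r t) - F (a' t) (r' t)) 3 (timeMeasure τ) ≤
      eLpNorm (C • fun t => (1 + ‖r t‖ + ‖r' t‖) * δ + ‖r t - r' t‖) 3 (timeMeasure τ) := by
    refine eLpNorm_mono_ae_real ?_
    filter_upwards [ae_timeMeasure_mem τ] with t ht
    have := hl (a t) (a' t) (r t) (r' t) (h.bound t ht) (h.bound' t ht)
    rw [pow_zero, mul_one] at this
    simp only [Pi.smul_apply, smul_eq_mul]
    refine this.trans ?_
    gcongr
    exact h.diff t ht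
  rw [eLpNorm_const_smul, ← ofReal_norm, Real.norm_of_nonneg hC] at h1
  rw [ENNReal.ofReal_rpow_of_nonneg hτ (by positivity),
    show C * (2 + K + K) * τ ^ (1 / 3 : ℝ) * δ = C * ((2 + K + K) * δ) * τ ^ (1 / 3 : ℝ) by ring,
    ENNReal.ofReal_mul (by positivity), ENNReal.ofReal_mul hC]
  gcongr
  refine h1.trans ?_
  gcongr
  exact eLpNorm_increment_le hτ1 hK hδ h.meas h.meas' h.rbound h.rbound' h.rdiff

/-- With quadratic growth the difference is bounded by a product of a weight and an increment, both
in L³. The product is in L^{3/2}, and lowering the exponent to 1 yields τ^{1/3}. -/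
lemma Tame.time_bound {F : P → E → G} (hF : Tame 1 F) {K : ℝ} (hK : 0 ≤ K) :
    ∃ C, 0 ≤ C ∧ ∀ (τ δ : ℝ) (a a' : ℝ → P) (r r' : ℝ → E), 0 ≤ τ → τ ≤ 1 → 0 ≤ δ →
      PathPair τ K δ a a' r r' →
      eLpNorm (fun t => F (a t) (r t) - F (a' t) (r' t)) 1 (timeMeasure τ) ≤
        ENNReal.ofReal (C * τ ^ (1 / 3 : ℝ) * δ) := by
  obtain ⟨C, hC, hl⟩ := hF.lip K hK
  refine ⟨C * ((1 + K + K) * (2 + K + K)), by positivity,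
    fun τ δ a a' r r' hτ hτ1 hδ h => ?_⟩
  have hm : AEStronglyMeasurable (fun t => F (a t) (r t) - F (a' t) (r' t)) (timeMeasure τ) :=
    (hF.aestronglyMeasurable h.cont h.meas).sub (hF.aestronglyMeasurable h.cont' h.meas')
  have hgm : AEStronglyMeasurable (fun t => 1 + ‖r t‖ + ‖r' t‖) (timeMeasure τ) :=
    (aestronglyMeasurable_const.add h.meas.norm).add h.meas'.norm
  have hkm : AEStronglyMeasurable (fun t => (1 + ‖r t‖ + ‖r' t‖) * δ + ‖r t - r' t‖)
      (timeMeasure τ) := (hgm.mul_const δ).add (h.meas.sub h.meas').norm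
  have h2 := eLpNorm_mul_time_le hgm hkm (by positivity)
    (eLpNorm_weight_le hτ1 hK h.meas h.meas' h.rbound h.rbound')
    (eLpNorm_increment_le hτ1 hK hδ h.meas h.meas' h.rbound h.rbound' h.rdiff)
  have h1 : eLpNorm (fun t => F (a t) (r t) - F (a' t) (r' t)) (3 / 2) (timeMeasure τ) ≤
      ENNReal.ofReal C * eLpNorm (fun t => (1 + ‖r t‖ + ‖r' t‖) *
        ((1 + ‖r t‖ + ‖r' t‖) * δ + ‖r t - r' t‖)) (3 / 2) (timeMeasure τ) := by
    refine eLpNorm_le_mul_eLpNorm_of_ae_le_mul ?_ _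
    filter_upwards [ae_timeMeasure_mem τ] with t ht
    have h3 := hl (a t) (a' t) (r t) (r' t) (h.bound t ht) (h.bound' t ht)
    rw [pow_one, mul_assoc] at h3
    refine h3.trans ?_
    rw [Real.norm_of_nonneg (by positivity)]
    gcongr
    exact h.diff t ht
  refine (eLpNorm_one_le_time hm).trans ?_
  rw [ENNReal.ofReal_rpow_of_nonneg hτ (by positivity),
    show C * ((1 + K + K) * (2 + K + K)) * τ ^ (1 / 3 : ℝ) * δ =
      C * ((1 + K + K) * ((2 + K + K) * δ)) * τ ^ (1 / 3 : ℝ) by ring,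
    ENNReal.ofReal_mul (by positivity), ENNReal.ofReal_mul hC]
  exact mul_le_mul_left (h1.trans (mul_le_mul_right h2 _)) _

/-- The trivial pair of a path and zero. -/
lemma exists_pathPair_zero {τ : ℝ} {a : ℝ → P} {r : ℝ → E} (ha : ContinuousOn a (Icc 0 τ))
    (hr : MemLp r 3 (timeMeasure τ)) :
    ∃ K, 0 ≤ K ∧ PathPair τ K K a (fun _ => 0) r (fun _ => 0) := by
  obtain ⟨K₁, hK₁⟩ := isCompact_Icc.exists_bound_of_continuousOn ha
  have h1 : ∀ t ∈ Icc 0 τ, ‖a t‖ ≤ max K₁ (eLpNorm r 3 (timeMeasure τ)).toReal :=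
    fun t ht => (hK₁ t ht).trans (le_max_left _ _)
  have hK : 0 ≤ max K₁ (eLpNorm r 3 (timeMeasure τ)).toReal :=
    ENNReal.toReal_nonneg.trans (le_max_right _ _)
  have h2 : eLpNorm r 3 (timeMeasure τ) ≤
      ENNReal.ofReal (max K₁ (eLpNorm r 3 (timeMeasure τ)).toReal) :=
    (ENNReal.le_ofReal_iff_toReal_le hr.2.ne hK).2 (le_max_right _ _)
  exact ⟨_, hK, ha, continuousOn_const, hr.1, aestronglyMeasurable_const, h1,
    fun _ _ => by simp [hK], h2, by simp, by simpa using h1, by simpa using h2⟩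

lemma Tame.integrable {F : P → E → G} (hF : Tame 1 F) {τ : ℝ} {a : ℝ → P} {r : ℝ → E} (hτ : 0 ≤ τ)
    (hτ1 : τ ≤ 1) (ha : ContinuousOn a (Icc 0 τ)) (hr : MemLp r 3 (timeMeasure τ)) :
    Integrable (fun t => F (a t) (r t)) (timeMeasure τ) := by
  obtain ⟨K, hK, hp⟩ := exists_pathPair_zero ha hr
  obtain ⟨C, hC, h⟩ := hF.time_bound hK
  have h1 := h τ K a (fun _ => 0) r (fun _ => 0) hτ hτ1 hK hp
  rw [← memLp_one_iff_integrable]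
  refine ⟨hF.aestronglyMeasurable ha hr.1, ?_⟩
  simp only [hF.zero, sub_zero] at h1
  exact h1.trans_lt ENNReal.ofReal_lt_top

lemma Tame.memLp {F : P → E → G} (hF : Tame 0 F) {τ : ℝ} {a : ℝ → P} {r : ℝ → E} (hτ : 0 ≤ τ)
    (hτ1 : τ ≤ 1) (ha : ContinuousOn a (Icc 0 τ)) (hr : MemLp r 3 (timeMeasure τ)) :
    MemLp (fun t => F (a t) (r t)) (3 / 2) (timeMeasure τ) := by
  obtain ⟨K, hK, hp⟩ := exists_pathPair_zero ha hr
  obtain ⟨C, hC, h⟩ := hF.time_bound_zero hK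
  have h1 := h τ K a (fun _ => 0) r (fun _ => 0) hτ hτ1 hK hp
  refine ⟨hF.aestronglyMeasurable ha hr.1, ?_⟩
  simp only [hF.zero, sub_zero] at h1
  exact h1.trans_lt ENNReal.ofReal_lt_top

end SpaceTime

end HartreeWave

namespace HartreeWave

/-! ### Integral operators with kernels in `L^∞_{t'} L³_t` -/

section Kernels

set_option linter.unusedSectionVars false

variable {E : Type*} [NormedAddCommGroup E] [NormedSpace ℝ E]

/-- Jensen for the measure f dν, obtained as Hölder with exponents 3/2 and 3 for the splitting fg =
f^{2/3} · f^{1/3} g. -/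
lemma lintegral_mul_pow_three_le {α : Type*} [MeasurableSpace α] {ν : Measure α} {f g : α → ℝ≥0∞}
    (hf : AEMeasurable f ν) (hg : AEMeasurable g ν) :
    (∫⁻ x, f x * g x ∂ν) ^ 3 ≤ (∫⁻ x, f x ∂ν) ^ 2 * ∫⁻ x, f x * g x ^ 3 ∂ν := by
  have hpq : (3 / 2 : ℝ).HolderConjugate 3 := ⟨by norm_num, by norm_num, by norm_num⟩
  have h := ENNReal.lintegral_mul_le_Lp_mul_Lq ν hpq (f := fun x => f x ^ (2 / 3 : ℝ))
    (g := fun x => f x ^ (1 / 3 : ℝ) * g x) (hf.pow_const _) ((hf.pow_const _).mul hg)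
  have e1 : ∀ x, ((fun x => f x ^ (2 / 3 : ℝ)) * fun x => f x ^ (1 / 3 : ℝ) * g x) x =
      f x * g x := fun x => by
    simp only [Pi.mul_apply]
    rw [← mul_assoc, ← ENNReal.rpow_add_of_nonneg _ _ (by norm_num) (by norm_num)]
    norm_num
  have e2 : ∀ x, (f x ^ (2 / 3 : ℝ)) ^ (3 / 2 : ℝ) = f x := fun x => by
    rw [← ENNReal.rpow_mul]; norm_num
  have e3 : ∀ x, (f x ^ (1 / 3 : ℝ) * g x) ^ (3 : ℝ) = f x * g x ^ 3 := fun x => by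
    rw [ENNReal.mul_rpow_of_nonneg _ _ (by norm_num), ← ENNReal.rpow_mul]
    norm_num
  simp only [e1, e2, e3] at h
  calc (∫⁻ x, f x * g x ∂ν) ^ 3
      ≤ ((∫⁻ x, f x ∂ν) ^ (1 / (3 / 2) : ℝ) * (∫⁻ x, f x * g x ^ 3 ∂ν) ^ (1 / 3 : ℝ)) ^ 3 := by
        gcongr
    _ = _ := by
        rw [mul_pow, ← ENNReal.rpow_natCast, ← ENNReal.rpow_mul, ← ENNReal.rpow_natCast _ 3,
          ← ENNReal.rpow_mul]
        norm_num

/-- A kernel that is bounded by `b` in `L^∞_{t'} L³_t` on the triangle. -/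
def KernelBound (T b : ℝ) (k : ℝ × ℝ → E) : Prop :=
  ∀ᵐ t' ∂timeMeasure T,
    eLpNorm (fun t => k (t, t')) 3 (volume.restrict (Icc t' T)) ≤ ENNReal.ofReal b

lemma KernelBound.mono {T τ b b' : ℝ} {k : ℝ × ℝ → E} (h : KernelBound T b k) (hτ : τ ≤ T)
    (hb : b ≤ b') : KernelBound τ b' k := by
  filter_upwards [ae_mono (timeMeasure_mono hτ) h] with t' ht'
  exact (eLpNorm_mono_measure _ (Measure.restrict_mono (Icc_subset_Icc_right hτ) le_rfl)).trans
    (ht'.trans (ENNReal.ofReal_le_ofReal hb))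

/-- The integral operator with kernel `k`. -/
noncomputable def kernelInt (m : ℝ → ℝ) (k : ℝ × ℝ → E) (t : ℝ) : E :=
  ∫ t' in (0 : ℝ)..t, m t' • k (t, t')

lemma measurableSet_triangle (T : ℝ) : MeasurableSet (triangle T) := by
  unfold triangle
  measurability

lemma timeMeasure_prod (T : ℝ) : (timeMeasure T).prod (timeMeasure T) =
    (volume : Measure (ℝ × ℝ)).restrict (Icc 0 T ×ˢ Icc 0 T) := by
  rw [timeMeasure, Measure.prod_restrict, Measure.volume_eq_prod]

lemma triangle_mono {τ T : ℝ} (h : τ ≤ T) : triangle τ ⊆ triangle T :=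
  fun _ hp => ⟨hp.1, hp.2.1, hp.2.2.trans h⟩

variable {τ : ℝ} {k : ℝ × ℝ → E} {m : ℝ → ℝ}

lemma aestronglyMeasurable_triangle
    (hk : AEStronglyMeasurable k (volume.restrict (triangle τ))) :
    AEStronglyMeasurable ((triangle τ).indicator k) ((timeMeasure τ).prod (timeMeasure τ)) := by
  rw [timeMeasure_prod]
  exact ((aestronglyMeasurable_indicator_iff (measurableSet_triangle τ)).2 hk).restrict

lemma kernel_indicator {t' : ℝ} (ht' : t' ∈ Icc 0 τ) :
    eLpNorm (fun t => (triangle τ).indicator k (t, t')) 3 (timeMeasure τ) =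
      eLpNorm (fun t => k (t, t')) 3 (volume.restrict (Icc t' τ)) := by
  have h : (fun t => (triangle τ).indicator k (t, t')) =
      (Icc t' τ).indicator fun t => k (t, t') := by
    funext t
    by_cases ht : t ∈ Icc t' τ
    · rw [indicator_of_mem ht, indicator_of_mem]
      exact ⟨ht'.1, ht.1, ht.2⟩
    · rw [indicator_of_notMem ht, indicator_of_notMem]
      exact fun h => ht ⟨h.2.1, h.2.2⟩
  rw [h, eLpNorm_indicator_eq_eLpNorm_restrict measurableSet_Icc, timeMeasure,
    Measure.restrict_restrict measurableSet_Icc,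
    inter_eq_left.2 (Icc_subset_Icc_left ht'.1)]

/-- A form of Minkowski's inequality: Jensen against |m| dt' moves the cube onto the kernel, and
Tonelli makes the integral in t the inner one, where the kernel bound holds for almost every t'. -/
lemma lintegral_kernel_le {a b : ℝ} (hm : AEStronglyMeasurable m (timeMeasure τ))
    (hk : AEStronglyMeasurable k (volume.restrict (triangle τ)))
    (ha : eLpNorm m 1 (timeMeasure τ) ≤ ENNReal.ofReal a) (hb : KernelBound τ b k) :
    ∫⁻ t, (∫⁻ t', ‖m t'‖ₑ * ‖(triangle τ).indicator k (t, t')‖ₑ ∂timeMeasure τ) ^ 3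
      ∂timeMeasure τ ≤ (ENNReal.ofReal a * ENNReal.ofReal b) ^ 3 := by
  have hκ := aestronglyMeasurable_triangle hk
  rw [eLpNorm_one_eq_lintegral_enorm] at ha
  have h1 : ∀ᵐ t ∂timeMeasure τ,
      (∫⁻ t', ‖m t'‖ₑ * ‖(triangle τ).indicator k (t, t')‖ₑ ∂timeMeasure τ) ^ 3 ≤
      ENNReal.ofReal a ^ 2 *
        ∫⁻ t', ‖m t'‖ₑ * ‖(triangle τ).indicator k (t, t')‖ₑ ^ 3 ∂timeMeasure τ := by
    filter_upwards [hκ.prodMk_left] with t ht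
    exact (lintegral_mul_pow_three_le hm.enorm ht.enorm).trans (by gcongr)
  refine (lintegral_mono_ae h1).trans ?_
  have hmeas : AEMeasurable (Function.uncurry fun t t' =>
      ‖m t'‖ₑ * ‖(triangle τ).indicator k (t, t')‖ₑ ^ 3)
      ((timeMeasure τ).prod (timeMeasure τ)) :=
    (hm.comp_snd.enorm).mul (hκ.enorm.pow_const 3)
  rw [lintegral_const_mul' _ _ (by finiteness), lintegral_lintegral_swap hmeas]
  have h2 : ∀ᵐ t' ∂timeMeasure τ,
      ∫⁻ t, ‖m t'‖ₑ * ‖(triangle τ).indicator k (t, t')‖ₑ ^ 3 ∂timeMeasure τ ≤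
        ‖m t'‖ₑ * ENNReal.ofReal b ^ 3 := by
    filter_upwards [hb, ae_timeMeasure_mem τ] with t' h ht'
    rw [lintegral_const_mul' _ _ (by finiteness)]
    rw [← kernel_indicator ht', eLpNorm_eq_lintegral_rpow_enorm_toReal (by norm_num)
      (by norm_num)] at h
    gcongr
    calc ∫⁻ t, ‖(triangle τ).indicator k (t, t')‖ₑ ^ 3 ∂timeMeasure τ
        = ((∫⁻ t, ‖(triangle τ).indicator k (t, t')‖ₑ ^ (3 : ℝ≥0∞).toReal ∂timeMeasure τ) ^
          (1 / (3 : ℝ≥0∞).toReal)) ^ 3 := by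
          rw [← ENNReal.rpow_natCast _ 3, ← ENNReal.rpow_mul]
          norm_num
      _ ≤ _ := by gcongr
  refine (mul_le_mul_right (lintegral_mono_ae h2) _).trans ?_
  rw [lintegral_mul_const' _ _ (by finiteness), mul_pow]
  calc ENNReal.ofReal a ^ 2 * ((∫⁻ t, ‖m t‖ₑ ∂timeMeasure τ) * ENNReal.ofReal b ^ 3)
      ≤ ENNReal.ofReal a ^ 2 * (ENNReal.ofReal a * ENNReal.ofReal b ^ 3) := by gcongr
    _ = _ := by ring

/-- Extending the kernel by zero off the triangle replaces the moving interval [0, t] by a fixed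
one, so that product measures can be used. -/
lemma kernelInt_eq {t : ℝ} (ht : t ∈ Icc 0 τ) :
    kernelInt m k t = ∫ t', m t' • (triangle τ).indicator k (t, t') ∂timeMeasure τ := by
  have h : (fun t' => m t' • k (t, t')) =ᵐ[volume.restrict (Icc 0 t)]
      fun t' => m t' • (triangle τ).indicator k (t, t') := by
    filter_upwards [ae_restrict_mem measurableSet_Icc] with t' ht'
    rw [indicator_of_mem (show (t, t') ∈ triangle τ from ⟨ht'.1, ht'.2, ht.2⟩)]
  rw [kernelInt, intervalIntegral.integral_of_le ht.1, ← integral_Icc_eq_integral_Ioc,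
    integral_congr_ae h, timeMeasure]
  refine (setIntegral_eq_of_subset_of_forall_sdiff_eq_zero measurableSet_Icc
    (Icc_subset_Icc_right ht.2) fun t' ht' => ?_).symm
  rw [indicator_of_notMem, smul_zero]
  exact fun h => ht'.2 ⟨h.1, h.2.1⟩

lemma enorm_kernelInt_le {t : ℝ} (ht : t ∈ Icc 0 τ) : ‖kernelInt m k t‖ₑ ≤
    ∫⁻ t', ‖m t'‖ₑ * ‖(triangle τ).indicator k (t, t')‖ₑ ∂timeMeasure τ := by
  rw [kernelInt_eq ht]
  refine (enorm_integral_le_lintegral_enorm _).trans (le_of_eq ?_)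
  simp_rw [enorm_smul]

lemma aestronglyMeasurable_kernelInt (hm : AEStronglyMeasurable m (timeMeasure τ))
    (hk : AEStronglyMeasurable k (volume.restrict (triangle τ))) :
    AEStronglyMeasurable (kernelInt m k) (timeMeasure τ) := by
  have h := ((hm.comp_snd (μ := timeMeasure τ)).smul
    (aestronglyMeasurable_triangle hk)).integral_prod_right'
  refine h.congr ?_
  filter_upwards [ae_timeMeasure_mem τ] with t ht
  exact (kernelInt_eq ht).symm

lemma eLpNorm_kernelInt_le {a b : ℝ} (ha0 : 0 ≤ a) (hm : AEStronglyMeasurable m (timeMeasure τ))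
    (hk : AEStronglyMeasurable k (volume.restrict (triangle τ)))
    (ha : eLpNorm m 1 (timeMeasure τ) ≤ ENNReal.ofReal a) (hb : KernelBound τ b k) :
    eLpNorm (kernelInt m k) 3 (timeMeasure τ) ≤ ENNReal.ofReal (a * b) := by
  have h := lintegral_kernel_le hm hk ha hb
  rw [ENNReal.ofReal_mul ha0, eLpNorm_eq_lintegral_rpow_enorm_toReal (by norm_num) (by norm_num)]
  have h1 : ∫⁻ t, ‖kernelInt m k t‖ₑ ^ (3 : ℝ≥0∞).toReal ∂timeMeasure τ ≤
      (ENNReal.ofReal a * ENNReal.ofReal b) ^ 3 := by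
    refine le_trans (lintegral_mono_ae ?_) h
    filter_upwards [ae_timeMeasure_mem τ] with t ht
    rw [show (3 : ℝ≥0∞).toReal = ((3 : ℕ) : ℝ) by norm_num, ENNReal.rpow_natCast]
    gcongr
    exact enorm_kernelInt_le ht
  calc _ ≤ ((ENNReal.ofReal a * ENNReal.ofReal b) ^ 3) ^ (1 / (3 : ℝ≥0∞).toReal) := by gcongr
    _ = _ := by
      rw [← ENNReal.rpow_natCast _ 3, ← ENNReal.rpow_mul]
      norm_num

/-- The cube of the integral of the norms is integrable in t, hence finite for almost every t.
Nothing better can be expected of a kernel that is only L³ in t. -/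
lemma ae_intervalIntegrable_kernel {b : ℝ} (hm : Integrable m (timeMeasure τ))
    (hk : AEStronglyMeasurable k (volume.restrict (triangle τ))) (hb : KernelBound τ b k) :
    ∀ᵐ t ∂timeMeasure τ, IntervalIntegrable (fun t' => m t' • k (t, t')) volume 0 t := by
  have hκ := aestronglyMeasurable_triangle hk
  have h := lintegral_kernel_le (a := (eLpNorm m 1 (timeMeasure τ)).toReal) hm.1 hk
    (ENNReal.ofReal_toReal (memLp_one_iff_integrable.2 hm).2.ne).ge hb
  have hmeas : AEMeasurable (fun t => (∫⁻ t', ‖m t'‖ₑ *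
      ‖(triangle τ).indicator k (t, t')‖ₑ ∂timeMeasure τ) ^ 3) (timeMeasure τ) := by
    have : AEMeasurable (fun z : ℝ × ℝ => ‖m z.2‖ₑ * ‖(triangle τ).indicator k z‖ₑ)
      ((timeMeasure τ).prod (timeMeasure τ)) := (hm.1.comp_snd.enorm).mul hκ.enorm
    exact (this.lintegral_prod_right').pow_const 3
  have h1 := ae_lt_top' hmeas (h.trans_lt (by finiteness)).ne
  filter_upwards [h1, hκ.prodMk_left, ae_timeMeasure_mem τ] with t h2 h3 ht
  have h4 : Integrable (fun t' => m t' • (triangle τ).indicator k (t, t')) (timeMeasure τ) := by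
    refine ⟨hm.1.smul h3, ?_⟩
    rw [hasFiniteIntegral_iff_enorm]
    simp_rw [enorm_smul]
    by_contra hc
    rw [not_lt, top_le_iff] at hc
    rw [hc] at h2
    simp at h2
  rw [intervalIntegrable_iff_integrableOn_Icc_of_le ht.1]
  have h5 : IntegrableOn (fun t' => m t' • (triangle τ).indicator k (t, t')) (Icc 0 t) volume :=
    IntegrableOn.mono_set h4 (Icc_subset_Icc_right ht.2)
  refine h5.congr_fun (fun t' ht' => ?_) measurableSet_Icc
  simp only
  rw [indicator_of_mem (show (t, t') ∈ triangle τ from ⟨ht'.1, ht'.2, ht.2⟩)]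

/-- Differences of integral operators. -/
lemma kernelInt_sub_ae {m' : ℝ → ℝ} {k' : ℝ × ℝ → E} {b b' : ℝ}
    (hm : Integrable m (timeMeasure τ)) (hm' : Integrable m' (timeMeasure τ))
    (hk : AEStronglyMeasurable k (volume.restrict (triangle τ)))
    (hk' : AEStronglyMeasurable k' (volume.restrict (triangle τ)))
    (hb : KernelBound τ b k) (hb' : KernelBound τ b' k') :
    ∀ᵐ t ∂timeMeasure τ, kernelInt m k t - kernelInt m' k' t =
      kernelInt (fun t => m t - m' t) k t + kernelInt m' (fun z => k z - k' z) t := by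
  filter_upwards [ae_intervalIntegrable_kernel hm hk hb, ae_intervalIntegrable_kernel hm' hk hb,
    ae_intervalIntegrable_kernel hm' hk' hb'] with t h1 h2 h3
  simp only [kernelInt, sub_smul, smul_sub]
  rw [intervalIntegral.integral_sub h1 h2, intervalIntegral.integral_sub h2 h3]
  abel

end Kernels

end HartreeWave

namespace HartreeWave

/-! ### Causal operators -/

section CausalOperators

/-- The class of the truncation of `f` to `[0, T]`, as a function on `[0, 1]`. -/
noncomputable def truncLp (T : ℝ) (f : ℝ → LpT 2) : Lp (LpT 2) (3 / 2) (timeMeasure 1) :=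
  open Classical in
  if h : MemLp ((Icc 0 T).indicator f) (3 / 2) (timeMeasure 1) then h.toLp else 0

variable {T τ : ℝ} {f g : ℝ → LpT 2} {J J' : ParaOp}

lemma ae_timeMeasure_iff {p : ℝ → Prop} :
    (∀ᵐ t ∂timeMeasure T, p t) ↔ ∀ᵐ t, t ∈ Icc 0 T → p t :=
  ae_restrict_iff' measurableSet_Icc

lemma timeMeasure_restrict (h : τ ≤ T) : (timeMeasure T).restrict (Icc 0 τ) = timeMeasure τ := by
  rw [timeMeasure, Measure.restrict_restrict measurableSet_Icc,
    inter_eq_left.2 (Icc_subset_Icc_right h), timeMeasure]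

lemma memLp_indicator_time (hT : T ≤ 1) (hf : MemLp f (3 / 2) (timeMeasure T)) :
    MemLp ((Icc 0 T).indicator f) (3 / 2) (timeMeasure 1) := by
  rw [memLp_indicator_iff_restrict measurableSet_Icc, timeMeasure_restrict hT]
  exact hf

lemma truncLp_ae (hT : T ≤ 1) (hf : MemLp f (3 / 2) (timeMeasure T)) :
    truncLp T f =ᵐ[timeMeasure 1] (Icc 0 T).indicator f := by
  rw [truncLp, dif_pos (memLp_indicator_time hT hf)]
  exact MemLp.coeFn_toLp _

lemma truncLp_ae_eq (hT : T ≤ 1) (hf : MemLp f (3 / 2) (timeMeasure T)) :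
    ∀ᵐ t ∂timeMeasure T, truncLp T f t = f t := by
  filter_upwards [ae_mono (timeMeasure_mono hT) (truncLp_ae hT hf), ae_timeMeasure_mem T]
    with t h ht
  rw [h, indicator_of_mem ht]

lemma truncLp_ae_zero (hT : T ≤ 1) (hf : MemLp f (3 / 2) (timeMeasure T)) :
    ∀ᵐ t ∂timeMeasure 1, T < t → truncLp T f t = 0 := by
  filter_upwards [truncLp_ae hT hf] with t h ht
  rw [h, indicator_of_notMem fun h => ht.not_ge h.2]

lemma eq_truncLp (hT : T ≤ 1) (hf : MemLp f (3 / 2) (timeMeasure T))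
    {W : Lp (LpT 2) (3 / 2) (timeMeasure 1)} (h0 : ∀ᵐ t ∂timeMeasure 1, T < t → W t = 0)
    (h1 : ∀ᵐ t ∂timeMeasure T, W t = f t) : W = truncLp T f := by
  refine Lp.ext ?_
  have h2 : ∀ᵐ t ∂timeMeasure 1, t ∈ Icc 0 T → W t = f t := by
    rw [ae_timeMeasure_iff] at h1 ⊢
    filter_upwards [h1] with t h _ ht
    exact h ht
  filter_upwards [truncLp_ae hT hf, h0, h2, ae_timeMeasure_mem 1] with t e1 e2 e3 e4
  rw [e1]
  by_cases ht : t ∈ Icc 0 T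
  · rw [indicator_of_mem ht, e3 ht]
  · rw [indicator_of_notMem ht, e2 (not_le.1 fun h => ht ⟨e4.1, h⟩)]

/-- The restriction of `J` to `[0, T]` is bounded by `K`. -/
def JBound (T K : ℝ) (J : ParaOp) : Prop :=
  ∀ W : Lp (LpT 2) (3 / 2) (timeMeasure 1), (∀ᵐ t ∂timeMeasure 1, T < t → W t = 0) →
    eLpNorm (J W) ∞ (timeMeasure T) ≤ ENNReal.ofReal K * eLpNorm W (3 / 2) (timeMeasure T)

lemma coeFn_sub_time (hτ : τ ≤ 1) {p : ℝ≥0∞} (f g : Lp (LpT 2) p (timeMeasure 1)) :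
    ∀ᵐ t ∂timeMeasure τ, (f - g) t = f t - g t :=
  ae_mono (timeMeasure_mono hτ) (Lp.coeFn_sub f g)

lemma Causal.sub (hJ : Causal J) (hJ' : Causal J') : Causal (J - J') := by
  intro t ht W hW
  filter_upwards [hJ t ht W hW, hJ' t ht W hW, coeFn_sub_time ht.2 (J W) (J' W)] with s h1 h2 h3
  rw [sub_apply, h3, h1, h2, sub_zero]

lemma causal_zero : Causal 0 := by
  intro t ht W _
  rw [zero_apply]
  exact ae_mono (timeMeasure_mono ht.2) (Lp.coeFn_zero _ _ _)

/-- On [0, τ] the output for W agrees with the output for the truncation of W to [0, τ]. So a bound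
on the single interval [0, T] gives the same bound on every shorter one, as the continuity argument
requires. -/
lemma JBound.causal_bound {K : ℝ} (h : JBound T K J) (hJ : Causal J) (hτ : 0 ≤ τ) (hτT : τ ≤ T)
    (hT : T ≤ 1) (W : Lp (LpT 2) (3 / 2) (timeMeasure 1)) :
    eLpNorm (J W) ∞ (timeMeasure τ) ≤ ENNReal.ofReal K * eLpNorm W (3 / 2) (timeMeasure τ) := by
  have hτ1 := hτT.trans hT
  have hWm : MemLp W (3 / 2) (timeMeasure τ) := (Lp.memLp W).mono_measure (timeMeasure_mono hτ1)
  set V := truncLp τ W with hV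
  have h1 : ∀ᵐ t ∂timeMeasure τ, V t = W t := truncLp_ae_eq hτ1 hWm
  have h2 := truncLp_ae_zero hτ1 hWm
  have h3 : ∀ᵐ t ∂timeMeasure τ, J W t = J V t := by
    have h4 := hJ τ ⟨hτ, hτ1⟩ (W - V) (by
      filter_upwards [coeFn_sub_time hτ1 W V, h1] with t e1 e2
      rw [e1, e2, sub_self])
    rw [map_sub] at h4
    filter_upwards [h4, coeFn_sub_time hτ1 (J W) (J V)] with t e1 e2
    rw [e2, sub_eq_zero] at e1
    exact e1
  have h5 := h V (by filter_upwards [h2] with t ht hTt using ht (hτT.trans_lt hTt))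
  rw [eLpNorm_congr_ae h3]
  refine (eLpNorm_mono_measure _ (timeMeasure_mono hτT)).trans (h5.trans ?_)
  gcongr
  rw [← eLpNorm_congr_ae h1]
  have h6 : eLpNorm V (3 / 2) (timeMeasure T) =
      eLpNorm ((Icc 0 τ).indicator W) (3 / 2) (timeMeasure T) :=
    eLpNorm_congr_ae (ae_mono (timeMeasure_mono hT) (truncLp_ae hτ1 hWm))
  rw [h6, eLpNorm_indicator_eq_eLpNorm_restrict measurableSet_Icc,
    timeMeasure_restrict hτT, eLpNorm_congr_ae h1]

lemma jBound_norm (hT : T ≤ 1) (J : ParaOp) : JBound T ‖J‖ J := by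
  intro W hW
  have h1 : eLpNorm W (3 / 2) (timeMeasure 1) ≤ eLpNorm W (3 / 2) (timeMeasure T) := by
    have h2 : W =ᵐ[timeMeasure 1] (Icc 0 T).indicator W := by
      filter_upwards [hW, ae_timeMeasure_mem 1] with t h ht
      by_cases h' : t ∈ Icc 0 T
      · rw [indicator_of_mem h']
      · rw [indicator_of_notMem h', h (not_le.1 fun h => h' ⟨ht.1, h⟩)]
    rw [eLpNorm_congr_ae h2, eLpNorm_indicator_eq_eLpNorm_restrict measurableSet_Icc,
      timeMeasure_restrict hT]
  calc eLpNorm (J W) ∞ (timeMeasure T) ≤ eLpNorm (J W) ∞ (timeMeasure 1) :=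
        eLpNorm_mono_measure _ (timeMeasure_mono hT)
    _ = ENNReal.ofReal ‖J W‖ := by
        rw [Lp.norm_def, ENNReal.ofReal_toReal (Lp.eLpNorm_ne_top _)]
    _ ≤ ENNReal.ofReal (‖J‖ * ‖W‖) := ENNReal.ofReal_le_ofReal (J.le_opNorm W)
    _ = ENNReal.ofReal ‖J‖ * eLpNorm W (3 / 2) (timeMeasure 1) := by
        rw [ENNReal.ofReal_mul (norm_nonneg _), Lp.norm_def W,
          ENNReal.ofReal_toReal (Lp.eLpNorm_ne_top _)]
    _ ≤ _ := by gcongr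

lemma JBound.mono {K K' : ℝ} (h : JBound T K J) (hK : K ≤ K') : JBound T K' J :=
  fun W hW => (h W hW).trans (by gcongr)

lemma JBound.add {K K' : ℝ} (hT : T ≤ 1) (hK : 0 ≤ K) (hK' : 0 ≤ K') (h : JBound T K J)
    (h' : JBound T K' (J' - J)) : JBound T (K + K') J' := by
  intro W hW
  have h1 : J' W =ᵐ[timeMeasure T] fun t => J W t + (J' - J) W t := by
    filter_upwards [coeFn_sub_time hT (J' W) (J W)] with t ht
    rw [sub_apply, ht, add_sub_cancel]
  have hm : ∀ J : ParaOp, AEStronglyMeasurable (J W) (timeMeasure T) := fun J =>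
    (Lp.aestronglyMeasurable _).mono_measure (timeMeasure_mono hT)
  rw [eLpNorm_congr_ae h1, ENNReal.ofReal_add hK hK', add_mul]
  exact (eLpNorm_add_le (hm J) (hm _) (by simp)).trans (add_le_add (h W hW) (h' W hW))

end CausalOperators

/-! ### The abstract system -/

section AbstractSystem

/-- The space of the values `(x, y, ψ, q)` of the unknowns and of the stochastic objects. -/
abbrev Phase : Type := LpT 2 × LpT 2 × LpT ∞ × LpT ∞

/-- The nonlinearities of the system, expressed in terms of unknowns in `L²`. -/
structure Model where
  FX : Phase → LpT 2 → LpT 2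
  FY : Phase → LpT 2 → LpT 2
  Fc : Phase → LpT 2 → LpT 2
  w : Phase → LpT 2 → LpT 2
  m : Phase → LpT 2 → ℝ
  res : LpT 2 →L[ℝ] LpT ∞ →L[ℝ] LpT 2
  emb : LpT 2 →L[ℝ] LpT 2
  tame_FX : Tame 1 FX
  tame_FY : Tame 1 FY
  tame_Fc : Tame 1 Fc
  tame_w : Tame 0 w
  tame_m : Tame 1 m

/-- Enhanced data, expressed in terms of elements of `L²` and `L^∞`. -/
structure ModelData where
  x₀ : LpT 2
  x₁ : LpT 2
  y₀ : LpT 2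
  y₁ : LpT 2
  ψ : ℝ → LpT ∞
  q : ℝ → LpT ∞
  k : ℝ × ℝ → LpT 2
  J : ParaOp

/-- The unknowns `(x, y, r)`. -/
structure Unknowns where
  x : ℝ → LpT 2
  y : ℝ → LpT 2
  r : ℝ → LpT 2

/-- Continuity and measurability of the data on `[0, T]`. -/
structure ModelData.Regular (T : ℝ) (d : ModelData) : Prop where
  ψ : ContinuousOn d.ψ (Icc 0 T)
  q : ContinuousOn d.q (Icc 0 T)
  k : AEStronglyMeasurable d.k (volume.restrict (triangle T))
  J : Causal d.J

/-- The distance of two data on `[0, T]` is at most `δ`. -/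
structure ModelData.Close (T δ : ℝ) (d d' : ModelData) : Prop where
  x₀ : ‖d.x₀ - d'.x₀‖ ≤ δ
  x₁ : ‖d.x₁ - d'.x₁‖ ≤ δ
  y₀ : ‖d.y₀ - d'.y₀‖ ≤ δ
  y₁ : ‖d.y₁ - d'.y₁‖ ≤ δ
  ψ : ∀ t ∈ Icc 0 T, ‖d.ψ t - d'.ψ t‖ ≤ δ
  q : ∀ t ∈ Icc 0 T, ‖d.q t - d'.q t‖ ≤ δ
  k : KernelBound T δ fun z => d.k z - d'.k z
  J : JBound T δ (d.J - d'.J)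

/-- The zero data. -/
noncomputable def ModelData.zero : ModelData := ⟨0, 0, 0, 0, 0, 0, 0, 0⟩

lemma ModelData.zero_regular (T : ℝ) : ModelData.zero.Regular T where
  ψ := continuousOn_const
  q := continuousOn_const
  k := aestronglyMeasurable_const
  J := causal_zero

/-- Continuity and integrability of the unknowns on `[0, T]`. -/
structure Unknowns.Regular (T : ℝ) (u : Unknowns) : Prop where
  x : ContinuousOn u.x (Icc 0 T)
  y : ContinuousOn u.y (Icc 0 T)
  r : MemLp u.r 3 (timeMeasure T)

/-- The distance of the unknowns on `[0, T]` is at most `δ`. -/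
structure Unknowns.Close (T δ : ℝ) (u u' : Unknowns) : Prop where
  x : ∀ t ∈ Icc 0 T, ‖u.x t - u'.x t‖ ≤ δ
  y : ∀ t ∈ Icc 0 T, ‖u.y t - u'.y t‖ ≤ δ
  r : eLpNorm (fun t => u.r t - u'.r t) 3 (timeMeasure T) ≤ ENNReal.ofReal δ

/-- The zero unknowns. -/
noncomputable def Unknowns.zero : Unknowns := ⟨0, 0, 0⟩

lemma Unknowns.zero_regular (T : ℝ) : Unknowns.zero.Regular T where
  x := continuousOn_const
  y := continuousOn_const
  r := MemLp.zero

/-- The path of the unknowns and of the data in the phase space. -/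
def path (d : ModelData) (u : Unknowns) (t : ℝ) : Phase := (u.x t, u.y t, d.ψ t, d.q t)

variable {T τ : ℝ} {d d' : ModelData} {u u' : Unknowns}

lemma continuousOn_path (hd : d.Regular T) (hu : u.Regular T) :
    ContinuousOn (path d u) (Icc 0 T) :=
  hu.x.prodMk (hu.y.prodMk (hd.ψ.prodMk hd.q))

lemma ModelData.Regular.mono (hd : d.Regular T) (h : τ ≤ T) : d.Regular τ :=
  ⟨hd.ψ.mono (Icc_subset_Icc_right h), hd.q.mono (Icc_subset_Icc_right h),
    hd.k.mono_set (triangle_mono h), hd.J⟩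

/-- Points of phase space contain both unknowns and data, so the distances add up to δ₀ + δ. The
data are controlled on all of [0, T], the unknowns only up to τ. -/
lemma pathPair {K δ₀ δ : ℝ} (hδ₀ : 0 ≤ δ₀) (hδ : 0 ≤ δ) (hτ : τ ≤ T)
    (hd : d.Regular T) (hd' : d'.Regular T) (hu : u.Regular T) (hu' : u'.Regular T)
    (hdK : d.Close T K .zero) (hdK' : d'.Close T K .zero) (huK : u.Close τ K .zero)
    (huK' : u'.Close τ K .zero) (hdd : d.Close T δ₀ d') (huu : u.Close τ δ u') :
    PathPair τ K (δ₀ + δ) (path d u) (path d' u') u.r u'.r := by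
  have aux : ∀ {t}, t ∈ Icc 0 τ → t ∈ Icc 0 T := fun ht => ⟨ht.1, ht.2.trans hτ⟩
  have hb : ∀ (d : ModelData) (u : Unknowns), d.Close T K .zero → u.Close τ K .zero →
      ∀ t ∈ Icc 0 τ, ‖path d u t‖ ≤ K := by
    intro d u hd hu t ht
    have h1 := hu.x t ht
    have h2 := hu.y t ht
    have h3 := hd.ψ t (aux ht)
    have h4 := hd.q t (aux ht)
    simp only [Unknowns.zero, ModelData.zero, Pi.zero_apply, sub_zero] at h1 h2 h3 h4
    simp only [path, Prod.norm_def, max_le_iff]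
    exact ⟨h1, h2, h3, h4⟩
  refine ⟨(continuousOn_path hd hu).mono (Icc_subset_Icc_right hτ),
    (continuousOn_path hd' hu').mono (Icc_subset_Icc_right hτ),
    hu.r.1.mono_measure (timeMeasure_mono hτ), hu'.r.1.mono_measure (timeMeasure_mono hτ),
    hb d u hdK huK, hb d' u' hdK' huK', by simpa [Unknowns.zero] using huK.r,
    by simpa [Unknowns.zero] using huK'.r, fun t ht => ?_,
    huu.r.trans (ENNReal.ofReal_le_ofReal (by linarith))⟩
  simp only [path, Prod.norm_def, Prod.mk_sub_mk, max_le_iff]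
  exact ⟨(huu.x t ht).trans (by linarith), (huu.y t ht).trans (by linarith),
    (hdd.ψ t (aux ht)).trans (by linarith), (hdd.q t (aux ht)).trans (by linarith)⟩

namespace Model

variable (M : Model)

/-- The right-hand side of the equation for `r`. -/
noncomputable def stepR (T : ℝ) (d : ModelData) (u : Unknowns) (t : ℝ) : LpT 2 :=
  M.res (convMul waveSym (fun t => M.Fc (path d u t) (u.r t)) t) (d.ψ t)
    + d.J (truncLp T fun t => M.w (path d u t) (u.r t)) t
    - M.emb (kernelInt (fun t => M.m (path d u t) (u.r t)) d.k t)

/-- The right-hand side of the equations. -/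
noncomputable def step (T : ℝ) (d : ModelData) (u : Unknowns) : Unknowns where
  x := waveSol d.x₀ d.x₁ fun t => M.FX (path d u t) (u.r t)
  y := waveSol d.y₀ d.y₁ fun t => M.FY (path d u t) (u.r t)
  r := M.stepR T d u

/-- The velocity of the unknown `x`. -/
noncomputable def velX (d : ModelData) (u : Unknowns) : ℝ → LpT 2 :=
  waveVel d.x₀ d.x₁ fun t => M.FX (path d u t) (u.r t)

/-- The velocity of the unknown `y`. -/
noncomputable def velY (d : ModelData) (u : Unknowns) : ℝ → LpT 2 :=
  waveVel d.y₀ d.y₁ fun t => M.FY (path d u t) (u.r t)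

lemma intervalIntegrable_path {F : Phase → LpT 2 → LpT 2} (hF : Tame 1 F) (hT : 0 ≤ T)
    (hT1 : T ≤ 1) (hd : d.Regular T) (hu : u.Regular T) :
    IntervalIntegrable (fun t => F (path d u t) (u.r t)) volume 0 T := by
  rw [intervalIntegrable_iff_integrableOn_Icc_of_le hT]
  exact hF.integrable hT hT1 (continuousOn_path hd hu) hu.r

lemma memLp_w (hT : 0 ≤ T) (hT1 : T ≤ 1) (hd : d.Regular T) (hu : u.Regular T) :
    MemLp (fun t => M.w (path d u t) (u.r t)) (3 / 2) (timeMeasure T) :=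
  M.tame_w.memLp hT hT1 (continuousOn_path hd hu) hu.r

lemma integrable_m (hT : 0 ≤ T) (hT1 : T ≤ 1) (hd : d.Regular T) (hu : u.Regular T) :
    Integrable (fun t => M.m (path d u t) (u.r t)) (timeMeasure T) :=
  M.tame_m.integrable hT hT1 (continuousOn_path hd hu) hu.r

end Model

/-- From bounds in `L¹` to bounds on the integral. -/
lemma integral_le_of_eLpNorm {f : ℝ → LpT 2} {a t : ℝ} (ht : t ∈ Icc 0 τ) (ha : 0 ≤ a)
    (hf : AEStronglyMeasurable f (timeMeasure τ))
    (h : eLpNorm f 1 (timeMeasure τ) ≤ ENNReal.ofReal a) :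
    ∫ t' in (0 : ℝ)..t, ‖f t'‖ ≤ a := by
  rw [intervalIntegral.integral_of_le ht.1, ← integral_Icc_eq_integral_Ioc]
  have h1 : ∫ t' in Icc 0 t, ‖f t'‖ = (eLpNorm f 1 (timeMeasure t)).toReal := by
    rw [eLpNorm_one_eq_lintegral_enorm]
    exact integral_norm_eq_lintegral_enorm (hf.mono_measure (timeMeasure_mono ht.2))
  rw [h1]
  exact ENNReal.toReal_le_of_le_ofReal ha
    ((eLpNorm_mono_measure _ (timeMeasure_mono ht.2)).trans h)

end AbstractSystem

end HartreeWave

namespace HartreeWave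

/-! ### Difference estimates -/

section Differences

lemma PathPair.memLp {P E : Type*} [NormedAddCommGroup P] [NormedAddCommGroup E] {τ K δ : ℝ}
    {a a' : ℝ → P} {r r' : ℝ → E} (h : PathPair τ K δ a a' r r') :
    MemLp r 3 (timeMeasure τ) := ⟨h.meas, h.rbound.trans_lt ENNReal.ofReal_lt_top⟩

lemma PathPair.intervalIntegrable {P : Type*} [NormedAddCommGroup P] [NormedSpace ℝ P]
    {F : P → LpT 2 → LpT 2} (hF : Tame 1 F) {τ K δ : ℝ} {a a' : ℝ → P} {r r' : ℝ → LpT 2}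
    (h : PathPair τ K δ a a' r r') (hτ : 0 ≤ τ) (hτ1 : τ ≤ 1) {t : ℝ} (ht : t ∈ Icc 0 τ) :
    IntervalIntegrable (fun t => F (a t) (r t)) volume 0 t := by
  refine intervalIntegrable_mono ?_ ht
  rw [intervalIntegrable_iff_integrableOn_Icc_of_le hτ]
  exact hF.integrable hτ hτ1 h.cont h.memLp

/-- Energy estimate for the difference of two solutions. -/
lemma exists_waveSol_sub_le {F : Phase → LpT 2 → LpT 2} (hF : Tame 1 F) {K : ℝ} (hK : 0 ≤ K) :
    ∃ C, 0 ≤ C ∧ ∀ (τ δ : ℝ) (a a' : ℝ → Phase) (r r' : ℝ → LpT 2), 0 ≤ τ → τ ≤ 1 → 0 ≤ δ →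
      PathPair τ K δ a a' r r' → ∀ (x₀ x₁ x₀' x₁' : LpT 2), ∀ t ∈ Icc 0 τ,
      ‖waveSol x₀ x₁ (fun t => F (a t) (r t)) t - waveSol x₀' x₁' (fun t => F (a' t) (r' t)) t‖
        ≤ 4 * (‖x₀ - x₀'‖ + ‖x₁ - x₁'‖) + C * τ ^ (1 / 3 : ℝ) * δ ∧
      ‖waveVel x₀ x₁ (fun t => F (a t) (r t)) t - waveVel x₀' x₁' (fun t => F (a' t) (r' t)) t‖
        ≤ 4 * (‖x₀ - x₀'‖ + ‖x₁ - x₁'‖) + C * τ ^ (1 / 3 : ℝ) * δ := by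
  obtain ⟨C, hC, h⟩ := hF.time_bound hK
  refine ⟨2 * C, by positivity,
    fun τ δ a a' r r' hτ hτ1 hδ hp x₀ x₁ x₀' x₁' t ht => ?_⟩
  have hi := hp.intervalIntegrable hF hτ hτ1 ht
  have hi' := hp.symm.intervalIntegrable hF hτ hτ1 ht
  have h1 := integral_le_of_eLpNorm ht (by positivity)
    ((hF.aestronglyMeasurable hp.cont hp.meas).sub (hF.aestronglyMeasurable hp.cont' hp.meas'))
    (h τ δ a a' r r' hτ hτ1 hδ hp)
  simp only [Pi.sub_apply] at h1
  rw [waveSol_sub hi hi', waveVel_sub hi hi']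
  exact ⟨(norm_waveSol_le ht.1 (hi.sub hi')).trans (by linarith),
    (norm_waveVel_le ht.1 (hi.sub hi')).trans (by linarith)⟩

lemma waveSol_zero_zero (F : ℝ → LpT 2) (t : ℝ) : waveSol 0 0 F t = convMul waveSym F t := by
  simp [waveSol]

lemma eLpNorm_le_of_forall_le {τ c : ℝ} (hτ1 : τ ≤ 1) (hc : 0 ≤ c) {f : ℝ → LpT 2}
    (h : ∀ t ∈ Icc 0 τ, ‖f t‖ ≤ c) : eLpNorm f 3 (timeMeasure τ) ≤ ENNReal.ofReal c := by
  refine (eLpNorm_mono_ae_real ?_).trans (eLpNorm_const_time_le hτ1 hc)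
  filter_upwards [ae_timeMeasure_mem τ] with t ht using h t ht

/-- The resonant product of the Duhamel integral with `ψ`. -/
lemma exists_res_sub_le {F : Phase → LpT 2 → LpT 2} (hF : Tame 1 F) {K : ℝ} (hK : 0 ≤ K)
    (B : LpT 2 →L[ℝ] LpT ∞ →L[ℝ] LpT 2) :
    ∃ C, 0 ≤ C ∧ ∀ (τ δ : ℝ) (a a' : ℝ → Phase) (r r' : ℝ → LpT 2), 0 ≤ τ → τ ≤ 1 → 0 ≤ δ →
      PathPair τ K δ a a' r r' →
      eLpNorm (fun t => B (convMul waveSym (fun t => F (a t) (r t)) t) (a t).2.2.1 -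
        B (convMul waveSym (fun t => F (a' t) (r' t)) t) (a' t).2.2.1) 3 (timeMeasure τ) ≤
        ENNReal.ofReal (C * τ ^ (1 / 3 : ℝ) * δ) := by
  obtain ⟨C, hC, h⟩ := exists_waveSol_sub_le hF hK
  refine ⟨‖B‖ * (2 * (C * K)), by positivity, fun τ δ a a' r r' hτ hτ1 hδ hp => ?_⟩
  refine eLpNorm_le_of_forall_le hτ1 (by positivity) fun t ht => ?_
  -- With zero initial data the wave solution is the bare Duhamel integral. The comparison with the
  -- zero path in the next line bounds the size of the second integral.
  have h1 := (h τ δ a a' r r' hτ hτ1 hδ hp 0 0 0 0 t ht).1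
  have h2 := (h τ K a' _ r' _ hτ hτ1 hK (hp.symm.left hK) 0 0 0 0 t ht).1
  simp only [waveSol_zero_zero, sub_zero, norm_zero, add_zero, mul_zero, zero_add] at h1 h2
  have h0 : convMul waveSym (fun _ => F 0 0) t = 0 := by simp [convMul, hF.zero]
  rw [h0, sub_zero] at h2
  have hψ : ‖(a t).2.2.1‖ ≤ K :=
    ((norm_fst_le _).trans ((norm_snd_le _).trans (norm_snd_le (a t)))).trans (hp.bound t ht)
  have hψ' : ‖(a t).2.2.1 - (a' t).2.2.1‖ ≤ δ :=
    ((norm_fst_le _).trans ((norm_snd_le _).trans (norm_snd_le (a t - a' t)))).trans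
      (hp.diff t ht)
  set D := convMul waveSym (fun t => F (a t) (r t)) t
  set D' := convMul waveSym (fun t => F (a' t) (r' t)) t
  have e1 : B D (a t).2.2.1 - B D' (a' t).2.2.1 =
      B (D - D') (a t).2.2.1 + B D' ((a t).2.2.1 - (a' t).2.2.1) := by
    simp only [map_sub, sub_apply]; abel
  rw [e1]
  calc _ ≤ ‖B‖ * ‖D - D'‖ * ‖(a t).2.2.1‖ + ‖B‖ * ‖D'‖ * ‖(a t).2.2.1 - (a' t).2.2.1‖ :=
        (norm_add_le _ _).trans (add_le_add (B.le_opNorm₂ _ _) (B.le_opNorm₂ _ _))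
    _ ≤ ‖B‖ * (C * τ ^ (1 / 3 : ℝ) * δ) * K + ‖B‖ * (C * τ ^ (1 / 3 : ℝ) * K) * δ := by gcongr
    _ = _ := by ring

/-- On an interval of length at most 1, L^∞ embeds in L³ with constant 1. -/
lemma JBound.nonneg_mul_le {T K τ : ℝ} {J : ParaOp} (h : JBound T K J) (hJ : Causal J)
    (hτ : 0 ≤ τ) (hτT : τ ≤ T) (hT : T ≤ 1) {W : Lp (LpT 2) (3 / 2) (timeMeasure 1)} {b : ℝ}
    (hK : 0 ≤ K) (hW : eLpNorm W (3 / 2) (timeMeasure τ) ≤ ENNReal.ofReal b) :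
    eLpNorm (J W) 3 (timeMeasure τ) ≤ ENNReal.ofReal (K * b) := by
  have hm : AEStronglyMeasurable (J W) (timeMeasure τ) :=
    (Lp.aestronglyMeasurable _).mono_measure (timeMeasure_mono (hτT.trans hT))
  have h1 := eLpNorm_le_eLpNorm_mul_rpow_measure_univ (p := 3) (q := ∞) le_top hm
  refine h1.trans ?_
  rw [ENNReal.ofReal_mul hK, timeMeasure_univ]
  refine (mul_le_of_le_one_right' ?_).trans ((h.causal_bound hJ hτ hτT hT W).trans (by gcongr))
  refine ENNReal.rpow_le_one ?_ (by norm_num)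
  rw [← ENNReal.ofReal_one]
  exact ENNReal.ofReal_le_ofReal (hτT.trans hT)

variable (M : Model)

/-- The difference is split as J(W - W') + (J - J')W'. The inputs are truncated at T although the
estimate is on [0, τ]; causality makes their values after τ irrelevant. -/
lemma Model.exists_J_sub_le {K : ℝ} (hK : 0 ≤ K) :
    ∃ C, 0 ≤ C ∧ ∀ (T τ δ₀ δ : ℝ) (a a' : ℝ → Phase) (r r' : ℝ → LpT 2) (J J' : ParaOp),
      0 ≤ τ → τ ≤ T → T ≤ 1 → 0 ≤ δ₀ → 0 ≤ δ → PathPair τ K (δ₀ + δ) a a' r r' →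
      MemLp (fun t => M.w (a t) (r t)) (3 / 2) (timeMeasure T) →
      MemLp (fun t => M.w (a' t) (r' t)) (3 / 2) (timeMeasure T) →
      Causal J → Causal J' → JBound T K J → JBound T δ₀ (J - J') →
      eLpNorm (fun t => J (truncLp T fun t => M.w (a t) (r t)) t -
        J' (truncLp T fun t => M.w (a' t) (r' t)) t) 3 (timeMeasure τ) ≤
        ENNReal.ofReal (C * τ ^ (1 / 3 : ℝ) * (δ₀ + δ)) := by
  obtain ⟨C, hC, h⟩ := M.tame_w.time_bound_zero hK
  refine ⟨2 * (K * C), by positivity, fun T τ δ₀ δ a a' r r' J J' hτ hτT hT hδ₀ hδ hp hw hw'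
    hJ hJ' hJK hJJ => ?_⟩
  have hτ1 := hτT.trans hT
  set W := truncLp T fun t => M.w (a t) (r t) with hW
  set W' := truncLp T fun t => M.w (a' t) (r' t) with hW'
  have e1 := ae_mono (timeMeasure_mono hτT) (truncLp_ae_eq hT hw)
  have e2 := ae_mono (timeMeasure_mono hτT) (truncLp_ae_eq hT hw')
  have h1 : eLpNorm (W - W' : Lp (LpT 2) (3 / 2) (timeMeasure 1)) (3 / 2) (timeMeasure τ) ≤
      ENNReal.ofReal (C * τ ^ (1 / 3 : ℝ) * (δ₀ + δ)) := by
    refine (eLpNorm_congr_ae ?_).trans_le (h τ (δ₀ + δ) a a' r r' hτ hτ1 (by positivity) hp)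
    filter_upwards [e1, e2, coeFn_sub_time hτ1 W W'] with t f1 f2 f3
    rw [f3, f1, f2]
  have h2 : eLpNorm W' (3 / 2) (timeMeasure τ) ≤ ENNReal.ofReal (C * τ ^ (1 / 3 : ℝ) * K) := by
    have := h τ K a' _ r' _ hτ hτ1 hK (hp.symm.left hK)
    simp only [M.tame_w.zero, sub_zero] at this
    exact (eLpNorm_congr_ae e2).trans_le this
  have h3 := hJK.nonneg_mul_le hJ hτ hτT hT hK h1
  have h4 := hJJ.nonneg_mul_le (hJ.sub hJ') hτ hτT hT hδ₀ h2
  have e3 : ∀ᵐ t ∂timeMeasure τ, J W t - J' W' t = J (W - W') t + (J - J') W' t := by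
    rw [map_sub, sub_apply]
    filter_upwards [coeFn_sub_time hτ1 (J W) (J W'), coeFn_sub_time hτ1 (J W') (J' W')]
      with t f1 f2
    rw [f1, f2]; abel
  have hm : ∀ (J : ParaOp) W, AEStronglyMeasurable (J W) (timeMeasure τ) := fun J W =>
    (Lp.aestronglyMeasurable _).mono_measure (timeMeasure_mono hτ1)
  rw [eLpNorm_congr_ae e3]
  refine (eLpNorm_add_le (hm J _) (hm _ _) (by norm_num)).trans ((add_le_add h3 h4).trans ?_)
  rw [← ENNReal.ofReal_add (by positivity) (by positivity)]
  refine ENNReal.ofReal_le_ofReal ?_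
  have h5 : 0 ≤ K * C * τ ^ (1 / 3 : ℝ) * δ := by positivity
  nlinarith

/-- The kernels contribute no power of τ. The factor τ^{1/3} comes entirely from the L¹ norm of the
taming factor. -/
lemma Model.exists_kernel_sub_le {K : ℝ} (hK : 0 ≤ K) :
    ∃ C, 0 ≤ C ∧ ∀ (τ δ₀ δ : ℝ) (a a' : ℝ → Phase) (r r' : ℝ → LpT 2) (k k' : ℝ × ℝ → LpT 2),
      0 ≤ τ → τ ≤ 1 → 0 ≤ δ₀ → 0 ≤ δ → PathPair τ K (δ₀ + δ) a a' r r' →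
      AEStronglyMeasurable k (volume.restrict (triangle τ)) →
      AEStronglyMeasurable k' (volume.restrict (triangle τ)) →
      KernelBound τ K k → KernelBound τ K k' → KernelBound τ δ₀ (fun z => k z - k' z) →
      eLpNorm (fun t => kernelInt (fun t => M.m (a t) (r t)) k t -
        kernelInt (fun t => M.m (a' t) (r' t)) k' t) 3 (timeMeasure τ) ≤
        ENNReal.ofReal (C * τ ^ (1 / 3 : ℝ) * (δ₀ + δ)) := by
  obtain ⟨C, hC, h⟩ := M.tame_m.time_bound hK
  refine ⟨2 * (C * K), by positivity, fun τ δ₀ δ a a' r r' k k' hτ hτ1 hδ₀ hδ hp hk hk'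
    hkK hkK' hkk => ?_⟩
  have h1 := h τ (δ₀ + δ) a a' r r' hτ hτ1 (by positivity) hp
  have h2 := h τ K a' _ r' _ hτ hτ1 hK (hp.symm.left hK)
  simp only [M.tame_m.zero, sub_zero] at h2
  have hm := M.tame_m.integrable hτ hτ1 hp.cont hp.memLp
  have hm' := M.tame_m.integrable hτ hτ1 hp.cont' hp.symm.memLp
  rw [eLpNorm_congr_ae (kernelInt_sub_ae hm hm' hk hk' hkK hkK')]
  refine (eLpNorm_add_le (aestronglyMeasurable_kernelInt (hm.1.sub hm'.1) hk)
    (aestronglyMeasurable_kernelInt hm'.1 (hk.sub hk')) (by norm_num)).trans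
    ((add_le_add (eLpNorm_kernelInt_le (by positivity) (hm.1.sub hm'.1) hk h1 hkK)
      (eLpNorm_kernelInt_le (by positivity) hm'.1 (hk.sub hk') h2 hkk)).trans ?_)
  rw [← ENNReal.ofReal_add (by positivity) (by positivity)]
  refine ENNReal.ofReal_le_ofReal ?_
  have h5 : 0 ≤ C * K * τ ^ (1 / 3 : ℝ) * δ := by positivity
  nlinarith

variable {T τ : ℝ} {d d' : ModelData} {u u' : Unknowns}

lemma Model.aestronglyMeasurable_stepR (hT : 0 ≤ T) (hT1 : T ≤ 1) (hd : d.Regular T)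
    (hu : u.Regular T) :
    AEStronglyMeasurable (fun t => M.res (convMul waveSym (fun t => M.Fc (path d u t) (u.r t)) t)
      (d.ψ t)) (timeMeasure T) ∧
    AEStronglyMeasurable (d.J (truncLp T fun t => M.w (path d u t) (u.r t))) (timeMeasure T) ∧
    AEStronglyMeasurable (kernelInt (fun t => M.m (path d u t) (u.r t)) d.k) (timeMeasure T) :=
  ⟨ContinuousOn.aestronglyMeasurable_of_isCompact
    ((M.res.continuous.comp_continuousOn (symbolFamily_waveSym.continuousOn_convMul
      (Model.intervalIntegrable_path M.tame_Fc hT hT1 hd hu))).clm_apply hd.ψ) isCompact_Icc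
      measurableSet_Icc,
    (Lp.aestronglyMeasurable _).mono_measure (timeMeasure_mono hT1),
    aestronglyMeasurable_kernelInt (M.integrable_m hT hT1 hd hu).1 hd.k⟩

/-- All hypotheses on a pair of data and unknowns that are to be compared on `[0, τ]`. -/
structure Comparison (T τ K δ₀ δ : ℝ) (d d' : ModelData) (u u' : Unknowns) : Prop where
  τ_nonneg : 0 ≤ τ
  τ_le : τ ≤ T
  T_le : T ≤ 1
  δ₀_nonneg : 0 ≤ δ₀
  δ_nonneg : 0 ≤ δ
  hd : d.Regular T
  hd' : d'.Regular T
  hu : u.Regular T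
  hu' : u'.Regular T
  hdK : d.Close T K .zero
  hdK' : d'.Close T K .zero
  huK : u.Close τ K .zero
  huK' : u'.Close τ K .zero
  hdd : d.Close T δ₀ d'
  huu : u.Close τ δ u'

lemma Comparison.pathPair {K δ₀ δ : ℝ} (h : Comparison T τ K δ₀ δ d d' u u') :
    PathPair τ K (δ₀ + δ) (path d u) (path d' u') u.r u'.r :=
  HartreeWave.pathPair h.δ₀_nonneg h.δ_nonneg h.τ_le h.hd h.hd' h.hu h.hu' h.hdK h.hdK' h.huK
    h.huK' h.hdd h.huu

lemma Model.exists_stepR_sub_le {K : ℝ} (hK : 0 ≤ K) :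
    ∃ C, 0 ≤ C ∧ ∀ (T τ δ₀ δ : ℝ) (d d' : ModelData) (u u' : Unknowns),
      Comparison T τ K δ₀ δ d d' u u' →
      eLpNorm (fun t => M.stepR T d u t - M.stepR T d' u' t) 3 (timeMeasure τ) ≤
        ENNReal.ofReal (C * τ ^ (1 / 3 : ℝ) * (δ₀ + δ)) := by
  obtain ⟨C₁, hC₁, h₁⟩ := exists_res_sub_le M.tame_Fc hK M.res
  obtain ⟨C₂, hC₂, h₂⟩ := M.exists_J_sub_le hK
  obtain ⟨C₃, hC₃, h₃⟩ := M.exists_kernel_sub_le hK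
  refine ⟨C₁ + C₂ + ‖M.emb‖ * C₃, by positivity, fun T τ δ₀ δ d d' u u' h => ?_⟩
  have hp := h.pathPair
  have hτ := h.τ_nonneg
  have hτ1 := h.τ_le.trans h.T_le
  have hT := hτ.trans h.τ_le
  have hδ₀ := h.δ₀_nonneg
  have hδ := h.δ_nonneg
  have a1 := h₁ τ (δ₀ + δ) _ _ _ _ hτ hτ1 (by positivity) hp
  have a2 := h₂ T τ δ₀ δ _ _ _ _ d.J d'.J hτ h.τ_le h.T_le hδ₀ hδ hp
    (M.memLp_w hT h.T_le h.hd h.hu) (M.memLp_w hT h.T_le h.hd' h.hu') h.hd.J h.hd'.J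
    (by simpa [ModelData.zero] using h.hdK.J) h.hdd.J
  have a3 := h₃ τ δ₀ δ _ _ _ _ d.k d'.k hτ hτ1 hδ₀ hδ hp (h.hd.mono h.τ_le).k
    (h.hd'.mono h.τ_le).k
    (by simpa [ModelData.zero] using h.hdK.k.mono h.τ_le le_rfl)
    (by simpa [ModelData.zero] using h.hdK'.k.mono h.τ_le le_rfl) (h.hdd.k.mono h.τ_le le_rfl)
  obtain ⟨m1, m2, m3⟩ := M.aestronglyMeasurable_stepR hT h.T_le h.hd h.hu
  obtain ⟨m1', m2', m3'⟩ := M.aestronglyMeasurable_stepR hT h.T_le h.hd' h.hu'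
  have b1 := (m1.sub m1').mono_measure (timeMeasure_mono h.τ_le)
  have b2 := (m2.sub m2').mono_measure (timeMeasure_mono h.τ_le)
  have b3 := (m3.sub m3').mono_measure (timeMeasure_mono h.τ_le)
  have a3' := (eLpNorm_le_mul_eLpNorm_of_ae_le_mul (μ := timeMeasure τ) (c := ‖M.emb‖)
    (Eventually.of_forall fun t => M.emb.le_opNorm _) 3).trans (mul_le_mul_right a3 _)
  have e : (fun t => M.stepR T d u t - M.stepR T d' u' t) =
      ((fun t => M.res (convMul waveSym (fun t => M.Fc (path d u t) (u.r t)) t) (d.ψ t) -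
        M.res (convMul waveSym (fun t => M.Fc (path d' u' t) (u'.r t)) t) (d'.ψ t)) +
      fun t => d.J (truncLp T fun t => M.w (path d u t) (u.r t)) t -
        d'.J (truncLp T fun t => M.w (path d' u' t) (u'.r t)) t) -
      fun t => M.emb (kernelInt (fun t => M.m (path d u t) (u.r t)) d.k t -
        kernelInt (fun t => M.m (path d' u' t) (u'.r t)) d'.k t) := by
    funext t
    simp only [Model.stepR, Pi.add_apply, Pi.sub_apply, map_sub]
    abel
  rw [e]
  refine (eLpNorm_sub_le (b1.add b2) (M.emb.continuous.comp_aestronglyMeasurable b3)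
    (by norm_num)).trans ((add_le_add ((eLpNorm_add_le b1 b2 (by norm_num)).trans
      (add_le_add a1 a2)) a3').trans ?_)
  rw [← ENNReal.ofReal_mul (norm_nonneg _), ← ENNReal.ofReal_add (by positivity) (by positivity),
    ← ENNReal.ofReal_add (by positivity) (by positivity)]
  exact ENNReal.ofReal_le_ofReal (le_of_eq (by ring))

/-- Difference estimate for one step of the Picard iteration. -/
lemma Model.exists_step_close {K : ℝ} (hK : 0 ≤ K) :
    ∃ C, 0 ≤ C ∧ ∀ (T τ δ₀ δ : ℝ) (d d' : ModelData) (u u' : Unknowns),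
      Comparison T τ K δ₀ δ d d' u u' →
      (M.step T d u).Close τ (8 * δ₀ + C * τ ^ (1 / 3 : ℝ) * (δ₀ + δ)) (M.step T d' u') ∧
      ∀ t ∈ Icc 0 τ,
        ‖M.velX d u t - M.velX d' u' t‖ ≤ 8 * δ₀ + C * τ ^ (1 / 3 : ℝ) * (δ₀ + δ) ∧
        ‖M.velY d u t - M.velY d' u' t‖ ≤ 8 * δ₀ + C * τ ^ (1 / 3 : ℝ) * (δ₀ + δ) := by
  obtain ⟨C₁, hC₁, h₁⟩ := exists_waveSol_sub_le M.tame_FX hK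
  obtain ⟨C₂, hC₂, h₂⟩ := exists_waveSol_sub_le M.tame_FY hK
  obtain ⟨C₃, hC₃, h₃⟩ := M.exists_stepR_sub_le hK
  refine ⟨C₁ + C₂ + C₃, by positivity, fun T τ δ₀ δ d d' u u' h => ?_⟩
  have hp := h.pathPair
  have hτ := h.τ_nonneg
  have hτ1 := h.τ_le.trans h.T_le
  have hδ₀ := h.δ₀_nonneg
  have hδ := h.δ_nonneg
  have a1 := h₁ τ (δ₀ + δ) _ _ _ _ hτ hτ1 (by positivity) hp d.x₀ d.x₁ d'.x₀ d'.x₁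
  have a2 := h₂ τ (δ₀ + δ) _ _ _ _ hτ hτ1 (by positivity) hp d.y₀ d.y₁ d'.y₀ d'.y₁
  have a3 := h₃ T τ δ₀ δ d d' u u' h
  have hx₀ := h.hdd.x₀
  have hx₁ := h.hdd.x₁
  have hy₀ := h.hdd.y₀
  have hy₁ := h.hdd.y₁
  set e := τ ^ (1 / 3 : ℝ) * (δ₀ + δ) with he
  have he0 : 0 ≤ e := by positivity
  simp only [mul_assoc, ← he] at a1 a2 a3 ⊢
  have f1 : 0 ≤ C₁ * e := by positivity
  have f2 : 0 ≤ C₂ * e := by positivity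
  have f3 : 0 ≤ C₃ * e := by positivity
  refine ⟨⟨fun t ht => (a1 t ht).1.trans (by linarith), fun t ht => (a2 t ht).1.trans (by linarith),
    a3.trans (ENNReal.ofReal_le_ofReal (by linarith))⟩, fun t ht =>
    ⟨(a1 t ht).2.trans (by linarith), (a2 t ht).2.trans (by linarith)⟩⟩

end Differences

end HartreeWave

namespace HartreeWave

/-! ### Well-posedness of the abstract system -/

section WellPosedness

variable {T τ : ℝ} {d d' : ModelData} {u u' : Unknowns}

lemma KernelBound.zero {b : ℝ} : KernelBound T b fun _ : ℝ × ℝ => (0 : LpT 2) :=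
  Eventually.of_forall fun _ => by simp

lemma JBound.zero (hT : T ≤ 1) {K : ℝ} : JBound T K 0 := by
  intro W _
  have h : ((0 : ParaOp) W : ℝ → LpT 2) =ᵐ[timeMeasure T] 0 := by
    rw [zero_apply]
    exact ae_mono (timeMeasure_mono hT) (Lp.coeFn_zero _ _ _)
  rw [eLpNorm_congr_ae h]
  simp

lemma ModelData.Close.refl (hT : T ≤ 1) {δ : ℝ} (hδ : 0 ≤ δ) (d : ModelData) :
    d.Close T δ d where
  x₀ := by simpa using hδ
  x₁ := by simpa using hδ
  y₀ := by simpa using hδ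
  y₁ := by simpa using hδ
  ψ _ _ := by simpa using hδ
  q _ _ := by simpa using hδ
  k := by simpa using KernelBound.zero
  J := by simpa using JBound.zero hT

lemma ModelData.Close.mono {δ δ' : ℝ} (h : d.Close T δ d') (hδ : δ ≤ δ') : d.Close T δ' d' where
  x₀ := h.x₀.trans hδ
  x₁ := h.x₁.trans hδ
  y₀ := h.y₀.trans hδ
  y₁ := h.y₁.trans hδ
  ψ t ht := (h.ψ t ht).trans hδ
  q t ht := (h.q t ht).trans hδ
  k := h.k.mono le_rfl hδ
  J := h.J.mono hδ

lemma Unknowns.Close.mono {δ δ' : ℝ} (h : u.Close T δ u') (hδ : δ ≤ δ') : u.Close T δ' u' where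
  x t ht := (h.x t ht).trans hδ
  y t ht := (h.y t ht).trans hδ
  r := h.r.trans (ENNReal.ofReal_le_ofReal hδ)

lemma Unknowns.Close.refl {δ : ℝ} (hδ : 0 ≤ δ) (u : Unknowns) : u.Close T δ u where
  x _ _ := by simpa using hδ
  y _ _ := by simpa using hδ
  r := by simp

lemma Unknowns.Close.add_zero {δ : ℝ} (hδ : 0 ≤ δ) (hu : u.Regular T) (hu' : u'.Regular T)
    (h : u.Close T δ .zero) (h' : u'.Close T δ .zero) : u.Close T (δ + δ) u' where
  x t ht := by
    have h1 := h.x t ht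
    have h2 := h'.x t ht
    simp only [Unknowns.zero, Pi.zero_apply, sub_zero] at h1 h2
    exact (norm_sub_le _ _).trans (add_le_add h1 h2)
  y t ht := by
    have h1 := h.y t ht
    have h2 := h'.y t ht
    simp only [Unknowns.zero, Pi.zero_apply, sub_zero] at h1 h2
    exact (norm_sub_le _ _).trans (add_le_add h1 h2)
  r := by
    have h1 := h.r
    have h2 := h'.r
    simp only [Unknowns.zero, Pi.zero_apply, sub_zero] at h1 h2
    rw [ENNReal.ofReal_add hδ hδ]
    exact (eLpNorm_sub_le hu.r.1 hu'.r.1 (by norm_num)).trans (add_le_add h1 h2)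

lemma Unknowns.Regular.exists_close_zero (hu : u.Regular T) :
    ∃ K, 0 ≤ K ∧ u.Close T K .zero := by
  obtain ⟨K, hK, h⟩ := exists_pathPair_zero (hu.x.prodMk hu.y) hu.r
  refine ⟨K, hK, fun t ht => ?_, fun t ht => ?_, ?_⟩
  · simpa [Unknowns.zero] using (norm_fst_le (u.x t, u.y t)).trans (h.bound t ht)
  · simpa [Unknowns.zero] using (norm_snd_le (u.x t, u.y t)).trans (h.bound t ht)
  · simpa [Unknowns.zero] using h.rbound

variable (M : Model)

/-- Solutions of the abstract system. -/
structure Model.IsSol (T : ℝ) (d : ModelData) (u : Unknowns) : Prop where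
  regular : u.Regular T
  x : ∀ t ∈ Icc 0 T, u.x t = (M.step T d u).x t
  y : ∀ t ∈ Icc 0 T, u.y t = (M.step T d u).y t
  r : ∀ᵐ t ∂timeMeasure T, u.r t = (M.step T d u).r t

variable {M}

/-- The reference point of all a priori bounds: being close to this solution means being bounded. -/
lemma Model.isSol_zero (hT1 : T ≤ 1) : M.IsSol T .zero .zero := by
  have hz : ∀ t, waveSol 0 0 (fun _ => (0 : LpT 2)) t = 0 := fun t => by
    simp [waveSol, convMul]
  have hp : ∀ t, path ModelData.zero Unknowns.zero t = 0 := fun _ => rfl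
  refine ⟨Unknowns.zero_regular T, fun t _ => ?_, fun t _ => ?_, ?_⟩
  · simp only [Model.step, hp]
    simp [Unknowns.zero, ModelData.zero, M.tame_FX.zero, hz]
  · simp only [Model.step, hp]
    simp [Unknowns.zero, ModelData.zero, M.tame_FY.zero, hz]
  · have h : ∀ W, ((0 : ParaOp) W : ℝ → LpT 2) =ᵐ[timeMeasure T] 0 := fun W => by
      rw [zero_apply]
      exact ae_mono (timeMeasure_mono hT1) (Lp.coeFn_zero _ _ _)
    filter_upwards [h (truncLp T fun t => M.w (path .zero .zero t) (Unknowns.zero.r t))]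
      with t ht
    have ht' : (ModelData.zero.J (truncLp T fun t => M.w (path .zero .zero t)
      (Unknowns.zero.r t)) : ℝ → LpT 2) t = 0 := ht
    simp only [Model.step, Model.stepR]
    rw [ht']
    simp [Unknowns.zero, ModelData.zero, kernelInt]

lemma Model.IsSol.close {δ : ℝ} (h : M.IsSol T d u) (h' : M.IsSol T d' u') (hτ : τ ≤ T)
    (hs : (M.step T d u).Close τ δ (M.step T d' u')) : u.Close τ δ u' where
  x t ht := by
    rw [h.x t ⟨ht.1, ht.2.trans hτ⟩, h'.x t ⟨ht.1, ht.2.trans hτ⟩]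
    exact hs.x t ht
  y t ht := by
    rw [h.y t ⟨ht.1, ht.2.trans hτ⟩, h'.y t ⟨ht.1, ht.2.trans hτ⟩]
    exact hs.y t ht
  r := by
    refine (eLpNorm_congr_ae ?_).trans_le hs.r
    filter_upwards [ae_mono (timeMeasure_mono hτ) h.r, ae_mono (timeMeasure_mono hτ) h'.r]
      with t e1 e2
    rw [e1, e2]

/-- Steps preserve regularity. -/
lemma Model.step_regular (hT : 0 ≤ T) (hT1 : T ≤ 1) (hd : d.Regular T) {B : ℝ} (hB : 0 ≤ B)
    (hdB : d.Close T B .zero) (hu : u.Regular T) : (M.step T d u).Regular T := by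
  refine ⟨continuousOn_waveSol (Model.intervalIntegrable_path M.tame_FX hT hT1 hd hu),
    continuousOn_waveSol (Model.intervalIntegrable_path M.tame_FY hT hT1 hd hu), ?_⟩
  obtain ⟨K, hK, huK⟩ := hu.exists_close_zero
  obtain ⟨C, hC, h⟩ := M.exists_stepR_sub_le (K := max B K) (le_max_of_le_left hB)
  have h1 := h T T (max B K) (max B K) d .zero u .zero ⟨hT, le_rfl, hT1, le_max_of_le_left hB,
    le_max_of_le_left hB, hd, ModelData.zero_regular T, hu, Unknowns.zero_regular T,
    hdB.mono (le_max_left _ _), ModelData.Close.refl hT1 (le_max_of_le_left hB) _,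
    huK.mono (le_max_right _ _), Unknowns.Close.refl (le_max_of_le_left hB) _,
    hdB.mono (le_max_left _ _), huK.mono (le_max_right _ _)⟩
  have h0 := (Model.isSol_zero (M := M) hT1).r
  obtain ⟨m1, m2, m3⟩ := M.aestronglyMeasurable_stepR hT hT1 hd hu
  refine ⟨(m1.add m2).sub (M.emb.continuous.comp_aestronglyMeasurable m3), ?_⟩
  refine ((eLpNorm_congr_ae ?_).trans_le h1).trans_lt ENNReal.ofReal_lt_top
  filter_upwards [h0] with t ht
  have ht' : (0 : LpT 2) = M.stepR T .zero .zero t := ht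
  rw [← ht', sub_zero]
  rfl

/-- The size of the unknowns up to time `τ` is controlled by a continuous function. -/
lemma Unknowns.Regular.exists_size (hu : u.Regular T) (hT : 0 ≤ T) :
    ∃ h : ℝ → ℝ, ContinuousOn h (Icc 0 T) ∧ h 0 = max ‖u.x 0‖ ‖u.y 0‖ ∧
      ∀ τ ∈ Icc 0 T, ∀ κ, 0 ≤ κ → (u.Close τ κ .zero ↔ ∀ t ∈ Icc 0 τ, h t ≤ κ) := by
  -- The L³ norm of r on [0, τ]. It depends continuously on τ, as a power of a primitive, so the
  -- size of r can enter a continuity argument although r has no pointwise bound.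
  set g : ℝ → ℝ := fun τ => (∫ t in (0 : ℝ)..τ, ‖u.r t‖ ^ (3 : ℝ)) ^ (3 : ℝ)⁻¹ with hg
  have hint : IntegrableOn (fun t => ‖u.r t‖ ^ (3 : ℝ)) (Icc 0 T) volume := by
    have := hu.r.integrable_norm_rpow (by norm_num) (by norm_num)
    rw [ENNReal.toReal_ofNat] at this
    exact this
  have hgc : ContinuousOn g (Icc 0 T) := by
    have h1 : ContinuousOn (fun τ => ∫ t in (0 : ℝ)..τ, ‖u.r t‖ ^ (3 : ℝ)) (Icc 0 T) := by
      rw [← uIcc_of_le hT] at hint ⊢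
      exact intervalIntegral.continuousOn_primitive_interval hint
    exact h1.rpow_const fun _ _ => Or.inr (by norm_num)
  have hge : ∀ τ ∈ Icc 0 T, eLpNorm u.r 3 (timeMeasure τ) = ENNReal.ofReal (g τ) := by
    intro τ hτ
    rw [(hu.r.mono_measure (timeMeasure_mono hτ.2)).eLpNorm_eq_integral_rpow_norm (by norm_num)
      (by norm_num), hg]
    simp only [ENNReal.toReal_ofNat]
    rw [intervalIntegral.integral_of_le hτ.1, ← integral_Icc_eq_integral_Ioc, timeMeasure]
  have hg0 : ∀ τ ∈ Icc 0 T, 0 ≤ g τ := fun τ hτ =>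
    Real.rpow_nonneg (intervalIntegral.integral_nonneg hτ.1 fun t _ => by positivity) _
  refine ⟨fun t => max (max ‖u.x t‖ ‖u.y t‖) (g t), (hu.x.norm.sup hu.y.norm).sup hgc, ?_, ?_⟩
  · have : g 0 = 0 := by simp [hg]
    simp [this]
  · intro τ hτ κ hκ
    constructor
    · intro h t ht
      have ht' : t ∈ Icc 0 T := ⟨ht.1, ht.2.trans hτ.2⟩
      have h1 := h.x t ht
      have h2 := h.y t ht
      have h3 := h.r
      simp only [Unknowns.zero, Pi.zero_apply, sub_zero] at h1 h2 h3
      refine max_le (max_le h1 h2) ?_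
      have h4 := (eLpNorm_mono_measure u.r (timeMeasure_mono ht.2)).trans h3
      rw [hge t ht', ENNReal.ofReal_le_ofReal_iff hκ] at h4
      exact h4
    · intro h
      refine ⟨fun t ht => ?_, fun t ht => ?_, ?_⟩
      · simpa [Unknowns.zero] using
          ((le_max_left _ _).trans (le_max_left _ _)).trans (h t ht)
      · simpa [Unknowns.zero] using
          ((le_max_right _ _).trans (le_max_left _ _)).trans (h t ht)
      · simp only [Unknowns.zero, Pi.zero_apply, sub_zero]
        change eLpNorm u.r 3 (timeMeasure τ) ≤ _
        rw [hge τ hτ]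
        exact ENNReal.ofReal_le_ofReal ((le_max_right _ _).trans (h τ ⟨hτ.1, le_rfl⟩))

/-- A continuity argument. -/
lemma forall_le_of_bootstrap {h : ℝ → ℝ} {R K : ℝ} (hc : ContinuousOn h (Icc 0 T)) (hRK : R < K)
    (h0 : h 0 ≤ R)
    (hb : ∀ τ ∈ Icc 0 T, (∀ t ∈ Icc 0 τ, h t ≤ K) → ∀ t ∈ Icc 0 τ, h t ≤ R) :
    ∀ t ∈ Icc 0 T, h t ≤ K := by
  by_contra hcon
  push Not at hcon
  obtain ⟨t₁, ht₁, hK⟩ := hcon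
  have hivt : ∀ t ∈ Icc 0 T, K < h t → ∃ s ∈ Icc 0 t, h s = K := by
    intro t ht hKt
    obtain ⟨s, hs, hs'⟩ := intermediate_value_Icc ht.1 (hc.mono (Icc_subset_Icc_right ht.2))
      (show K ∈ Icc (h 0) (h t) from ⟨(h0.trans_lt hRK).le, hKt.le⟩)
    exact ⟨s, hs, hs'⟩
  set S := Icc 0 T ∩ h ⁻¹' {K} with hS
  have hSc : IsCompact S :=
    isCompact_Icc.of_isClosed_subset (hc.preimage_isClosed_of_isClosed isClosed_Icc
      isClosed_singleton) inter_subset_left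
  obtain ⟨s, hs, hs'⟩ := hivt t₁ ht₁ hK
  -- t₀ is the first time at which h reaches K. Up to t₀ the bound K holds, so the hypothesis
  -- improves it to R < K at t₀ itself.
  obtain ⟨t₀, ht₀, hmin⟩ := hSc.exists_isLeast ⟨s, ⟨hs.1, hs.2.trans ht₁.2⟩, hs'⟩
  have h1 := hb t₀ ht₀.1 (fun t ht => by
    by_contra hlt
    push Not at hlt
    have htT : t ∈ Icc 0 T := ⟨ht.1, ht.2.trans ht₀.1.2⟩
    obtain ⟨s, hs, hs'⟩ := hivt t htT hlt
    have h2 := hmin ⟨⟨hs.1, hs.2.trans htT.2⟩, hs'⟩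
    have h3 : t = t₀ := le_antisymm ht.2 (h2.trans hs.2)
    have h4 : h t₀ = K := ht₀.2
    rw [h3, h4] at hlt
    exact lt_irrefl _ hlt) t₀ ⟨ht₀.1.1, le_rfl⟩
  have h4 : h t₀ = K := ht₀.2
  linarith

/-- At time 0 the forces contribute nothing, so for data bounded by B the size is at most 8B. This
starts the continuity argument. -/
lemma Model.step_zero_time (d : ModelData) (u : Unknowns) :
    ‖(M.step T d u).x 0‖ ≤ 4 * (‖d.x₀‖ + ‖d.x₁‖) ∧
    ‖(M.step T d u).y 0‖ ≤ 4 * (‖d.y₀‖ + ‖d.y₁‖) :=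
  ⟨(norm_waveSol_le le_rfl (by simp)).trans (by simp),
    (norm_waveSol_le le_rfl (by simp)).trans (by simp)⟩

/-- Lower bound on the existence time. -/
lemma exists_time {C L : ℝ} (hC : 0 ≤ C) (hL : 0 ≤ L) : ∃ T, 0 < T ∧ T ≤ 1 ∧
    ∀ τ, 0 ≤ τ → τ ≤ T → C * τ ^ (1 / 3 : ℝ) * L ≤ 1 ∧ C * τ ^ (1 / 3 : ℝ) ≤ 1 / 2 := by
  -- Chosen so that C c ≤ 1/2 and C c L ≤ 1 hold together; T ≤ c³ then gives τ^{1/3} ≤ c.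
  set c : ℝ := 1 / (2 * (C + 1) * (L + 1)) with hc
  have hc0 : 0 < c := by positivity
  refine ⟨min 1 (c ^ 3), by positivity, min_le_left _ _, fun τ hτ hτT => ?_⟩
  have h1 : τ ^ (1 / 3 : ℝ) ≤ c := by
    calc τ ^ (1 / 3 : ℝ) ≤ (c ^ 3) ^ (1 / 3 : ℝ) :=
          Real.rpow_le_rpow hτ (hτT.trans (min_le_right _ _)) (by norm_num)
      _ = c := by
          rw [← Real.rpow_natCast, ← Real.rpow_mul hc0.le]; norm_num
  have h2 : c * (2 * (C + 1) * (L + 1)) = 1 := by rw [hc]; field_simp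
  have h3 : 0 ≤ c * C := by positivity
  have h4 : 0 ≤ c * L := by positivity
  have h5 : 0 ≤ c * C * L := by positivity
  constructor
  · calc C * τ ^ (1 / 3 : ℝ) * L ≤ C * c * L := by gcongr
      _ ≤ 1 := by nlinarith
  · calc C * τ ^ (1 / 3 : ℝ) ≤ C * c := by gcongr
      _ ≤ 1 / 2 := by nlinarith

/-- The contraction estimate, for data that are bounded by `B` and unknowns that are bounded
by `K = 2 R` with `R = 8 B + 1`. -/
structure Model.Contracts (M : Model) (T B : ℝ) : Prop where
  step_bound : ∀ τ d u, τ ∈ Icc 0 T → d.Regular T → u.Regular T → d.Close T B .zero →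
    u.Close τ (2 * (8 * B + 1)) .zero → (M.step T d u).Close τ (8 * B + 1) (M.step T .zero .zero)
  step_sub : ∀ δ₀ δ d d' u u', 0 ≤ δ₀ → 0 ≤ δ → d.Regular T → d'.Regular T → u.Regular T →
    u'.Regular T → d.Close T B .zero → d'.Close T B .zero → u.Close T (2 * (8 * B + 1)) .zero →
    u'.Close T (2 * (8 * B + 1)) .zero → d.Close T δ₀ d' → u.Close T δ u' →
    (M.step T d u).Close T (9 * δ₀ + δ / 2) (M.step T d' u') ∧
      ∀ t ∈ Icc 0 T, ‖M.velX d u t - M.velX d' u' t‖ ≤ 9 * δ₀ + δ / 2 ∧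
        ‖M.velY d u t - M.velY d' u' t‖ ≤ 9 * δ₀ + δ / 2

/-- The step estimate 8δ₀ + Cτ^{1/3}(δ₀ + δ) is used twice. Against zero, with δ₀ = B and δ = K, it
is at most 8B + 1 once Cτ^{1/3}(B + K) ≤ 1. For differences it is at most 9δ₀ + δ/2 once Cτ^{1/3} ≤
1/2. -/
lemma Model.exists_contracts (M : Model) {B : ℝ} (hB : 0 ≤ B) :
    ∃ T, 0 < T ∧ T ≤ 1 ∧ M.Contracts T B := by
  set K := 2 * (8 * B + 1) with hK
  have hK0 : 0 ≤ K := by positivity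
  have hBK : B ≤ K := by rw [hK]; linarith
  obtain ⟨C, hC, h⟩ := M.exists_step_close hK0
  obtain ⟨T, hT, hT1, hTC⟩ := exists_time hC (show 0 ≤ B + K by positivity)
  refine ⟨T, hT, hT1, ?_, ?_⟩
  · intro τ d u hτ hd hu hdB huK
    have h1 := (h T τ B K d .zero u .zero ⟨hτ.1, hτ.2, hT1, hB, hK0, hd,
      ModelData.zero_regular T, hu, Unknowns.zero_regular T, hdB.mono hBK,
      ModelData.Close.refl hT1 hK0 _, huK, Unknowns.Close.refl hK0 _, hdB, huK⟩).1
    exact h1.mono (by linarith [(hTC τ hτ.1 hτ.2).1])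
  · intro δ₀ δ d d' u u' hδ₀ hδ hd hd' hu hu' hdB hdB' huK huK' hdd huu
    have h1 := h T T δ₀ δ d d' u u' ⟨hT.le, le_rfl, hT1, hδ₀, hδ, hd, hd', hu, hu',
      hdB.mono hBK, hdB'.mono hBK, huK, huK', hdd, huu⟩
    have h2 : 8 * δ₀ + C * T ^ (1 / 3 : ℝ) * (δ₀ + δ) ≤ 9 * δ₀ + δ / 2 := by
      have := mul_le_mul_of_nonneg_right (hTC T hT.le le_rfl).2 (add_nonneg hδ₀ hδ)
      linarith
    exact ⟨h1.1.mono h2, fun t ht => ⟨(h1.2 t ht).1.trans h2, (h1.2 t ht).2.trans h2⟩⟩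

variable {B : ℝ}

/-- Steps map the ball of radius `2 (8 B + 1)` to the ball of radius `8 B + 1`. -/
lemma Model.Contracts.close_zero (h : M.Contracts T B) (hT1 : T ≤ 1) (hτ : τ ∈ Icc 0 T)
    (hd : d.Regular T) (hu : u.Regular T) (hdB : d.Close T B .zero)
    (huK : u.Close τ (2 * (8 * B + 1)) .zero) : (M.step T d u).Close τ (8 * B + 1) .zero := by
  have h1 := h.step_bound τ d u hτ hd hu hdB huK
  have h0 := Model.isSol_zero (M := M) hT1
  have h0r := ae_mono (timeMeasure_mono hτ.2) h0.r
  refine ⟨fun t ht => ?_, fun t ht => ?_, ?_⟩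
  · rw [h0.x t ⟨ht.1, ht.2.trans hτ.2⟩]; exact h1.x t ht
  · rw [h0.y t ⟨ht.1, ht.2.trans hτ.2⟩]; exact h1.y t ht
  · refine (eLpNorm_congr_ae ?_).trans_le h1.r
    filter_upwards [h0r] with t ht
    rw [ht]

/-- A priori bound. -/
lemma Model.IsSol.close_zero (h : M.IsSol T d u) (hc : M.Contracts T B) (hB : 0 ≤ B)
    (hT : 0 ≤ T) (hT1 : T ≤ 1) (hd : d.Regular T) (hdB : d.Close T B .zero) :
    u.Close T (8 * B + 1) .zero := by
  obtain ⟨g, hg, hg0, hgc⟩ := h.regular.exists_size hT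
  -- On every [0, τ] the equation improves the bound 2R to R, where R = 8B + 1.
  have hstep : ∀ τ ∈ Icc 0 T, u.Close τ (2 * (8 * B + 1)) .zero →
      u.Close τ (8 * B + 1) .zero := fun τ hτ hu => by
    have h1 := hc.step_bound τ d u hτ hd h.regular hdB hu
    exact h.close (Model.isSol_zero hT1) hτ.2 h1
  have hR : 0 ≤ 8 * B + 1 := by positivity
  have hK : 0 ≤ 2 * (8 * B + 1) := by positivity
  refine hstep T ⟨hT, le_rfl⟩ ((hgc T ⟨hT, le_rfl⟩ _ hK).2 ?_)
  refine forall_le_of_bootstrap hg (R := 8 * B + 1) (by linarith) ?_ fun τ hτ ht => ?_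
  · have h0 := M.step_zero_time (T := T) d u
    rw [← h.x 0 ⟨le_rfl, hT⟩, ← h.y 0 ⟨le_rfl, hT⟩] at h0
    have e1 := hdB.x₀
    have e2 := hdB.x₁
    have e3 := hdB.y₀
    have e4 := hdB.y₁
    simp only [ModelData.zero, sub_zero] at e1 e2 e3 e4
    rw [hg0]
    exact max_le (by linarith [h0.1]) (by linarith [h0.2])
  · exact (hgc τ hτ _ hR).1 (hstep τ hτ ((hgc τ hτ _ hK).2 ht))

/-- Lipschitz dependence on the data. -/
lemma Model.IsSol.close_of_close (h : M.IsSol T d u) (h' : M.IsSol T d' u')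
    (hc : M.Contracts T B) (hB : 0 ≤ B) (hT : 0 ≤ T) (hT1 : T ≤ 1) (hd : d.Regular T)
    (hd' : d'.Regular T) (hdB : d.Close T B .zero) (hdB' : d'.Close T B .zero) {δ₀ : ℝ}
    (hδ₀ : 0 ≤ δ₀) (hdd : d.Close T δ₀ d') :
    u.Close T (18 * δ₀) u' ∧ ∀ t ∈ Icc 0 T, ‖M.velX d u t - M.velX d' u' t‖ ≤ 18 * δ₀ ∧
        ‖M.velY d u t - M.velY d' u' t‖ ≤ 18 * δ₀ := by
  have hR : 0 ≤ 8 * B + 1 := by positivity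
  have hu := h.close_zero hc hB hT hT1 hd hdB
  have hu' := h'.close_zero hc hB hT hT1 hd' hdB'
  have hstep : ∀ δ, 0 ≤ δ → u.Close T δ u' → _ := fun δ hδ huu =>
    hc.step_sub δ₀ δ d d' u u' hδ₀ hδ hd hd' h.regular h'.regular hdB hdB'
      (hu.mono (by linarith)) (hu'.mono (by linarith)) hdd huu
  -- The equation improves a bound δ on the difference to 9δ₀ + δ/2. Iterating from the crude bound
  -- 2R leads to the fixed point 18δ₀.
  have hit : ∀ n : ℕ, u.Close T (18 * δ₀ + 2 * (8 * B + 1) * (1 / 2) ^ n) u' := by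
    intro n
    induction n with
    | zero => exact (hu.add_zero hR h.regular h'.regular hu').mono (by simp; linarith)
    | succ n ih =>
      refine (h.close h' le_rfl (hstep _ (by positivity) ih).1).mono (le_of_eq ?_)
      rw [pow_succ]; ring
  have hlim : Tendsto (fun n : ℕ => 18 * δ₀ + 2 * (8 * B + 1) * (1 / 2 : ℝ) ^ n) atTop
      (𝓝 (18 * δ₀)) := by
    have := (tendsto_pow_atTop_nhds_zero_of_lt_one (r := (1 / 2 : ℝ)) (by norm_num)
      (by norm_num)).const_mul (2 * (8 * B + 1))
    simpa using this.const_add (18 * δ₀)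
  have huu : u.Close T (18 * δ₀) u' :=
    ⟨fun t ht => ge_of_tendsto' hlim fun n => (hit n).x t ht,
      fun t ht => ge_of_tendsto' hlim fun n => (hit n).y t ht,
      ge_of_tendsto' (ENNReal.tendsto_ofReal hlim) fun n => (hit n).r⟩
  refine ⟨huu, fun t ht => ?_⟩
  have h1 := (hstep _ (by positivity) huu).2 t ht
  exact ⟨h1.1.trans (by linarith), h1.2.trans (by linarith)⟩

end WellPosedness

end HartreeWave

namespace HartreeWave

/-! ### Existence -/

section Existence

variable {T : ℝ} {d : ModelData} {M : Model} {B : ℝ}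

/-- The Banach space in which the fixed point is found. -/
abbrev SolSpace (T : ℝ) : Type :=
  C(Icc (0 : ℝ) T, LpT 2) × C(Icc (0 : ℝ) T, LpT 2) × Lp (LpT 2) 3 (timeMeasure T)

instance factOneLeThree : Fact ((1 : ℝ≥0∞) ≤ 3) := ⟨by norm_num⟩

/-- The unknowns given by an element of the solution space. -/
noncomputable def SolSpace.unknowns (hT : 0 ≤ T) (z : SolSpace T) : Unknowns where
  x := IccExtend hT z.1
  y := IccExtend hT z.2.1
  r := z.2.2

lemma SolSpace.regular (hT : 0 ≤ T) (z : SolSpace T) : (SolSpace.unknowns hT z).Regular T where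
  x := z.1.continuous.Icc_extend'.continuousOn
  y := z.2.1.continuous.Icc_extend'.continuousOn
  r := Lp.memLp _

lemma SolSpace.close (hT : 0 ≤ T) (z z' : SolSpace T) :
    (SolSpace.unknowns hT z).Close T (dist z z') (SolSpace.unknowns hT z') where
  x t _ := by
    rw [← dist_eq_norm]
    exact (ContinuousMap.dist_apply_le_dist _).trans (le_max_left _ _)
  y t _ := by
    rw [← dist_eq_norm]
    exact (ContinuousMap.dist_apply_le_dist _).trans
      ((le_max_left _ _).trans (le_max_right _ _))
  r := by
    have h1 : dist z.2.2 z'.2.2 ≤ dist z z' := (le_max_right _ _).trans (le_max_right _ _)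
    refine le_trans (le_of_eq ?_) (ENNReal.ofReal_le_ofReal h1)
    rw [dist_eq_norm, Lp.norm_def, ENNReal.ofReal_toReal (Lp.eLpNorm_ne_top _)]
    exact eLpNorm_congr_ae (Lp.coeFn_sub _ _).symm

lemma SolSpace.close_zero (hT : 0 ≤ T) {z : SolSpace T} {K : ℝ} (hz : ‖z‖ ≤ K) :
    (SolSpace.unknowns hT z).Close T K .zero := by
  have h := SolSpace.close hT z 0
  rw [dist_zero_right] at h
  refine ⟨fun t ht => (h.x t ht).trans hz, fun t ht => (h.y t ht).trans hz, ?_⟩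
  refine (eLpNorm_congr_ae ?_).trans_le (h.r.trans (ENNReal.ofReal_le_ofReal hz))
  filter_upwards [Lp.coeFn_zero (LpT 2) 3 (timeMeasure T)] with t ht
  simp only [SolSpace.unknowns, Unknowns.zero, Pi.zero_apply]
  rw [show ((0 : SolSpace T).2.2 : ℝ → LpT 2) t = 0 from ht]

/-- The element of the solution space given by regular unknowns. -/
noncomputable def Unknowns.Regular.toSpace {u : Unknowns} (hu : u.Regular T) : SolSpace T :=
  (⟨(Icc 0 T).domRestrict u.x, hu.x.domRestrict⟩, ⟨(Icc 0 T).domRestrict u.y, hu.y.domRestrict⟩, hu.r.toLp)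

lemma Unknowns.Regular.dist_toSpace_le {u u' : Unknowns} (hu : u.Regular T) (hu' : u'.Regular T)
    {δ : ℝ} (hδ : 0 ≤ δ) (h : u.Close T δ u') : dist hu.toSpace hu'.toSpace ≤ δ := by
  refine max_le ?_ (max_le ?_ ?_)
  · refine (ContinuousMap.dist_le hδ).2 fun t => ?_
    rw [dist_eq_norm]; exact h.x t t.2
  · refine (ContinuousMap.dist_le hδ).2 fun t => ?_
    rw [dist_eq_norm]; exact h.y t t.2
  · change dist hu.r.toLp hu'.r.toLp ≤ δ
    rw [dist_edist, Lp.edist_toLp_toLp]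
    exact ENNReal.toReal_le_of_le_ofReal hδ h.r

lemma Unknowns.Regular.norm_toSpace_le {u : Unknowns} (hu : u.Regular T) {δ : ℝ} (hδ : 0 ≤ δ)
    (h : u.Close T δ .zero) : ‖hu.toSpace‖ ≤ δ := by
  refine le_trans (le_of_eq ?_) (hu.dist_toSpace_le (Unknowns.zero_regular T) hδ h)
  have h0 : (Unknowns.zero_regular T).toSpace = 0 := by
    refine Prod.ext rfl (Prod.ext rfl ?_)
    exact MemLp.toLp_zero (Unknowns.zero_regular T).r
  rw [h0, dist_zero_right]

/-- Existence of a solution. -/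
lemma Model.Contracts.exists_isSol (hc : M.Contracts T B) (hB : 0 ≤ B) (hT : 0 ≤ T) (hT1 : T ≤ 1)
    (hd : d.Regular T) (hdB : d.Close T B .zero) : ∃ u, M.IsSol T d u := by
  have hreg : ∀ z : SolSpace T, (M.step T d (SolSpace.unknowns hT z)).Regular T := fun z =>
    Model.step_regular hT hT1 hd hB hdB (SolSpace.regular hT z)
  set Γ : SolSpace T → SolSpace T := fun z => (hreg z).toSpace with hΓ
  set K := 2 * (8 * B + 1) with hK
  have hK0 : 0 ≤ K := by positivity
  have hmaps : MapsTo Γ (Metric.closedBall 0 K) (Metric.closedBall 0 K) := by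
    intro z hz
    rw [mem_closedBall_zero_iff] at hz ⊢
    exact (hreg z).norm_toSpace_le hK0 ((hc.close_zero hT1 ⟨hT, le_rfl⟩ hd (SolSpace.regular hT z)
      hdB (SolSpace.close_zero hT hz)).mono (by linarith))
  have hcontr : ContractingWith (1 / 2) (hmaps.restrict Γ _ _) := by
    refine ⟨by norm_num, LipschitzWith.of_dist_le_mul fun z z' => ?_⟩
    have hz := z.2
    have hz' := z'.2
    rw [mem_closedBall_zero_iff] at hz hz'
    -- Both unknowns have the same data, so δ₀ = 0 and only the contraction factor 1/2 remains.
    have h1 := (hc.step_sub 0 (dist z.1 z'.1) d d _ _ le_rfl dist_nonneg hd hd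
      (SolSpace.regular hT z.1) (SolSpace.regular hT z'.1) hdB hdB
      (SolSpace.close_zero hT hz) (SolSpace.close_zero hT hz')
      (ModelData.Close.refl hT1 le_rfl d) (SolSpace.close hT z.1 z'.1)).1
    have h2 := (hreg z.1).dist_toSpace_le (hreg z'.1) (by positivity) h1
    refine h2.trans (le_of_eq ?_)
    rw [Subtype.dist_eq]
    push_cast
    ring
  obtain ⟨z, -, hz, -⟩ := ContractingWith.exists_fixedPoint' Metric.isClosed_closedBall.isComplete
    hmaps hcontr (x := 0) (Metric.mem_closedBall_self hK0) (edist_ne_top _ _)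
  have hz' : (hreg z).toSpace = z := hz
  refine ⟨SolSpace.unknowns hT z, SolSpace.regular hT z, fun t ht => ?_, fun t ht => ?_, ?_⟩
  · have h1 : (hreg z).toSpace.1 ⟨t, ht⟩ = z.1 ⟨t, ht⟩ := by rw [hz']
    exact (IccExtend_of_mem hT _ ht).trans h1.symm
  · have h1 : (hreg z).toSpace.2.1 ⟨t, ht⟩ = z.2.1 ⟨t, ht⟩ := by rw [hz']
    exact (IccExtend_of_mem hT _ ht).trans h1.symm
  · have h1 : (hreg z).toSpace.2.2 = z.2.2 := by rw [hz']
    filter_upwards [(hreg z).r.coeFn_toLp] with t ht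
    rw [← ht]
    change z.2.2 t = _
    rw [← h1]
    rfl

/-- Well-posedness of the abstract system. -/
theorem Model.exists_wellPosed (M : Model) (hB : 0 ≤ B) : ∃ T, 0 < T ∧ T ≤ 1 ∧
    (∀ d : ModelData, d.Regular T → d.Close T B .zero → ∃ u, M.IsSol T d u) ∧
    ∀ (d d' : ModelData) (u u' : Unknowns) (δ : ℝ), 0 ≤ δ → d.Regular T → d'.Regular T →
      d.Close T B .zero → d'.Close T B .zero → d.Close T δ d' → M.IsSol T d u →
      M.IsSol T d' u' → u.Close T (18 * δ) u' ∧ ∀ t ∈ Icc 0 T,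
        ‖M.velX d u t - M.velX d' u' t‖ ≤ 18 * δ ∧ ‖M.velY d u t - M.velY d' u' t‖ ≤ 18 * δ := by
  obtain ⟨T, hT, hT1, hc⟩ := M.exists_contracts hB
  exact ⟨T, hT, hT1, fun d hd hdB => hc.exists_isSol hB hT.le hT1 hd hdB,
    fun d d' u u' δ hδ hd hd' hdB hdB' hdd hu hu' =>
      hu.close_of_close hu' hc hB hT.le hT1 hd hd' hdB hdB' hδ hdd⟩

end Existence

end HartreeWave

namespace HartreeWave

/-! ### The focusing system as an instance of the abstract system -/

section Concrete

/-- The embedding of `H^s` into `H^t`, for `t ≤ s`. -/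
noncomputable def embed (s t : ℝ) : LpT 2 →L[ℝ] LpT 2 :=
  multiplier fun n => bracket n ^ (t - s)

lemma bessel_embed {s t : ℝ} (h : t ≤ s) (g : LpT 2) : bessel t (embed s t g) = bessel s g := by
  have hs : IsSymbol 1 fun n => bracket n ^ (t - s) :=
    ⟨fun n => by rw [bracket_neg], fun n => by
      rw [abs_of_nonneg (Real.rpow_nonneg (bracket_pos n).le _)]
      exact Real.rpow_le_one_of_one_le_of_nonpos (one_le_bracket n) (by linarith)⟩
  funext n
  rw [bessel_apply, embed, hs.coef_multiplier, bessel_apply, ← mul_assoc, ← Complex.ofReal_mul,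
    ← Real.rpow_add (bracket_pos n)]
  ring_nf

lemma bessel_inclL2 (s : ℝ) (ψ : LpT ∞) : bessel s (inclL2 ψ) = bessel s ψ := by
  funext n; rw [bessel_apply, bessel_apply, coef_inclL2]

lemma besselConv_bessel (β s : ℝ) {p : ℝ≥0∞} (g : LpT p) :
    besselConv β (bessel s g) = bessel (s + β) g := by
  funext n
  rw [besselConv, bessel_apply, bessel_apply, ← mul_assoc, ← Complex.ofReal_mul,
    ← Real.rpow_add (bracket_pos n)]
  ring_nf

lemma besselConv_add (β : ℝ) (f g : TDist) :
    besselConv β (f + g) = besselConv β f + besselConv β g := by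
  funext n; simp only [besselConv, Pi.add_apply, mul_add]

lemma prodT_comm (f g : TDist) : prodT f g = prodT g f := by
  funext n
  simp only [prodT, bilin]
  rw [← (Equiv.subLeft n).tsum_eq]
  refine tsum_congr fun m => ?_
  simp only [Equiv.subLeft_apply, sub_sub_cancel]
  ring

/-- The full product is the case S = `univ` of the block estimates, because the Littlewood-Paley
symbols sum to 1. -/
lemma prodT_eq_bilin {φ : ℝ → ℝ} (hφ : IsBump φ) (f g : TDist) :
    prodT f g = bilin (pairSymbol φ univ) f g := by
  have h : pairSymbol φ univ = fun _ _ => 1 := by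
    funext n m; exact hφ.pairSymbol_univ n m
  rw [prodT, h]

lemma summable_prodT (f g : LpT 2) (n : Freq) :
    Summable fun m => (((fun _ _ => 1 : Freq → Freq → ℝ) m (n - m) : ℝ) : ℂ) * bessel 0 f m *
      bessel 0 g (n - m) := by
  obtain ⟨_, _, _, h⟩ := exists_hasSum_mul (norm_nonneg f) (norm_nonneg g) (hasSum_coef_sq f)
    (hasSum_coef_sq g) n
  refine Summable.of_norm (h.summable.congr fun m => ?_)
  simp [bessel_apply]

lemma prodT_add_left (f f' g : LpT 2) : prodT (bessel 0 f + bessel 0 f') (bessel 0 g) =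
    prodT (bessel 0 f) (bessel 0 g) + prodT (bessel 0 f') (bessel 0 g) := by
  funext n
  exact bilin_add_left (summable_prodT f g n) (summable_prodT f' g n)

/-- The mean value of a function. -/
noncomputable def meanCLM : LpT 2 →L[ℝ] ℝ := Complex.reCLM.comp (coefCLM 0)

lemma bracket_zero : bracket 0 = 1 := by simp [bracket, freqNorm]

/-- The zeroth coefficient is its own conjugate, so the taming factor is a real scalar. -/
lemma bessel_zero_freq (s : ℝ) (g : LpT 2) : bessel s g 0 = (meanCLM g : ℂ) := by
  rw [bessel_apply, bracket_zero, Real.one_rpow, Complex.ofReal_one, one_mul]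
  have h := coef_neg_freq g 0
  rw [neg_zero] at h
  exact (Complex.conj_eq_iff_re.1 h.symm).symm

lemma outLevel_of_lt {j k : ℕ} (h : j + 2 < k) : outLevel j k = k := if_pos h

lemma outLevel_of_gt {j k : ℕ} (h : k + 2 < j) : outLevel j k = j := by
  rw [outLevel, if_neg (by omega), if_pos h]

/-- Paraproduct estimate. -/
lemma IsBump.exists_paraLow {φ : ℝ → ℝ} (hφ : IsBump φ) {s a b : ℝ} (hs : 0 < s) (hb : 0 ≤ b)
    (hab : a < b) : ∃ T : LpT 2 →L[ℝ] LpT ∞ →L[ℝ] LpT 2, ∀ f ψ,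
      paraLow φ (bessel s f) (bessel (-a) ψ) = bessel (-b) (T f ψ) := by
  -- The output has level k, so the exponent is -s j - (b - a) k, negative in both indices.
  refine hφ.exists_para (κ := min s (b - a)) (C := 0) hb (lt_min hs (by linarith)) ?_
  rintro ⟨j, k⟩ hz
  have hjk : j + 2 < k := hz
  simp only [outLevel_of_lt hjk]
  have h1 : min s (b - a) * j ≤ s * j := by gcongr; exact min_le_left _ _
  have h2 : min s (b - a) * k ≤ (b - a) * k := by gcongr; exact min_le_right _ _
  linarith

/-- Paraproduct estimate. -/
lemma IsBump.exists_paraHigh {φ : ℝ → ℝ} (hφ : IsBump φ) {s a b : ℝ} (hb : 0 ≤ b) (ha : 0 ≤ a)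
    (hab : a < s + b) : ∃ T : LpT 2 →L[ℝ] LpT ∞ →L[ℝ] LpT 2, ∀ f ψ,
      paraHigh φ (bessel s f) (bessel (-a) ψ) = bessel (-b) (T f ψ) := by
  -- The output has level j > k. After a k ≤ a j the gain (s + b - a) j remains, and it is shared
  -- equally between j and k.
  refine hφ.exists_para (κ := (s + b - a) / 2) (C := 0) hb (by linarith) ?_
  rintro ⟨j, k⟩ hz
  have hjk : k + 2 < j := hz
  simp only [outLevel_of_gt hjk]
  have hkj : (k : ℝ) ≤ j := by exact_mod_cast (show k ≤ j by omega)
  nlinarith [mul_le_mul_of_nonneg_left hkj ha,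
    mul_le_mul_of_nonneg_left hkj (show 0 ≤ (s + b - a) / 2 by linarith)]

/-- Resonant product estimate. -/
lemma IsBump.exists_resonant {φ : ℝ → ℝ} (hφ : IsBump φ) {s a : ℝ} (ha : 0 ≤ a)
    (hab : a < s) : ∃ T : LpT 2 →L[ℝ] LpT ∞ →L[ℝ] LpT 2, ∀ f ψ,
      resonant φ (bessel s f) (bessel (-a) ψ) = bessel 0 (T f ψ) := by
  rw [← neg_zero]
  -- The output level is 0, so only k ≤ j + 2 helps; the offset 2 accounts for the constant C.
  refine hφ.exists_para (κ := (s - a) / 2) (C := 2 * a + (s - a)) le_rfl (by linarith) ?_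
  rintro ⟨j, k⟩ hz
  have hjk : k ≤ j + 2 := hz.2
  simp only [zero_mul, sub_zero]
  have hkj : (k : ℝ) ≤ j + 2 := by exact_mod_cast hjk
  nlinarith [mul_le_mul_of_nonneg_left hkj ha,
    mul_le_mul_of_nonneg_left hkj (show 0 ≤ (s - a) / 2 by linarith)]

/-- Product estimate. -/
lemma IsBump.exists_prodT_top {φ : ℝ → ℝ} (hφ : IsBump φ) {s a b : ℝ} (hs : 0 < s) (hb : 0 ≤ b)
    (ha : 0 ≤ a) (hab : a < b) (has : a < s) : ∃ T : LpT 2 →L[ℝ] LpT ∞ →L[ℝ] LpT 2, ∀ f ψ,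
      prodT (bessel s f) (bessel (-a) ψ) = bessel (-b) (T f ψ) := by
  simp only [prodT_eq_bilin hφ]
  have hκ : 0 < min (min s (b - a)) ((s - a) / 2) :=
    lt_min (lt_min hs (by linarith)) (by linarith)
  refine hφ.exists_para (κ := min (min s (b - a)) ((s - a) / 2)) (C := 2 * a + (s - a)) hb hκ ?_
  rintro ⟨j, k⟩ -
  have h1 : min (min s (b - a)) ((s - a) / 2) ≤ s := (min_le_left _ _).trans (min_le_left _ _)
  have h2 : min (min s (b - a)) ((s - a) / 2) ≤ b - a :=
    (min_le_left _ _).trans (min_le_right _ _)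
  have h3 : min (min s (b - a)) ((s - a) / 2) ≤ (s - a) / 2 := min_le_right _ _
  generalize min (min s (b - a)) ((s - a) / 2) = κ at *
  have hj : (0 : ℝ) ≤ j := j.cast_nonneg
  have hk : (0 : ℝ) ≤ k := k.cast_nonneg
  by_cases hjk : j + 2 < k
  · simp only [outLevel_of_lt hjk]
    nlinarith [mul_le_mul_of_nonneg_right h1 hj, mul_le_mul_of_nonneg_right h2 hk]
  · have hkj : (k : ℝ) ≤ j + 2 := by exact_mod_cast not_lt.1 hjk
    have h4 : 0 ≤ b * outLevel j k := by positivity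
    simp only
    nlinarith [mul_le_mul_of_nonneg_left hkj ha, mul_le_mul_of_nonneg_left hkj hκ.le,
      mul_le_mul_of_nonneg_right h3 (show (0 : ℝ) ≤ 2 * j + 2 by positivity)]

/-- Product with a distribution of positive regularity. -/
lemma IsBump.exists_prodT_smooth {φ : ℝ → ℝ} (hφ : IsBump φ) {s a : ℝ} (hs : 0 < s) (ha : 0 < a) :
    ∃ T : LpT 2 →L[ℝ] LpT ∞ →L[ℝ] LpT 2, ∀ f ψ,
      prodT (bessel s f) (bessel a ψ) = bessel 0 (T f ψ) := by
  simp only [prodT_eq_bilin hφ]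
  have h := hφ.exists_para (S := univ) (s := s) (a := -a) (b := 0) (κ := min s a) (C := 0) le_rfl
    (lt_min hs ha) (by
      rintro ⟨j, k⟩ -
      have hj : (0 : ℝ) ≤ j := j.cast_nonneg
      have hk : (0 : ℝ) ≤ k := k.cast_nonneg
      simp only [zero_mul, sub_zero]
      nlinarith [mul_le_mul_of_nonneg_right (min_le_left s a) hj,
        mul_le_mul_of_nonneg_right (min_le_right s a) hk])
  simpa only [neg_neg, neg_zero] using h

/-- Estimate of the paraproduct with the frequency cutoff. -/
lemma IsBump.exists_paraLowCut {φ : ℝ → ℝ} (hφ : IsBump φ) {θ c₀ ε : ℝ} (hθ : 0 < θ) (hθ1 : θ ≤ 1)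
    (hε : ε ≤ θ / 8) : ∃ T : LpT 2 →L[ℝ] LpT ∞ →L[ℝ] LpT 2, ∀ f ψ,
      paraLowCut φ θ c₀ (bessel (3 / 4) f) (bessel (-(1 / 2 + ε)) ψ) =
        bessel (-(1 / 2 - θ / 4)) (T f ψ) := by
  -- The exponent is -(3/4) j + (ε + θ/4) k. Since θ k ≤ j - c₀ and ε ≤ θ/8, the three quarters of a
  -- derivative on the low factor cover this loss together with κ (j + k), up to a multiple of |c₀|.
  refine hφ.exists_para (κ := θ / 8) (C := |c₀|) (by linarith) (by linarith) ?_
  rintro ⟨j, k⟩ hz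
  have hjk : j + 2 < k := hz.2
  have hc : θ * k + c₀ ≤ j := hz.1
  simp only [outLevel_of_lt hjk]
  have hj : (0 : ℝ) ≤ j := j.cast_nonneg
  have hk : (0 : ℝ) ≤ k := k.cast_nonneg
  nlinarith [mul_le_mul_of_nonneg_right hε hk, mul_le_mul_of_nonneg_right hθ1 hj, abs_nonneg c₀,
    neg_abs_le c₀]

end Concrete

end HartreeWave

namespace HartreeWave

/-! ### Choice of the exponents, and the nonlinearities as a model -/

section ConcreteModel

/-- The relations between the exponents. Here `V * (Q_{X,Y} + 2 𝔑)` is estimated in `H^p`. -/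
structure Admissible (s₁ s₂ s₃ β θ p ε : ℝ) : Prop where
  θ_pos : 0 < θ
  θ_le : θ ≤ 1
  ε_pos : 0 < ε
  ε_le : ε ≤ θ / 8
  s₁_pos : 0 < s₁
  s₁_lt : 1 / 2 + ε < 1 - s₁
  s₁_le : s₁ ≤ s₂
  s₂_gt : 1 / 2 + ε < s₂
  s₂_lt : s₂ < 1
  s₃_neg : s₃ ≤ -ε
  s₃_gt : -(1 / 2) < s₃
  p_ge : 1 ≤ p
  p_lt : 1 / 2 + ε < β - p
  p_lt' : 3 / 2 < β - p + 2 * s₁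
  p_gt : 3 / 2 < 1 - s₂ + p + s₁
  β_ge : 2 ≤ β

/-- The bounds 1/2 - s₁ + s₂ < p and p < β + 2s₁ - 3/2 are compatible exactly when -3s₁ + s₂ + 2 <
β. The inequality 1 < β + 2s₁ - 3/2 uses β ≥ 2 and s₁ > 1/4, and p < 3/2 gives β - p > 1/2. All
remaining strict inequalities leave room for ε, which is chosen last. -/
lemma exists_admissible {s₁ s₂ s₃ β θ : ℝ} (hs₃ : -(1 / 2) < s₃) (hs₃' : s₃ < 0) (hθ : 0 < θ)
    (hθ1 : θ ≤ 1) (hβ : 2 ≤ β) (h1 : 1 / 4 < s₁) (h1' : s₁ < 1 / 2) (h2 : 1 / 2 < s₂)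
    (h2' : s₂ < 1) (hβs : -3 * s₁ + s₂ + 2 < β) : ∃ p ε, Admissible s₁ s₂ s₃ β θ p ε := by
  obtain ⟨p, hp1, hp2⟩ := exists_between
    (show max 1 (1 / 2 - s₁ + s₂) < min (3 / 2) (β + 2 * s₁ - 3 / 2) from
      max_lt (lt_min (by norm_num) (by linarith)) (lt_min (by linarith) (by linarith)))
  rw [max_lt_iff] at hp1
  rw [lt_min_iff] at hp2
  obtain ⟨ε, hε0, hε⟩ := exists_between (show 0 < min (min (θ / 8) (1 / 2 - s₁))
    (min (s₂ - 1 / 2) (min (β - p - 1 / 2) (-s₃))) from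
      lt_min (lt_min (by linarith) (by linarith)) (lt_min (by linarith)
        (lt_min (by linarith) (by linarith))))
  simp only [lt_min_iff] at hε
  obtain ⟨⟨e1, e2⟩, e3, e4, e5⟩ := hε
  exact ⟨p, ε, hθ, hθ1, hε0, e1.le, by linarith, by linarith, by linarith, by linarith, h2',
    by linarith, hs₃, hp1.1.le, by linarith, by linarith, by linarith, hβ⟩

/-- The model `M` represents the focusing system. -/
structure Model.Represents (M : Model) (φ : ℝ → ℝ) (θ c₀ β A γ s₁ s₂ s₃ ε : ℝ) : Prop where
  eqs : ∀ (Ξ : EnhancedData) (u : Triple) (t : ℝ) (z : Phase) (r : LpT 2),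
    Ξ.Ψ t = bessel (-(1 / 2) - ε) z.2.2.1 → Ξ.Ψsq t = bessel (-1 - ε) z.2.2.2 →
    u.X t = bessel s₁ z.1 → u.Y t = bessel s₂ z.2.1 → u.R t = bessel s₃ r →
    besselConv β (wickSquare φ Ξ u t) = bessel 0 (M.w z r) ∧
    forceX φ β A γ Ξ u t = bessel (s₁ - 1) (M.FX z r) ∧
    forceY φ β A γ Ξ u t = bessel (s₂ - 1) (M.FY z r) ∧
    forceCut φ θ c₀ β Ξ u t = bessel (1 / 2 + θ / 4 - 1) (M.Fc z r) ∧
    taming A γ (wickSquare φ Ξ u t) = (M.m z r : ℂ)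
  res : ∀ f ψ, resonant φ (bessel (1 / 2 + θ / 4) f) (bessel (-(1 / 2) - ε) ψ) =
    bessel s₃ (M.res f ψ)
  emb : ∀ k, bessel (-ε) k = bessel s₃ (M.emb k)

/-- The component `x` of the phase space. -/
noncomputable abbrev projX : Phase →L[ℝ] LpT 2 := ContinuousLinearMap.fst ℝ _ _

/-- The component `y` of the phase space. -/
noncomputable abbrev projY : Phase →L[ℝ] LpT 2 :=
  (ContinuousLinearMap.fst ℝ _ _).comp (ContinuousLinearMap.snd ℝ _ _)

/-- The component `ψ` of the phase space. -/
noncomputable abbrev projΨ : Phase →L[ℝ] LpT ∞ :=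
  (ContinuousLinearMap.fst ℝ _ _).comp ((ContinuousLinearMap.snd ℝ _ _).comp
    (ContinuousLinearMap.snd ℝ _ _))

/-- The component `q` of the phase space. -/
noncomputable abbrev projQ : Phase →L[ℝ] LpT ∞ :=
  (ContinuousLinearMap.snd ℝ _ _).comp ((ContinuousLinearMap.snd ℝ _ _).comp
    (ContinuousLinearMap.snd ℝ _ _))

variable {φ : ℝ → ℝ} {θ c₀ β s₁ s₂ s₃ p ε : ℝ}

/-- The sum `X + Y` in `H^{s₁}`. -/
noncomputable def sumXY (s₁ s₂ : ℝ) : Phase →L[ℝ] LpT 2 := projX + (embed s₂ s₁).comp projY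

lemma bessel_sumXY (h : s₁ ≤ s₂) (z : Phase) :
    bessel s₁ (sumXY s₁ s₂ z) = bessel s₁ z.1 + bessel s₂ z.2.1 := by
  simp only [sumXY, add_apply, ContinuousLinearMap.comp_apply, bessel_add, bessel_embed h]
  rfl

lemma neg_half_sub (ε : ℝ) : -(1 / 2) - ε = -(1 / 2 + ε) := by ring

/-- The Wick square without the stochastic part. -/
lemma Admissible.exists_quadratic (h : Admissible s₁ s₂ s₃ β θ p ε) (hφ : IsBump φ) :
    ∃ G : Phase → LpT 2 → LpT 2, Tame 0 G ∧ ∀ z r,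
      prodT (bessel s₁ z.1 + bessel s₂ z.2.1) (bessel s₁ z.1 + bessel s₂ z.2.1)
        + (2 : ℂ) • paraLow φ (bessel s₁ z.1) (bessel (-(1 / 2) - ε) z.2.2.1)
        + (2 : ℂ) • paraHigh φ (bessel s₁ z.1) (bessel (-(1 / 2) - ε) z.2.2.1)
        + (2 : ℂ) • prodT (bessel s₂ z.2.1) (bessel (-(1 / 2) - ε) z.2.2.1)
        + (2 : ℂ) • bessel s₃ r = bessel (-(β - p)) (G z r) := by
  have hε := h.ε_pos
  have hp := h.p_lt
  obtain ⟨T₁, hT₁⟩ := exists_prod h.s₁_pos.le h.s₁_pos.le (show 0 ≤ β - p by linarith)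
    (by linarith [h.p_lt'])
  obtain ⟨T₂, hT₂⟩ := hφ.exists_paraLow h.s₁_pos (show 0 ≤ β - p by linarith) hp
  obtain ⟨T₃, hT₃⟩ := hφ.exists_paraHigh (s := s₁) (show 0 ≤ β - p by linarith)
    (show 0 ≤ 1 / 2 + ε by linarith) (by linarith [h.s₁_pos])
  obtain ⟨T₄, hT₄⟩ := hφ.exists_prodT_top (s := s₂) (by linarith [h.s₂_gt])
    (show 0 ≤ β - p by linarith) (show 0 ≤ 1 / 2 + ε by linarith) hp h.s₂_gt
  have h3 : -(β - p) ≤ s₃ := by linarith [h.s₃_gt]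
  refine ⟨fun z r => T₁ (sumXY s₁ s₂ z) (sumXY s₁ s₂ z) + (2 : ℝ) • T₂ z.1 z.2.2.1
    + (2 : ℝ) • T₃ z.1 z.2.2.1 + (2 : ℝ) • T₄ z.2.1 z.2.2.1
    + (2 : ℝ) • embed s₃ (-(β - p)) r, ?_, fun z r => ?_⟩
  -- The map is quadratic in the phase variables, which are bounded in time, but only linear in r;
  -- hence degree 0.
  · have t1 := (tame_fst (E := LpT 2) (sumXY s₁ s₂)).bilin T₁ (sumXY s₁ s₂)
    have t2 := ((tame_fst (E := LpT 2) projX).bilin T₂ projΨ).clm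
      ((2 : ℝ) • ContinuousLinearMap.id ℝ (LpT 2))
    have t3 := ((tame_fst (E := LpT 2) projX).bilin T₃ projΨ).clm
      ((2 : ℝ) • ContinuousLinearMap.id ℝ (LpT 2))
    have t4 := ((tame_fst (E := LpT 2) projY).bilin T₄ projΨ).clm
      ((2 : ℝ) • ContinuousLinearMap.id ℝ (LpT 2))
    have t5 := tame_snd (P := Phase) ((2 : ℝ) • embed s₃ (-(β - p)))
    exact (((t1.add t2).add t3).add t4).add t5
  · have hs : ∀ g : LpT 2, bessel (-(β - p)) ((2 : ℝ) • g) = (2 : ℂ) • bessel (-(β - p)) g :=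
      fun g => by rw [bessel_smul]; norm_num
    rw [← bessel_sumXY h.s₁_le, hT₁, neg_half_sub, hT₂, hT₃, hT₄, ← bessel_embed h3 r]
    simp only [bessel_add, hs]

/-- The stochastic part V * :Ψ²: is bounded in W^{β-1-ε,∞}, of positive regularity, and is
multiplied by other means than the H^p part. Distributing the product requires convergent sums,
which hold because all factors are in L². -/
lemma prod_split (h : Admissible s₁ s₂ s₃ β θ p ε) (g f : LpT 2) (q : LpT ∞) :
    prodT (bessel p g + bessel (-1 - ε + β) q) (bessel s₁ f) =
      prodT (bessel p g) (bessel s₁ f) + prodT (bessel (-1 - ε + β) q) (bessel s₁ f) := by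
  have h1 := h.p_ge
  have h2 := h.β_ge
  have h3 := h.ε_le
  have h4 := h.θ_le
  rw [← bessel_inclL2, ← bessel_embed (show 0 ≤ p by linarith),
    ← bessel_embed (show 0 ≤ -1 - ε + β by linarith), ← bessel_embed h.s₁_pos.le, prodT_add_left]

lemma ofReal_smul_bessel (c s : ℝ) (g : LpT 2) : (c : ℂ) • bessel s g = bessel s (c • g) :=
  (bessel_smul c g).symm

/-- The right-hand side of the `X`-equation. -/
lemma Admissible.exists_forceX (h : Admissible s₁ s₂ s₃ β θ p ε) (hφ : IsBump φ)
    {V : Phase → LpT 2 → LpT 2} {m : Phase → LpT 2 → ℝ} (tV : Tame 0 V) (tm : Tame 1 m) :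
    ∃ F : Phase → LpT 2 → LpT 2, Tame 1 F ∧ ∀ z r, bessel (s₁ - 1) (F z r) =
      paraLow φ (bessel (3 / 4) (V z r)) (bessel (-(1 / 2 + ε)) z.2.2.1) -
        (m z r : ℂ) • bessel (-(1 / 2 + ε)) z.2.2.1 := by
  have hs := h.s₁_lt
  have hε := h.ε_pos
  obtain ⟨T, hT⟩ := hφ.exists_paraLow (s := 3 / 4) (by norm_num)
    (show 0 ≤ 1 - s₁ by linarith) hs
  set L := (embed (-(1 / 2 + ε)) (s₁ - 1)).comp (inclL2.comp projΨ) with hL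
  refine ⟨fun z r => T (V z r) (projΨ z) - ContinuousLinearMap.lsmul ℝ ℝ (m z r) (L z),
    ((tV.bilin T projΨ).succ).sub (tm.bilin (ContinuousLinearMap.lsmul ℝ ℝ) L), fun z r => ?_⟩
  have h1 : bessel (-(1 / 2 + ε)) z.2.2.1 = bessel (s₁ - 1) (L z) := by
    rw [hL, ContinuousLinearMap.comp_apply, bessel_embed (by linarith),
      ContinuousLinearMap.comp_apply, bessel_inclL2]
    rfl
  rw [hT, h1, ofReal_smul_bessel, neg_sub, ← bessel_sub]
  rfl

/-- The right-hand side of the `Y`-equation. -/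
lemma Admissible.exists_forceY (h : Admissible s₁ s₂ s₃ β θ p ε) (hφ : IsBump φ)
    {G V : Phase → LpT 2 → LpT 2} {m : Phase → LpT 2 → ℝ} (tG : Tame 0 G) (tV : Tame 0 V)
    (tm : Tame 1 m) :
    ∃ F : Phase → LpT 2 → LpT 2, Tame 1 F ∧ ∀ z r, bessel (s₂ - 1) (F z r) =
      prodT (bessel p (G z r) + bessel (-1 - ε + β) z.2.2.2) (bessel s₁ (sumXY s₁ s₂ z)) +
      (paraHigh φ (bessel (3 / 4) (V z r)) (bessel (-(1 / 2 + ε)) z.2.2.1) +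
        resonant φ (bessel (3 / 4) (V z r)) (bessel (-(1 / 2 + ε)) z.2.2.1)) -
        (m z r : ℂ) • bessel s₁ (sumXY s₁ s₂ z) := by
  have hε := h.ε_pos
  have hε8 := h.ε_le
  have hθ1 := h.θ_le
  have hβ := h.β_ge
  have hs₂ := h.s₂_lt
  have ha : 0 ≤ 1 / 2 + ε := by linarith
  obtain ⟨TY, hTY⟩ := exists_prod (s := p) (t := s₁) (u := 1 - s₂) (by linarith [h.p_ge])
    h.s₁_pos.le (by linarith) h.p_gt
  obtain ⟨TQ, hTQ⟩ := hφ.exists_prodT_smooth h.s₁_pos (show 0 < -1 - ε + β by linarith)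
  obtain ⟨TH, hTH⟩ := hφ.exists_paraHigh (s := 3 / 4) le_rfl ha (by linarith)
  obtain ⟨TR, hTR⟩ := hφ.exists_resonant (s := 3 / 4) ha (by linarith)
  set L := (embed s₁ (s₂ - 1)).comp (sumXY s₁ s₂) with hL
  set e := embed 0 (s₂ - 1)
  have he : ∀ g, bessel 0 g = bessel (s₂ - 1) (e g) := fun g =>
    (bessel_embed (by linarith) g).symm
  have t1 := tG.bilin TY (sumXY s₁ s₂)
  have t2 := ((tame_fst (E := LpT 2) (sumXY s₁ s₂)).bilin TQ projQ).clm e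
  have t3 := (tV.bilin TH projΨ).clm e
  have t4 := (tV.bilin TR projΨ).clm e
  have t5 := tm.bilin (ContinuousLinearMap.lsmul ℝ ℝ) L
  refine ⟨_, (((t1.add t2).add (t3.add t4)).succ).sub t5, fun z r => ?_⟩
  have h1 : bessel s₁ (sumXY s₁ s₂ z) = bessel (s₂ - 1) (L z) := by
    rw [hL, ContinuousLinearMap.comp_apply, bessel_embed (by linarith [h.s₁_pos])]
  have h2 : prodT (bessel p (G z r) + bessel (-1 - ε + β) z.2.2.2)
      (bessel s₁ (sumXY s₁ s₂ z)) = bessel (s₂ - 1) (TY (G z r) (sumXY s₁ s₂ z)) +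
        bessel (s₂ - 1) (e (TQ (sumXY s₁ s₂ z) (projQ z))) := by
    rw [prod_split h, hTY, prodT_comm (bessel _ z.2.2.2), hTQ, neg_sub, he]
    rfl
  rw [h2, h1, hTH, hTR, neg_zero, he, he, ofReal_smul_bessel]
  simp only [bessel_sub, bessel_add]
  rfl

/-- The existence of a model. -/
theorem Admissible.exists_model (h : Admissible s₁ s₂ s₃ β θ p ε) (hφ : IsBump φ) (c₀ A : ℝ)
    {γ : ℝ} (hγ : 2 < γ) (hγ' : γ ≤ 3) :
    ∃ M : Model, M.Represents φ θ c₀ β A γ s₁ s₂ s₃ ε := by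
  have hε := h.ε_pos
  have hε8 := h.ε_le
  have hθ := h.θ_pos
  have hθ1 := h.θ_le
  have hβ := h.β_ge
  have ha : 0 ≤ 1 / 2 + ε := by linarith
  have hq : -1 - ε + β ≥ 3 / 4 := by linarith
  obtain ⟨G, tG, hG⟩ := h.exists_quadratic hφ
  obtain ⟨TC, hTC⟩ := hφ.exists_paraLowCut (c₀ := c₀) hθ hθ1 hε8
  -- The Duhamel integral of the cut paraproduct is in H^{1/2+θ/4}, above the critical 1/2 + ε since
  -- ε ≤ θ/8.
  obtain ⟨TB, hTB⟩ := hφ.exists_resonant (s := 1 / 2 + θ / 4) ha (by linarith)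
  -- A common space for the two parts of V * N: 3/4 is at most p and at most β - 1 - ε, and it
  -- exceeds 1/2 + ε.
  obtain ⟨V, tV, hV⟩ : ∃ V : Phase → LpT 2 → LpT 2, Tame 0 V ∧ ∀ z r,
      bessel (3 / 4) (V z r) = bessel p (G z r) + bessel (-1 - ε + β) z.2.2.2 := by
    refine ⟨fun z r => embed p (3 / 4) (G z r) +
      (embed (-1 - ε + β) (3 / 4)).comp (inclL2.comp projQ) z,
      (tG.clm _).add (tame_fst _), fun z r => ?_⟩
    rw [bessel_add, bessel_embed (by linarith [h.p_ge]), ContinuousLinearMap.comp_apply,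
      bessel_embed hq, ContinuousLinearMap.comp_apply, bessel_inclL2]
    rfl
  obtain ⟨μ, tμ, hμ⟩ : ∃ μ : Phase → LpT 2 → ℝ, Tame 0 μ ∧ ∀ z r,
      (bessel (-(β - p)) (G z r) + bessel (-1 - ε) z.2.2.2) 0 = (μ z r : ℂ) := by
    refine ⟨fun z r => meanCLM (G z r) + (meanCLM.comp (inclL2.comp projQ)) z,
      (tG.clm _).add (tame_fst _), fun z r => ?_⟩
    rw [Pi.add_apply, ← bessel_inclL2, bessel_zero_freq, bessel_zero_freq]
    push_cast
    rfl
  -- Here γ - 2 lies in (0, 1], so the taming factor grows at most quadratically in r.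
  obtain ⟨m, tm, hm⟩ : ∃ m : Phase → LpT 2 → ℝ, Tame 1 m ∧ ∀ z r,
      m z r = 2 * A * γ * |μ z r| ^ (γ - 2) * μ z r :=
    ⟨_, tμ.rpow _ (by linarith) (by linarith), fun _ _ => rfl⟩
  obtain ⟨FX, tFX, hFX⟩ := h.exists_forceX hφ tV tm
  obtain ⟨FY, tFY, hFY⟩ := h.exists_forceY hφ tG tV tm
  refine ⟨⟨FX, FY, fun z r => TC (V z r) (projΨ z), fun z r => embed (3 / 4) 0 (V z r), m,
    (ContinuousLinearMap.compL ℝ (LpT ∞) (LpT 2) (LpT 2) (embed 0 s₃)).comp TB, embed (-ε) s₃,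
    tFX, tFY, (tV.bilin TC projΨ).succ, tV.clm _, tm⟩, ?_, fun f ψ => ?_,
    fun k => (bessel_embed h.s₃_neg k).symm⟩
  · intro Ξ u t z r hΨ hq' hX hY hR
    have hwick : wickSquare φ Ξ u t = bessel (-(β - p)) (G z r) + bessel (-1 - ε) z.2.2.2 := by
      rw [wickSquare, hΨ, hq', hX, hY, hR, hG]
    have hconv : besselConv β (wickSquare φ Ξ u t) =
        bessel p (G z r) + bessel (-1 - ε + β) z.2.2.2 := by
      rw [hwick, besselConv_add, besselConv_bessel, besselConv_bessel]
      ring_nf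
    have hconvV : besselConv β (wickSquare φ Ξ u t) = bessel (3 / 4) (V z r) := by
      rw [hconv, hV]
    have htam : taming A γ (wickSquare φ Ξ u t) = (m z r : ℂ) := by
      rw [taming, hwick, hμ, Complex.norm_real, Real.norm_eq_abs, hm]
      push_cast
      ring
    refine ⟨?_, ?_, ?_, ?_, htam⟩
    · rw [hconvV]
      exact (bessel_embed (by norm_num) _).symm
    · rw [forceX, hconvV, htam, hΨ, neg_half_sub]
      exact (hFX z r).symm
    · have e1 : forceY φ β A γ Ξ u t = prodT (besselConv β (wickSquare φ Ξ u t))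
          (bessel s₁ (sumXY s₁ s₂ z)) + (paraHigh φ (bessel (3 / 4) (V z r)) (Ξ.Ψ t) +
          resonant φ (bessel (3 / 4) (V z r)) (Ξ.Ψ t)) -
          (m z r : ℂ) • bessel s₁ (sumXY s₁ s₂ z) := by
        rw [bessel_sumXY h.s₁_le, ← hX, ← hY, ← hconvV, ← htam]
        rfl
      rw [e1, hconv, hΨ, neg_half_sub]
      exact (hFY z r).symm
    · have e1 : (1 : ℝ) / 2 + θ / 4 - 1 = -(1 / 2 - θ / 4) := by ring
      rw [forceCut, hconvV, hΨ, neg_half_sub, hTC, e1]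
      rfl
  · rw [neg_half_sub, hTB]
    exact (bessel_embed (by linarith [h.s₃_neg]) _).symm

end ConcreteModel

end HartreeWave

namespace HartreeWave

/-! ### Sobolev norms -/

section Norms

lemma coef_eq_of_bessel_eq {s : ℝ} {p q : ℝ≥0∞} {g : LpT p} {g' : LpT q}
    (h : bessel s g = bessel s g') : coef g = coef g' := by
  funext n
  have h1 := congrFun h n
  rw [bessel_apply, bessel_apply] at h1
  exact mul_left_cancel₀ (by exact_mod_cast (Real.rpow_pos_of_pos (bracket_pos n) _).ne') h1

lemma bessel_injective (s : ℝ) : Function.Injective (bessel s : LpT 2 → TDist) :=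
  fun _ _ h => coef_injective (coef_eq_of_bessel_eq h)

lemma bessel_injective_top (s : ℝ) : Function.Injective (bessel s : LpT ∞ → TDist) :=
  fun _ _ h => coef_injective_top (coef_eq_of_bessel_eq h)

/-- By injectivity the infimum in the definition runs over a single representative. -/
lemma sobNorm_of_injective {s : ℝ} {p : ℝ≥0∞}
    (h : Function.Injective (bessel s : LpT p → TDist)) (g : LpT p) :
    sobNorm s p (bessel s g) = ‖g‖ₑ := by
  rw [Lp.enorm_def]
  refine le_antisymm (iInf₂_le (f := fun (g' : LpT p) (_ : bessel s g = bessel s g') =>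
    eLpNorm g' p torusMeasure) g rfl) (le_iInf₂ fun g' hg' => by rw [h hg'])

lemma sobNorm_bessel (s : ℝ) (g : LpT 2) : sobNorm s 2 (bessel s g) = ‖g‖ₑ :=
  sobNorm_of_injective (bessel_injective s) g

lemma sobNorm_bessel_top (s : ℝ) (g : LpT ∞) : sobNorm s ∞ (bessel s g) = ‖g‖ₑ :=
  sobNorm_of_injective (bessel_injective_top s) g

lemma norm_le_of_enorm_le {E : Type*} [SeminormedAddCommGroup E] {g : E} {δ : ℝ} (hδ : 0 ≤ δ)
    (h : ‖g‖ₑ ≤ ENNReal.ofReal δ) : ‖g‖ ≤ δ := by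
  rwa [← ofReal_norm, ENNReal.ofReal_le_ofReal_iff hδ] at h

lemma enorm_le_of_norm_le {E : Type*} [SeminormedAddCommGroup E] {g : E} {δ : ℝ}
    (h : ‖g‖ ≤ δ) : ‖g‖ₑ ≤ ENNReal.ofReal δ := by
  rw [← ofReal_norm]; exact ENNReal.ofReal_le_ofReal h

end Norms

/-! ### Slices of the triangle -/

section Slices

variable {T : ℝ} {P : ℝ × ℝ → Prop}

lemma ae_triangle_fst (h : ∀ᵐ z ∂volume.restrict (triangle T), P z) :
    ∀ᵐ t ∂timeMeasure T, ∀ᵐ t' ∂volume.restrict (Icc 0 t), P (t, t') := by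
  rw [ae_restrict_iff' (measurableSet_triangle T), Measure.volume_eq_prod] at h
  have h1 := Measure.ae_ae_of_ae_prod h
  filter_upwards [ae_restrict_of_ae h1, ae_timeMeasure_mem T] with t ht htT
  rw [ae_restrict_iff' measurableSet_Icc]
  filter_upwards [ht] with t' h2 ht'
  exact h2 ⟨ht'.1, ht'.2, htT.2⟩

lemma ae_triangle_snd (h : ∀ᵐ z ∂volume.restrict (triangle T), P z) :
    ∀ᵐ t' ∂timeMeasure T, ∀ᵐ t ∂volume.restrict (Icc t' T), P (t, t') := by
  rw [ae_restrict_iff' (measurableSet_triangle T), Measure.volume_eq_prod] at h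
  have h1 := Measure.ae_ae_of_ae_prod
    (Measure.measurePreserving_swap.quasiMeasurePreserving.ae h)
  filter_upwards [ae_restrict_of_ae h1, ae_timeMeasure_mem T] with t' ht htT
  rw [ae_restrict_iff' measurableSet_Icc]
  filter_upwards [ht] with t h2 ht'
  exact h2 ⟨htT.1, ht'.1, ht'.2⟩

end Slices

/-! ### Representation of the data and of the unknowns -/

section Representation

variable {T s₁ s₂ s₃ ε δ : ℝ}

/-- The enhanced data `Ξ` are given by the elements `d` of `L²` and `L^∞`. -/
structure EnhancedData.Rep (T s₁ s₂ ε : ℝ) (Ξ : EnhancedData) (d : ModelData) : Prop where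
  x₀ : Ξ.X₀ = bessel s₁ d.x₀
  x₁ : Ξ.X₁ = bessel (s₁ - 1) d.x₁
  y₀ : Ξ.Y₀ = bessel s₂ d.y₀
  y₁ : Ξ.Y₁ = bessel (s₂ - 1) d.y₁
  ψ : ∀ t ∈ Icc 0 T, Ξ.Ψ t = bessel (-(1 / 2) - ε) (d.ψ t)
  q : ∀ t ∈ Icc 0 T, Ξ.Ψsq t = bessel (-1 - ε) (d.q t)
  k : ∀ᵐ z ∂volume.restrict (triangle T), Ξ.K z.1 z.2 = bessel (-ε) (d.k z)
  J : d.J = Ξ.J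
  regular : d.Regular T

/-- The triple `v` is given by the elements `u` of `L²`. -/
structure Triple.Rep (T s₁ s₂ s₃ : ℝ) (v : Triple) (u : Unknowns) : Prop where
  x : ∀ t ∈ Icc 0 T, v.X t = bessel s₁ (u.x t)
  y : ∀ t ∈ Icc 0 T, v.Y t = bessel s₂ (u.y t)
  r : ∀ᵐ t ∂timeMeasure T, v.R t = bessel s₃ (u.r t)
  regular : u.Regular T

variable {Ξ Ξ' : EnhancedData} {d d' : ModelData} {v v' : Triple} {u u' : Unknowns}

lemma EnhancedData.Mem.exists_rep (h : Ξ.Mem T s₁ s₂ ε) : ∃ d, Ξ.Rep T s₁ s₂ ε d := by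
  obtain ⟨x₀, h1⟩ := h.X₀
  obtain ⟨x₁, h2⟩ := h.X₁
  obtain ⟨y₀, h3⟩ := h.Y₀
  obtain ⟨y₁, h4⟩ := h.Y₁
  obtain ⟨ψ, h5, h5'⟩ := h.Ψ_C
  obtain ⟨q, h6, h6'⟩ := h.Ψsq
  obtain ⟨⟨k, h7, h7'⟩, -⟩ := h.K
  exact ⟨⟨x₀, x₁, y₀, y₁, ψ, q, k, Ξ.J⟩, h1, h2, h3, h4, h5', h6', h7', rfl, h5, h6, h7, h.J⟩

lemma EnhancedData.Rep.mono {T' : ℝ} (h : Ξ.Rep T s₁ s₂ ε d) (hT : T' ≤ T) :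
    Ξ.Rep T' s₁ s₂ ε d :=
  ⟨h.x₀, h.x₁, h.y₀, h.y₁, fun t ht => h.ψ t ⟨ht.1, ht.2.trans hT⟩,
    fun t ht => h.q t ⟨ht.1, ht.2.trans hT⟩,
    ae_mono (Measure.restrict_mono (triangle_mono hT) le_rfl) h.k, h.J, h.regular.mono hT⟩

lemma Triple.Mem.exists_rep (h : v.Mem T s₁ s₂ s₃) : ∃ u, v.Rep T s₁ s₂ s₃ u := by
  obtain ⟨x, h1, h1'⟩ := h.X_C
  obtain ⟨y, h2, h2'⟩ := h.Y_C
  obtain ⟨r, h3, h3'⟩ := h.R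
  exact ⟨⟨x, y, r⟩, h1', h2', h3', h1, h2, h3⟩

lemma kernelBound_of_normKernel {K : ℝ → ℝ → TDist} {k : ℝ × ℝ → LpT 2}
    (hk : ∀ᵐ z ∂volume.restrict (triangle T), K z.1 z.2 = bessel (-ε) (k z))
    (h : normKernel T (-ε) K ≤ ENNReal.ofReal δ) : KernelBound T δ k := by
  rw [normKernel, eLpNorm_exponent_top] at h
  filter_upwards [ae_triangle_snd hk, ae_le_eLpNormEssSup (μ := timeMeasure T)
    (f := fun t' => eLpNorm (fun t => sobNorm (-ε) 2 (K t t')) 3 (volume.restrict (Icc t' T)))]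
    with t' h1 h2
  rw [enorm_eq_self] at h2
  refine le_trans (le_of_eq ?_) (h2.trans h)
  rw [← eLpNorm_enorm]
  refine eLpNorm_congr_ae ?_
  filter_upwards [h1] with t ht
  rw [ht, sobNorm_bessel]

lemma jBound_of_normOp (hT : T ≤ 1) {J : ParaOp} (h : normOp T J ≤ ENNReal.ofReal δ) :
    JBound T δ J := by
  intro W hW
  have h1 := (le_iSup₂ (f := fun (W : Lp (LpT 2) (3 / 2) (timeMeasure 1))
    (_ : ∀ᵐ τ ∂timeMeasure 1, T < τ → W τ = 0) =>
      eLpNorm (J W) ∞ (timeMeasure T) / eLpNorm W (3 / 2) (timeMeasure T)) W hW).trans h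
  have hb : eLpNorm W (3 / 2) (timeMeasure T) ≠ ∞ :=
    ((Lp.memLp W).mono_measure (timeMeasure_mono hT)).2.ne
  -- If W vanishes on [0, T], the quotient is x / 0, which is infinite unless x = 0; so the finite
  -- bound still gives the inequality.
  exact (ENNReal.div_le_iff_le_mul (Or.inr ENNReal.ofReal_ne_top) (Or.inl hb)).1 h1

lemma norm_le_of_normC {s : ℝ} {p : ℝ≥0∞} (hs : ∀ g : LpT p, sobNorm s p (bessel s g) = ‖g‖ₑ)
    [Fact (1 ≤ p)] {f f' : ℝ → TDist} {g g' : ℝ → LpT p} (hδ : 0 ≤ δ)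
    (hf : ∀ t ∈ Icc 0 T, f t = bessel s (g t)) (hf' : ∀ t ∈ Icc 0 T, f' t = bessel s (g' t))
    (h : normC T s p (f - f') ≤ ENNReal.ofReal δ) {t : ℝ} (ht : t ∈ Icc 0 T) :
    ‖g t - g' t‖ ≤ δ := by
  refine norm_le_of_enorm_le hδ ?_
  rw [← hs, bessel_sub, ← hf t ht, ← hf' t ht]
  exact (le_iSup₂ (f := fun t (_ : t ∈ Icc 0 T) => sobNorm s p ((f - f') t)) t ht).trans h

lemma norm_le_of_sobNorm {s : ℝ} {f f' : TDist} {g g' : LpT 2} (hδ : 0 ≤ δ)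
    (hf : f = bessel s g) (hf' : f' = bessel s g')
    (h : sobNorm s 2 (f - f') ≤ ENNReal.ofReal δ) : ‖g - g'‖ ≤ δ := by
  refine norm_le_of_enorm_le hδ ?_
  rwa [← sobNorm_bessel s, bessel_sub, ← hf, ← hf']

/-- The distance in the class of enhanced data controls the distance of representatives. -/
lemma EnhancedData.Rep.close (h : Ξ.Rep T s₁ s₂ ε d) (h' : Ξ'.Rep T s₁ s₂ ε d') (hT : T ≤ 1)
    (hδ : 0 ≤ δ) (hd : Ξ.dist T s₁ s₂ ε Ξ' ≤ ENNReal.ofReal δ) : d.Close T δ d' := by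
  rw [EnhancedData.dist, normC1] at hd
  have e7 := le_of_add_le_left hd
  have e6 := le_of_add_le_left e7
  have e5 := le_of_add_le_left e6
  have e4 := le_of_add_le_left e5
  have e3 := le_of_add_le_left e4
  have e2 := le_of_add_le_left e3
  refine ⟨norm_le_of_sobNorm hδ h.x₀ h'.x₀ (le_of_add_le_left e2),
    norm_le_of_sobNorm hδ h.x₁ h'.x₁ (le_of_add_le_right e2),
    norm_le_of_sobNorm hδ h.y₀ h'.y₀ (le_of_add_le_right e3),
    norm_le_of_sobNorm hδ h.y₁ h'.y₁ (le_of_add_le_right e4),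
    fun t ht => norm_le_of_normC (sobNorm_bessel_top _) hδ h.ψ h'.ψ
      (le_of_add_le_left (le_of_add_le_right e5)) ht,
    fun t ht => norm_le_of_normC (sobNorm_bessel_top _) hδ h.q h'.q (le_of_add_le_right e6) ht,
    kernelBound_of_normKernel (K := Ξ.K - Ξ'.K) ?_ (le_of_add_le_right e7), ?_⟩
  · filter_upwards [h.k, h'.k] with z h1 h2
    rw [bessel_sub, ← h1, ← h2]
    rfl
  · rw [h.J, h'.J]
    exact jBound_of_normOp hT (le_of_add_le_right hd)

/-- Enhanced data are bounded. -/
lemma EnhancedData.Rep.exists_bound (h : Ξ.Rep 1 s₁ s₂ ε d) (hm : Ξ.Mem 1 s₁ s₂ ε) :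
    ∃ B, 0 ≤ B ∧ ∀ T ≤ 1, d.Close T B .zero := by
  obtain ⟨Bψ, hBψ⟩ := isCompact_Icc.exists_bound_of_continuousOn h.regular.ψ
  obtain ⟨Bq, hBq⟩ := isCompact_Icc.exists_bound_of_continuousOn h.regular.q
  have hk : KernelBound 1 (normKernel 1 (-ε) Ξ.K).toReal d.k :=
    kernelBound_of_normKernel h.k (ENNReal.ofReal_toReal hm.K.2.ne).ge
  set B := ‖d.x₀‖ + ‖d.x₁‖ + ‖d.y₀‖ + ‖d.y₁‖ + |Bψ| + |Bq| + (normKernel 1 (-ε) Ξ.K).toReal +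
    ‖d.J‖ with hB
  have n1 := norm_nonneg d.x₀
  have n2 := norm_nonneg d.x₁
  have n3 := norm_nonneg d.y₀
  have n4 := norm_nonneg d.y₁
  have n5 := abs_nonneg Bψ
  have n6 := abs_nonneg Bq
  have n7 : 0 ≤ (normKernel 1 (-ε) Ξ.K).toReal := ENNReal.toReal_nonneg
  have n8 := norm_nonneg d.J
  refine ⟨B, by positivity, fun T hT => ?_⟩
  constructor
  case k =>
    simp only [ModelData.zero, Pi.zero_apply, sub_zero]
    exact hk.mono hT (by linarith)
  case J =>
    simp only [ModelData.zero, sub_zero]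
    exact (jBound_norm hT d.J).mono (by linarith)
  all_goals simp only [ModelData.zero, Pi.zero_apply, sub_zero]
  · linarith
  · linarith
  · linarith
  · linarith
  · intro t ht
    linarith [hBψ t ⟨ht.1, ht.2.trans hT⟩, le_abs_self Bψ]
  · intro t ht
    linarith [hBq t ⟨ht.1, ht.2.trans hT⟩, le_abs_self Bq]

lemma KernelBound.of_sub {k k' : ℝ × ℝ → LpT 2} {B : ℝ} (hB : 0 ≤ B) (hδ : 0 ≤ δ)
    (hk : AEStronglyMeasurable k (volume.restrict (triangle T)))
    (hk' : AEStronglyMeasurable k' (volume.restrict (triangle T))) (h : KernelBound T B k)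
    (h' : KernelBound T δ fun z => k z - k' z) : KernelBound T (B + δ) k' := by
  -- The triangle inequality in L³ is applied on slices, which are measurable for almost every t'.
  have hm : ∀ {k : ℝ × ℝ → LpT 2}, AEStronglyMeasurable k (volume.restrict (triangle T)) →
      ∀ᵐ t' ∂timeMeasure T,
        AEStronglyMeasurable (fun t => k (t, t')) (volume.restrict (Icc t' T)) := by
    intro k hk
    filter_upwards [ae_triangle_snd hk.ae_eq_mk] with t' ht'
    exact ⟨fun t => hk.mk k (t, t'),
      hk.stronglyMeasurable_mk.comp_measurable measurable_prodMk_right, ht'⟩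
  filter_upwards [h, h', hm hk, hm hk'] with t' h1 h2 h3 h4
  have e : (fun t => k' (t, t')) = (fun t => k (t, t')) - fun t => k (t, t') - k' (t, t') := by
    funext t; simp
  rw [e, ENNReal.ofReal_add hB hδ]
  exact (eLpNorm_sub_le h3 (h3.sub h4) (by norm_num)).trans (add_le_add h1 h2)

lemma norm_le_add_of_sub {E : Type*} [SeminormedAddCommGroup E] {a b : E} {B : ℝ}
    (h : ‖a - 0‖ ≤ B) (h' : ‖a - b‖ ≤ δ) : ‖b - 0‖ ≤ B + δ := by
  rw [sub_zero] at h ⊢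
  have : b = a - (a - b) := by abel
  rw [this]
  exact (norm_sub_le _ _).trans (add_le_add h h')

/-- Data close to bounded data are bounded. -/
lemma ModelData.Close.bound {B : ℝ} (hT : T ≤ 1) (hB : 0 ≤ B) (hδ : 0 ≤ δ) (hd : d.Regular T)
    (hd' : d'.Regular T) (h : d.Close T B .zero) (h' : d.Close T δ d') :
    d'.Close T (B + δ) .zero where
  x₀ := norm_le_add_of_sub h.x₀ h'.x₀
  x₁ := norm_le_add_of_sub h.x₁ h'.x₁
  y₀ := norm_le_add_of_sub h.y₀ h'.y₀
  y₁ := norm_le_add_of_sub h.y₁ h'.y₁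
  ψ t ht := norm_le_add_of_sub (h.ψ t ht) (h'.ψ t ht)
  q t ht := norm_le_add_of_sub (h.q t ht) (h'.q t ht)
  k := by
    have h1 := h.k
    simp only [ModelData.zero, Pi.zero_apply, sub_zero] at h1 ⊢
    exact KernelBound.of_sub hB hδ hd.k hd'.k h1 h'.k
  J := by
    have h1 := h.J
    simp only [ModelData.zero, sub_zero] at h1 ⊢
    refine h1.add hT hB hδ fun W hW => ?_
    refine le_trans (le_of_eq ?_) (h'.J W hW)
    rw [← neg_sub, neg_apply]
    refine (eLpNorm_congr_ae (ae_mono (timeMeasure_mono hT) (Lp.coeFn_neg _))).trans ?_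
    exact eLpNorm_neg _ _ _

end Representation

end HartreeWave

namespace HartreeWave

/-! ### Solutions of the focusing system -/

section Solutions

variable {φ : ℝ → ℝ} {θ c₀ β A γ T s₁ s₂ s₃ ε δ : ℝ} {Ξ Ξ' : EnhancedData} {d d' : ModelData}
  {v v' : Triple} {u u' : Unknowns} {M : Model}

lemma Model.Represents.ae_eqs (hM : M.Represents φ θ c₀ β A γ s₁ s₂ s₃ ε)
    (hΞ : Ξ.Rep T s₁ s₂ ε d) (hv : v.Rep T s₁ s₂ s₃ u) : ∀ᵐ t ∂timeMeasure T,
    besselConv β (wickSquare φ Ξ v t) = bessel 0 (M.w (path d u t) (u.r t)) ∧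
    forceX φ β A γ Ξ v t = bessel (s₁ - 1) (M.FX (path d u t) (u.r t)) ∧
    forceY φ β A γ Ξ v t = bessel (s₂ - 1) (M.FY (path d u t) (u.r t)) ∧
    forceCut φ θ c₀ β Ξ v t = bessel (1 / 2 + θ / 4 - 1) (M.Fc (path d u t) (u.r t)) ∧
    taming A γ (wickSquare φ Ξ v t) = (M.m (path d u t) (u.r t) : ℂ) := by
  filter_upwards [hv.r, ae_timeMeasure_mem T] with t hr ht
  exact hM.eqs Ξ v t (path d u t) (u.r t) (hΞ.ψ t ht) (hΞ.q t ht) (hv.x t ht) (hv.y t ht) hr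

lemma coeffIntegrable_of_ae {s : ℝ} {F : ℝ → TDist} {f : ℝ → LpT 2} (hT : 0 ≤ T)
    (h : ∀ᵐ t ∂timeMeasure T, F t = bessel s (f t)) (hf : IntervalIntegrable f volume 0 T) :
    CoeffIntegrable T F := by
  intro n
  rw [intervalIntegrable_iff_integrableOn_Icc_of_le hT] at hf ⊢
  refine Integrable.congr (((coefCLM n).integrable_comp hf).const_mul
    (((bracket n ^ (-s) : ℝ) : ℂ))) ?_
  filter_upwards [h] with t ht
  rw [ht]
  rfl

lemma wave_eq {s : ℝ} {F : ℝ → TDist} {f : ℝ → LpT 2} {x₀ x₁ : LpT 2}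
    (h : ∀ᵐ t ∂timeMeasure T, F t = bessel (s - 1) (f t))
    (hf : IntervalIntegrable f volume 0 T) {t : ℝ} (ht : t ∈ Icc 0 T) :
    linEvol (bessel s x₀) (bessel (s - 1) x₁) t + duhamel F t = bessel s (waveSol x₀ x₁ f t) := by
  rw [duhamel_congr ht h, bessel_waveSol ht.1 (intervalIntegrable_mono hf ht)]

/-- The memory term with kernel `𝔸`. -/
lemma Model.Represents.kernel_eq (hM : M.Represents φ θ c₀ β A γ s₁ s₂ s₃ ε)
    (hΞ : Ξ.Rep T s₁ s₂ ε d) (hv : v.Rep T s₁ s₂ s₃ u) (hT : 0 ≤ T) (hT1 : T ≤ 1) {B : ℝ}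
    (hB : KernelBound T B d.k) : ∀ᵐ t ∂timeMeasure T,
    CoeffIntegrable t (fun t' => taming A γ (wickSquare φ Ξ v t') • Ξ.K t t') ∧
    (fun n => ∫ t' in (0 : ℝ)..t, taming A γ (wickSquare φ Ξ v t') * Ξ.K t t' n) =
      bessel s₃ (M.emb (kernelInt (fun t => M.m (path d u t) (u.r t)) d.k t)) := by
  have hm := M.integrable_m hT hT1 hΞ.regular hv.regular
  have heq := hM.ae_eqs hΞ hv
  filter_upwards [ae_intervalIntegrable_kernel hm hΞ.regular.k hB, ae_triangle_fst hΞ.k,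
    ae_timeMeasure_mem T] with t h1 h2 ht
  have h3 : ∀ᵐ t' ∂timeMeasure t, taming A γ (wickSquare φ Ξ v t') • Ξ.K t t' =
      bessel (-ε) (M.m (path d u t') (u.r t') • d.k (t, t')) := by
    filter_upwards [h2, ae_mono (timeMeasure_mono ht.2) heq] with t' e1 e2
    rw [e1, e2.2.2.2.2, ofReal_smul_bessel]
  refine ⟨coeffIntegrable_of_ae ht.1 h3 h1, ?_⟩
  rw [← hM.emb]
  funext n
  have h4 : ∫ t' in (0 : ℝ)..t, taming A γ (wickSquare φ Ξ v t') * Ξ.K t t' n =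
      ∫ t' in (0 : ℝ)..t, ((bracket n ^ (-(-ε)) : ℝ) : ℂ) *
        coefCLM n (M.m (path d u t') (u.r t') • d.k (t, t')) := by
    rw [intervalIntegral.integral_of_le ht.1, intervalIntegral.integral_of_le ht.1]
    refine integral_congr_ae (ae_restrict_of_ae_restrict_of_subset Ioc_subset_Icc_self ?_)
    filter_upwards [h3] with t' e
    exact congrFun e n
  rw [h4, intervalIntegral.integral_const_mul, ContinuousLinearMap.intervalIntegral_comp_comm _ h1]
  rfl

lemma Model.Represents.res_eq (hM : M.Represents φ θ c₀ β A γ s₁ s₂ s₃ ε)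
    (hΞ : Ξ.Rep T s₁ s₂ ε d) (hv : v.Rep T s₁ s₂ s₃ u) (hT : 0 ≤ T) (hT1 : T ≤ 1) {t : ℝ}
    (ht : t ∈ Icc 0 T) : resonant φ (duhamel (forceCut φ θ c₀ β Ξ v) t) (Ξ.Ψ t) =
      bessel s₃ (M.res (convMul waveSym (fun t => M.Fc (path d u t) (u.r t)) t) (d.ψ t)) := by
  have hf := Model.intervalIntegrable_path M.tame_Fc hT hT1 hΞ.regular hv.regular
  have h1 : ∀ᵐ t ∂timeMeasure T, forceCut φ θ c₀ β Ξ v t =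
      bessel (1 / 2 + θ / 4 - 1) (M.Fc (path d u t) (u.r t)) := by
    filter_upwards [hM.ae_eqs hΞ hv] with t e using e.2.2.2.1
  rw [duhamel_congr ht h1, duhamel_bessel ht.1 (intervalIntegrable_mono hf ht), hΞ.ψ t ht, hM.res]

/-- The focusing system is equivalent to the abstract system. -/
lemma Model.Represents.isSolution_iff (hM : M.Represents φ θ c₀ β A γ s₁ s₂ s₃ ε)
    (hΞ : Ξ.Rep T s₁ s₂ ε d) (hv : v.Rep T s₁ s₂ s₃ u) (hT : 0 ≤ T) (hT1 : T ≤ 1) {B : ℝ}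
    (hB : KernelBound T B d.k) :
    IsSolution φ θ c₀ β A γ s₃ T Ξ v ↔ M.IsSol T d u := by
  have heq := hM.ae_eqs hΞ hv
  have hX : ∀ᵐ t ∂timeMeasure T, forceX φ β A γ Ξ v t =
      bessel (s₁ - 1) (M.FX (path d u t) (u.r t)) := by
    filter_upwards [heq] with t e using e.2.1
  have hY : ∀ᵐ t ∂timeMeasure T, forceY φ β A γ Ξ v t =
      bessel (s₂ - 1) (M.FY (path d u t) (u.r t)) := by
    filter_upwards [heq] with t e using e.2.2.1
  have hC : ∀ᵐ t ∂timeMeasure T, forceCut φ θ c₀ β Ξ v t =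
      bessel (1 / 2 + θ / 4 - 1) (M.Fc (path d u t) (u.r t)) := by
    filter_upwards [heq] with t e using e.2.2.2.1
  have iX := Model.intervalIntegrable_path M.tame_FX hT hT1 hΞ.regular hv.regular
  have iY := Model.intervalIntegrable_path M.tame_FY hT hT1 hΞ.regular hv.regular
  have iC := Model.intervalIntegrable_path M.tame_Fc hT hT1 hΞ.regular hv.regular
  have hk := hM.kernel_eq hΞ hv hT hT1 hB
  have hw := M.memLp_w hT hT1 hΞ.regular hv.regular
  have eX : ∀ t ∈ Icc 0 T, linEvol Ξ.X₀ Ξ.X₁ t + duhamel (forceX φ β A γ Ξ v) t =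
      bessel s₁ ((M.step T d u).x t) := fun t ht => by
    rw [hΞ.x₀, hΞ.x₁, wave_eq hX iX ht]; rfl
  have eY : ∀ t ∈ Icc 0 T, linEvol Ξ.Y₀ Ξ.Y₁ t + duhamel (forceY φ β A γ Ξ v) t =
      bessel s₂ ((M.step T d u).y t) := fun t ht => by
    rw [hΞ.y₀, hΞ.y₁, wave_eq hY iY ht]; rfl
  have eR : ∀ᵐ t ∂timeMeasure T, resonant φ (duhamel (forceCut φ θ c₀ β Ξ v) t) (Ξ.Ψ t)
        + bessel s₃ (Ξ.J (truncLp T fun t => M.w (path d u t) (u.r t)) t)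
        - (fun n => ∫ t' in (0 : ℝ)..t, taming A γ (wickSquare φ Ξ v t') * Ξ.K t t' n) =
      bessel s₃ ((M.step T d u).r t) := by
    filter_upwards [hk, ae_timeMeasure_mem T] with t e1 ht
    rw [e1.2, hM.res_eq hΞ hv hT hT1 ht, ← hΞ.J, ← bessel_add, ← bessel_sub]
    rfl
  constructor
  · intro h
    refine ⟨hv.regular, fun t ht => bessel_injective s₁ ?_, fun t ht => bessel_injective s₂ ?_, ?_⟩
    · rw [← hv.x t ht, h.X_eq t ht, eX t ht]
    · rw [← hv.y t ht, h.Y_eq t ht, eY t ht]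
    · obtain ⟨W, hW0, hW, hR⟩ := h.R_eq
      -- The input W of the operator is not a free choice: its values on [0, T] are prescribed and
      -- it vanishes afterwards.
      have hWe : W = truncLp T fun t => M.w (path d u t) (u.r t) := by
        refine eq_truncLp hT1 hw hW0 ?_
        filter_upwards [hW, heq] with t e1 e2
        exact bessel_injective 0 (e1.symm.trans e2.1)
      rw [hWe] at hR
      filter_upwards [hR, eR, hv.r] with t e1 e2 e3
      exact bessel_injective s₃ (by rw [← e3, e1, e2])
  · intro h
    refine ⟨coeffIntegrable_of_ae hT hX iX, fun t ht => ?_, coeffIntegrable_of_ae hT hY iY,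
      fun t ht => ?_, coeffIntegrable_of_ae hT hC iC, ?_, ?_⟩
    · rw [eX t ht, hv.x t ht, h.x t ht]
    · rw [eY t ht, hv.y t ht, h.y t ht]
    · filter_upwards [hk] with t e using e.1
    · refine ⟨truncLp T fun t => M.w (path d u t) (u.r t), truncLp_ae_zero hT1 hw, ?_, ?_⟩
      · filter_upwards [heq, truncLp_ae_eq hT1 hw] with t e1 e2
        rw [e1.1, e2]
      · filter_upwards [eR, hv.r, h.r] with t e1 e2 e3
        rw [e1, e2, e3]

/-- The triple with the given representatives. -/
noncomputable def Unknowns.toTriple (s₁ s₂ s₃ : ℝ) (u : Unknowns) : Triple where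
  X t := bessel s₁ (u.x t)
  Y t := bessel s₂ (u.y t)
  R t := bessel s₃ (u.r t)

lemma Unknowns.rep_toTriple (hu : u.Regular T) : (u.toTriple s₁ s₂ s₃).Rep T s₁ s₂ s₃ u :=
  ⟨fun _ _ => rfl, fun _ _ => rfl, Eventually.of_forall fun _ => rfl, hu⟩

lemma memC1_waveSol {s : ℝ} {x₀ x₁ : LpT 2} {f : ℝ → LpT 2} {U : ℝ → TDist} (hT : 0 < T)
    (hf : IntervalIntegrable f volume 0 T)
    (hU : ∀ t ∈ Icc 0 T, U t = bessel s (waveSol x₀ x₁ f t)) : MemC1 T (s - 1) 2 U :=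
  ⟨_, (contDiffOn_waveSol hT hf).1, fun t ht => by rw [hU t ht, bessel_multiplier_inv_bracket]⟩

lemma Triple.Rep.mem_of_isSol (hv : v.Rep T s₁ s₂ s₃ u) (h : M.IsSol T d u) (hT : 0 < T)
    (hT1 : T ≤ 1) (hd : d.Regular T) : v.Mem T s₁ s₂ s₃ where
  X_C := ⟨u.x, h.regular.x, hv.x⟩
  X_C1 := memC1_waveSol hT (Model.intervalIntegrable_path M.tame_FX hT.le hT1 hd h.regular)
    fun t ht => by rw [hv.x t ht, h.x t ht]; rfl
  Y_C := ⟨u.y, h.regular.y, hv.y⟩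
  Y_C1 := memC1_waveSol hT (Model.intervalIntegrable_path M.tame_FY hT.le hT1 hd h.regular)
    fun t ht => by rw [hv.y t ht, h.y t ht]; rfl
  R := ⟨u.r, h.regular.r, hv.r⟩

/-- By linearity the difference is itself a wave solution, so its time derivative is the difference
of the velocities. -/
lemma normC1_waveSol_le {s : ℝ} {x₀ x₁ x₀' x₁' : LpT 2} {f f' : ℝ → LpT 2} {U U' : ℝ → TDist}
    (hT : 0 < T) (hf : IntervalIntegrable f volume 0 T) (hf' : IntervalIntegrable f' volume 0 T)
    (hU : ∀ t ∈ Icc 0 T, U t = bessel s (waveSol x₀ x₁ f t))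
    (hU' : ∀ t ∈ Icc 0 T, U' t = bessel s (waveSol x₀' x₁' f' t))
    (h : ∀ t ∈ Icc 0 T, ‖waveSol x₀ x₁ f t - waveSol x₀' x₁' f' t‖ ≤ δ)
    (h' : ∀ t ∈ Icc 0 T, ‖waveVel x₀ x₁ f t - waveVel x₀' x₁' f' t‖ ≤ δ) :
    normC1 T s 2 (U - U') ≤ ENNReal.ofReal δ + ENNReal.ofReal δ := by
  have hD : ∀ t ∈ Icc 0 T, (U - U') t =
      bessel s (waveSol (x₀ - x₀') (x₁ - x₁') (fun τ => f τ - f' τ) t) := fun t ht => by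
    rw [Pi.sub_apply, hU t ht, hU' t ht, ← bessel_sub,
      waveSol_sub (intervalIntegrable_mono hf ht) (intervalIntegrable_mono hf' ht)]
  refine add_le_add (iSup₂_le fun t ht => ?_) (iSup₂_le fun t ht => ?_)
  · rw [Pi.sub_apply, hU t ht, hU' t ht, ← bessel_sub, sobNorm_bessel]
    exact enorm_le_of_norm_le (h t ht)
  · rw [timeDeriv_waveSol hT (hf.sub hf') hD ht, sobNorm_bessel,
      ← waveVel_sub (intervalIntegrable_mono hf ht) (intervalIntegrable_mono hf' ht)]
    exact enorm_le_of_norm_le (h' t ht)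

/-- The distance of solutions in terms of representatives. -/
lemma Triple.Rep.dist_le (hv : v.Rep T s₁ s₂ s₃ u) (hv' : v'.Rep T s₁ s₂ s₃ u')
    (h : M.IsSol T d u) (h' : M.IsSol T d' u') (hT : 0 < T) (hT1 : T ≤ 1) (hd : d.Regular T)
    (hd' : d'.Regular T) (hu : u.Close T δ u')
    (hvel : ∀ t ∈ Icc 0 T, ‖M.velX d u t - M.velX d' u' t‖ ≤ δ ∧
      ‖M.velY d u t - M.velY d' u' t‖ ≤ δ) :
    v.dist T s₁ s₂ s₃ v' ≤ 5 * ENNReal.ofReal δ := by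
  have h1 : normC1 T s₁ 2 (v.X - v'.X) ≤ ENNReal.ofReal δ + ENNReal.ofReal δ := by
    refine normC1_waveSol_le hT
      (Model.intervalIntegrable_path M.tame_FX hT.le hT1 hd h.regular)
      (Model.intervalIntegrable_path M.tame_FX hT.le hT1 hd' h'.regular)
      (fun t ht => by rw [hv.x t ht, h.x t ht]; rfl)
      (fun t ht => by rw [hv'.x t ht, h'.x t ht]; rfl) (fun t ht => ?_)
      (fun t ht => (hvel t ht).1)
    have := hu.x t ht
    rwa [h.x t ht, h'.x t ht] at this
  have h2 : normC1 T s₂ 2 (v.Y - v'.Y) ≤ ENNReal.ofReal δ + ENNReal.ofReal δ := by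
    refine normC1_waveSol_le hT
      (Model.intervalIntegrable_path M.tame_FY hT.le hT1 hd h.regular)
      (Model.intervalIntegrable_path M.tame_FY hT.le hT1 hd' h'.regular)
      (fun t ht => by rw [hv.y t ht, h.y t ht]; rfl)
      (fun t ht => by rw [hv'.y t ht, h'.y t ht]; rfl) (fun t ht => ?_)
      (fun t ht => (hvel t ht).2)
    have := hu.y t ht
    rwa [h.y t ht, h'.y t ht] at this
  have h3 : normLq T 3 s₃ (v.R - v'.R) ≤ ENNReal.ofReal δ := by
    refine le_trans (le_of_eq ?_) hu.r
    rw [normLq, ← eLpNorm_enorm (fun t => u.r t - u'.r t)]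
    refine eLpNorm_congr_ae ?_
    filter_upwards [hv.r, hv'.r] with t e1 e2
    rw [Pi.sub_apply, e1, e2, ← bessel_sub, sobNorm_bessel]
  refine (add_le_add (add_le_add h1 h2) h3).trans (le_of_eq ?_)
  ring

lemma Triple.Rep.eqOn (hv : v.Rep T s₁ s₂ s₃ u) (hv' : v'.Rep T s₁ s₂ s₃ u')
    (h : u.Close T 0 u') : v.EqOn T v' := by
  refine ⟨fun t ht => ?_, fun t ht => ?_, ?_⟩
  · rw [hv.x t ht, hv'.x t ht, sub_eq_zero.1 (norm_le_zero_iff.1 (h.x t ht))]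
  · rw [hv.y t ht, hv'.y t ht, sub_eq_zero.1 (norm_le_zero_iff.1 (h.y t ht))]
  · have h1 := h.r
    rw [ENNReal.ofReal_zero, nonpos_iff_eq_zero] at h1
    have h2 := (eLpNorm_eq_zero_iff (f := fun t => u.r t - u'.r t)
      (hv.regular.r.1.sub hv'.regular.r.1) (by norm_num)).1 h1
    filter_upwards [hv.r, hv'.r, h2] with t e1 e2 e3
    rw [e1, e2, sub_eq_zero.1 e3]

end Solutions

/-- Local well-posedness for a system that is represented by a model. -/
theorem Model.Represents.wellPosed {φ : ℝ → ℝ} {θ c₀ β A γ s₁ s₂ s₃ ε : ℝ} {M : Model}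
    (hM : M.Represents φ θ c₀ β A γ s₁ s₂ s₃ ε) (Ξ : EnhancedData) (hΞ : Ξ.Mem 1 s₁ s₂ ε) :
    ∃ T : ℝ, 0 < T ∧ T ≤ 1 ∧ ∃ r : ℝ≥0∞, 0 < r ∧ ∃ Φ : EnhancedData → Triple,
      (∀ Ξ' : EnhancedData, Ξ'.Mem T s₁ s₂ ε → Ξ.dist T s₁ s₂ ε Ξ' < r →
        (Φ Ξ').Mem T s₁ s₂ s₃ ∧ IsSolution φ θ c₀ β A γ s₃ T Ξ' (Φ Ξ') ∧
        ∀ v : Triple, v.Mem T s₁ s₂ s₃ →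
          IsSolution φ θ c₀ β A γ s₃ T Ξ' v → v.EqOn T (Φ Ξ')) ∧
      (∀ Ξ' : EnhancedData, Ξ'.Mem T s₁ s₂ ε → Ξ.dist T s₁ s₂ ε Ξ' < r →
        ∀ η : ℝ≥0∞, 0 < η → ∃ δ : ℝ≥0∞, 0 < δ ∧
        ∀ Ξ'' : EnhancedData, Ξ''.Mem T s₁ s₂ ε → Ξ.dist T s₁ s₂ ε Ξ'' < r →
          Ξ'.dist T s₁ s₂ ε Ξ'' < δ → (Φ Ξ').dist T s₁ s₂ s₃ (Φ Ξ'') < η) := by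
  obtain ⟨d, hd⟩ := hΞ.exists_rep
  obtain ⟨B, hB, hdB⟩ := hd.exists_bound hΞ
  have hB1 : 0 ≤ B + 1 := by positivity
  -- B + 1 bounds all data at distance less than 1 from Ξ, so this T serves the whole ball of radius
  -- r = 1.
  obtain ⟨T, hT, hT1, hex, hst⟩ := M.exists_wellPosed hB1
  have key : ∀ Ξ' : EnhancedData, ∃ (d' : ModelData) (u' : Unknowns), Ξ'.Mem T s₁ s₂ ε →
      Ξ.dist T s₁ s₂ ε Ξ' < 1 → Ξ'.Rep T s₁ s₂ ε d' ∧ d'.Close T (B + 1) .zero ∧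
        M.IsSol T d' u' := by
    intro Ξ'
    by_cases h : Ξ'.Mem T s₁ s₂ ε ∧ Ξ.dist T s₁ s₂ ε Ξ' < 1
    · obtain ⟨d', hd'⟩ := h.1.exists_rep
      have h1 : d'.Close T (B + 1) .zero :=
        (hdB T hT1).bound hT1 hB zero_le_one (hd.mono hT1).regular hd'.regular
          ((hd.mono hT1).close hd' hT1 zero_le_one (by rw [ENNReal.ofReal_one]; exact h.2.le))
      obtain ⟨u', hu'⟩ := hex d' hd'.regular h1
      exact ⟨d', u', fun _ _ => ⟨hd', h1, hu'⟩⟩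
    -- A default value for data outside the class or outside the ball.
    · exact ⟨.zero, .zero, fun h1 h2 => (h ⟨h1, h2⟩).elim⟩
  choose D U hDU using key
  have hkb : ∀ {d : ModelData}, d.Close T (B + 1) .zero → KernelBound T (B + 1) d.k :=
    fun h => by simpa [ModelData.zero] using h.k
  refine ⟨T, hT, hT1, 1, zero_lt_one, fun Ξ' => (U Ξ').toTriple s₁ s₂ s₃, ?_, ?_⟩
  · intro Ξ' hm hdist
    obtain ⟨hd', hdB', hu'⟩ := hDU Ξ' hm hdist
    have hrep : ((U Ξ').toTriple s₁ s₂ s₃).Rep T s₁ s₂ s₃ (U Ξ') :=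
      Unknowns.rep_toTriple hu'.regular
    refine ⟨hrep.mem_of_isSol hu' hT hT1 hd'.regular,
      (hM.isSolution_iff hd' hrep hT.le hT1 (hkb hdB')).2 hu', fun v hv hsol => ?_⟩
    obtain ⟨w, hw⟩ := hv.exists_rep
    have hws := (hM.isSolution_iff hd' hw hT.le hT1 (hkb hdB')).1 hsol
    -- Uniqueness is stability for two solutions whose data are at distance 0.
    have hclose := (hst _ _ _ _ 0 le_rfl hd'.regular hd'.regular hdB' hdB'
      (ModelData.Close.refl hT1 le_rfl _) hws hu').1
    rw [mul_zero] at hclose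
    exact hw.eqOn hrep hclose
  · intro Ξ' hm hdist η hη
    -- 90 = 5 · 18: the Lipschitz constant is 18, and the distance of triples consists of five norms
    -- (position and velocity of X and of Y, and ℜ). The minimum with 1 keeps the distance of the
    -- data finite.
    refine ⟨min 1 (η / 90), lt_min zero_lt_one (ENNReal.div_pos hη.ne' (by norm_num)), ?_⟩
    intro Ξ'' hm' hdist' hδ
    obtain ⟨hd', hdB', hu'⟩ := hDU Ξ' hm hdist
    obtain ⟨hd'', hdB'', hu''⟩ := hDU Ξ'' hm' hdist'
    rw [lt_min_iff] at hδ
    have hfin : Ξ'.dist T s₁ s₂ ε Ξ'' ≠ ∞ := (hδ.1.trans ENNReal.one_lt_top).ne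
    have h1 := hst _ _ _ _ _ ENNReal.toReal_nonneg hd'.regular hd''.regular hdB' hdB''
      (hd'.close hd'' hT1 ENNReal.toReal_nonneg (ENNReal.ofReal_toReal hfin).ge) hu' hu''
    refine (Triple.Rep.dist_le (Unknowns.rep_toTriple hu'.regular)
      (Unknowns.rep_toTriple hu''.regular) hu' hu'' hT hT1 hd'.regular hd''.regular
      h1.1 h1.2).trans_lt ?_
    rw [ENNReal.ofReal_mul (by norm_num), ENNReal.ofReal_toReal hfin, ← mul_assoc, mul_comm]
    have h2 := ENNReal.mul_lt_of_lt_div hδ.2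
    norm_num
    exact h2

end HartreeWave

theorem mainTheorem6 (φ : ℝ → ℝ) (hφ : HartreeWave.IsBump φ) (c₀ : ℝ)
    (s₃ : ℝ) (hs₃ : -(1 / 2) < s₃) (hs₃' : s₃ < 0) :
    ∃ θ₀ : ℝ, 0 < θ₀ ∧ ∀ θ : ℝ, 0 < θ → θ ≤ θ₀ →
    ∀ β s₁ s₂ : ℝ, 2 ≤ β → 1 / 4 < s₁ → s₁ < 1 / 2 → 1 / 2 < s₂ → s₂ < 1 →
      -3 * s₁ + s₂ + 2 < β →
    ∃ ε : ℝ, 0 < ε ∧ ∀ A γ : ℝ, 2 < γ → γ ≤ 3 →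
    ∀ Ξ : HartreeWave.EnhancedData, Ξ.Mem 1 s₁ s₂ ε →
    ∃ T : ℝ, 0 < T ∧ T ≤ 1 ∧ ∃ r : ℝ≥0∞, 0 < r ∧
    ∃ Φ : HartreeWave.EnhancedData → HartreeWave.Triple,
      -- existence and uniqueness on `[0, T]`, for `Ξ` and for all data near `Ξ`
      (∀ Ξ' : HartreeWave.EnhancedData, Ξ'.Mem T s₁ s₂ ε → Ξ.dist T s₁ s₂ ε Ξ' < r →
        (Φ Ξ').Mem T s₁ s₂ s₃ ∧
        HartreeWave.IsSolution φ θ c₀ β A γ s₃ T Ξ' (Φ Ξ') ∧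
        ∀ v : HartreeWave.Triple, v.Mem T s₁ s₂ s₃ →
          HartreeWave.IsSolution φ θ c₀ β A γ s₃ T Ξ' v → v.EqOn T (Φ Ξ')) ∧
      -- continuity of the solution map
      (∀ Ξ' : HartreeWave.EnhancedData, Ξ'.Mem T s₁ s₂ ε → Ξ.dist T s₁ s₂ ε Ξ' < r →
        ∀ η : ℝ≥0∞, 0 < η → ∃ δ : ℝ≥0∞, 0 < δ ∧
        ∀ Ξ'' : HartreeWave.EnhancedData, Ξ''.Mem T s₁ s₂ ε → Ξ.dist T s₁ s₂ ε Ξ'' < r →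
          Ξ'.dist T s₁ s₂ ε Ξ'' < δ → (Φ Ξ').dist T s₁ s₂ s₃ (Φ Ξ'') < η) := by
  -- θ₀ = 1 works for every s₃, because ε is chosen after θ and below θ/8.
  refine ⟨1, one_pos, fun θ hθ hθ1 β s₁ s₂ hβ h1 h1' h2 h2' hβs => ?_⟩
  obtain ⟨p, ε, h⟩ := HartreeWave.exists_admissible hs₃ hs₃' hθ hθ1 hβ h1 h1' h2 h2' hβs
  refine ⟨ε, h.ε_pos, fun A γ hγ hγ' Ξ hΞ => ?_⟩
  obtain ⟨M, hM⟩ := h.exists_model hφ c₀ A hγ hγ'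
  exact hM.wellPosed Ξ hΞ
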